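/- Let $p$ be a real number with $p\neq 0$, fix a sign $s=\pm1$, and let $\sigma^2=\pm1$, with $\sigma=1$ or $\sigma=i$ respectively. Consider the potential 2D generalized Boussinesq equation for a real function $v(x,y,t)$, $$\Delta:=v_{tt}-v_{xx}-(v_x^{p+1})_x-s\,v_{xxxx}-\sigma^2v_{yy}=0,$$ where $v_x$ ranges over the set on which $v_x^p$ is defined and smooth (all of $\mathbb R$ if $p$ is a positive integer, $\mathbb R\setminus\{0\}$ if $p$ is a negative integer, $(0,\infty)$ otherwise). Let $M$ be a non-empty convex open subset of the space $\mathbb R^4$ of points $(x,y,t,v)$. A point symmetry on $M$ is a vector field $X=\xi^x\partial_x+\xi^y\partial_y+\tau\partial_t+\eta\,\partial_v$ whose coefficients are smooth real functions of $(x,y,t,v)\in M$ and whose prolongation satisfies $(\mathrm{pr}\,X)\Delta=0$ at every jet over $M$ at which $\Delta=0$. (i) The following vector fields on $M$, and their linear combinations, are point symmetries for every $p\neq0$: the translations $\partial_x$, $\partial_y$, $\partial_t$; the boost $y\,\partial_t+\sigma^2t\,\partial_y$; and the shifts $\big(f_1(y+\sigma t)+f_2(y-\sigma t)\big)\partial_v$.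 Here $f_1,f_2$ are smooth functions of a real variable if $\sigma=1$; they are holomorphic functions with a real-valued sum $f_1(y+it)+f_2(y-it)$ if $\sigma=i$; in both cases they are defined on the ranges of $y\pm\sigma t$ over $M$. The functions $f_1(y+\sigma t)+f_2(y-\sigma t)$ are exactly the smooth solutions $W(y,t)$ of $W_{tt}-\sigma^2W_{yy}=0$ on the projection of $M$ to the $(y,t)$-plane. If the equation is nonlinear (that is, $p\neq-1$) and $p\neq1$, then every point symmetry on $M$ is a linear combination of these vector fields. (ii) The scaling-shift $2t\,\partial_t+x\,\partial_x+2y\,\partial_y-(v+x)\,\partial_v$, which is not a linear combination of the vector fields in (i), is a point symmetry if and only if $p=1$. For $p=1$, the point symmetries on $M$ are exactly the linear combinations of it and the vector fields in (i). -/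

import Mathlib

open scoped ContDiff

namespace GB

noncomputable section

/-- The space of independent variables, with points `(x, y, t)`. -/
abbrev Base := ℝ × ℝ × ℝ

/-- The space of independent and dependent variables, with points `(x, y, t, v)`. -/
abbrev Total := ℝ × ℝ × ℝ × ℝ

/-- A vector field `ξˣ ∂ₓ + ξʸ ∂_y + τ ∂_t + η ∂_v` on `(x, y, t, v)`-space, written as the map
`(x, y, t, v) ↦ (ξˣ, ξʸ, τ, η)`. -/
abbrev Field := Total → ℝ × ℝ × ℝ × ℝ

/-- Partial derivative with respect to `x`. -/
def Dx (w : Base → ℝ) : Base → ℝ := fun q => deriv (fun r => w (r, q.2.1, q.2.2)) q.1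

/-- Partial derivative with respect to `y`. -/
def Dy (w : Base → ℝ) : Base → ℝ := fun q => deriv (fun r => w (q.1, r, q.2.2)) q.2.1

/-- Partial derivative with respect to `t`. -/
def Dt (w : Base → ℝ) : Base → ℝ := fun q => deriv (fun r => w (q.1, q.2.1, r)) q.2.2

/-- The derivative `∂ₓᵃ ∂_yᵇ ∂_tᶜ w` for the multi-index `(a, b, c)`. -/
def D (J : ℕ × ℕ × ℕ) (w : Base → ℝ) : Base → ℝ := Dx^[J.1] (Dy^[J.2.1] (Dt^[J.2.2] w))

/-- The values `v_J` of the jet coordinates, indexed by multi-indices `J = (a, b, c)`. -/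
abbrev Jet := ℕ × ℕ × ℕ → ℝ

/-- The jet of the function `v` at the point `q`. -/
def jet (v : Base → ℝ) (q : Base) : Jet := fun J => D J v q

/-- The point of the graph of `v` over `q`. -/
def graph (v : Base → ℝ) (q : Base) : Total := (q.1, q.2.1, q.2.2, v q)

/-- The characteristic `P = η - ξˣ v_x - ξʸ v_y - τ v_t` of the vector field `X`, evaluated along
the function `v`. -/
def characteristic (X : Field) (v : Base → ℝ) : Base → ℝ := fun q =>
  (X (graph v q)).2.2.2 - (X (graph v q)).1 * Dx v q - (X (graph v q)).2.1 * Dy v q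
    - (X (graph v q)).2.2.1 * Dt v q

/-- The coefficients of `∂/∂v_J` in the prolongation of `X`, at the jet of `v` at `q`:
`η^J = D_J P + ξˣ v_{J,x} + ξʸ v_{J,y} + τ v_{J,t}`. -/
def prolongation (X : Field) (v : Base → ℝ) (q : Base) : Jet := fun J =>
  D J (characteristic X v) q
    + (X (graph v q)).1 * jet v q (J.1 + 1, J.2.1, J.2.2)
    + (X (graph v q)).2.1 * jet v q (J.1, J.2.1 + 1, J.2.2)
    + (X (graph v q)).2.2.1 * jet v q (J.1, J.2.1, J.2.2 + 1)

/-- The prolongation of `X` applied to a function `F` of the jet coordinates `v_J` (with no explicit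
dependence on `x, y, t`), at the jet of `v` at `q`: the derivative of `F` along `(η^J)_J`. -/
def prolongedAction (X : Field) (F : Jet → ℝ) (v : Base → ℝ) (q : Base) : ℝ :=
  deriv (fun e : ℝ => F (jet v q + e • prolongation X v q)) 0

/-- The left-hand side `v_tt - v_xx - (v_x^(p+1))_x - s v_xxxx - ε v_yy` of the potential 2D
generalized Boussinesq equation, with `(v_x^(p+1))_x = (p+1) v_x^p v_xx`; here `s` is the sign `±`
and `ε` is `σ²`. -/
def boussinesq (p s ε : ℝ) : Jet → ℝ := fun j =>
  j (0, 0, 2) - j (2, 0, 0) - (p + 1) * j (1, 0, 0) ^ p * j (2, 0, 0)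
    - s * j (4, 0, 0) - ε * j (0, 2, 0)

/-- The real numbers at which the power with exponent `p` is defined and smooth: all of `ℝ` when `p`
is a natural number, `ℝ \ {0}` when `p` is a negative integer, `(0, ∞)` for other `p`. -/
def powDomain (p : ℝ) : Set ℝ :=
  {u | 0 < u ∨ (∃ n : ℕ, p = n) ∨ (u ≠ 0 ∧ ∃ n : ℤ, p = n)}

/-- `X` is an infinitesimal point symmetry, on the open set `M` of `(x, y, t, v)`-space: it is smooth
on `M`, and its prolongation annihilates the left-hand side of the equation at every jet that lies
over `M` and satisfies the equation. Each jet is given as the jet of a smooth function `v` at a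
point `q`; `v` need not solve the equation at other points. -/
def IsPointSymmetry (p s ε : ℝ) (M : Set Total) (X : Field) : Prop :=
  ContDiffOn ℝ ∞ X M ∧
    ∀ v : Base → ℝ, ContDiff ℝ ∞ v → ∀ q : Base, graph v q ∈ M → Dx v q ∈ powDomain p →
      boussinesq p s ε (jet v q) = 0 → prolongedAction X (boussinesq p s ε) v q = 0

/-- Translation in `x`. -/
def transX : Field := fun _ => (1, 0, 0, 0)

/-- Translation in `y`. -/
def transY : Field := fun _ => (0, 1, 0, 0)

/-- Translation in `t`. -/
def transT : Field := fun _ => (0, 0, 1, 0)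

/-- The boost `y ∂_t + ε t ∂_y`. -/
def boost (ε : ℝ) : Field := fun m => (0, ε * m.2.2.1, m.2.1, 0)

/-- The scaling-shift `x ∂ₓ + 2 y ∂_y + 2 t ∂_t - (v + x) ∂_v`. -/
def scalingShift : Field := fun m =>
  (m.1, 2 * m.2.1, 2 * m.2.2.1, -(m.2.2.2 + m.1))

/-- The functions on `M` of the form `f₁ (y + σ t) + f₂ (y - σ t)`, where `σ² = ε`.
For `ε = 1`, `f₁` and `f₂` are smooth functions of one real variable. For `ε = -1`, i.e. `σ = i`,
they are holomorphic functions of one complex variable with a real-valued sum. -/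
def travelling (ε : ℝ) (M : Set Total) : Set (Total → ℝ) :=
  {b | (ε = 1 ∧ ∃ f₁ f₂ : ℝ → ℝ,
          ContDiffOn ℝ ∞ f₁ ((fun m : Total => m.2.1 + m.2.2.1) '' M) ∧
          ContDiffOn ℝ ∞ f₂ ((fun m : Total => m.2.1 - m.2.2.1) '' M) ∧
          ∀ m ∈ M, b m = f₁ (m.2.1 + m.2.2.1) + f₂ (m.2.1 - m.2.2.1)) ∨
       (ε = -1 ∧ ∃ f₁ f₂ : ℂ → ℂ,
          DifferentiableOn ℂ f₁
            ((fun m : Total => (m.2.1 : ℂ) + Complex.I * (m.2.2.1 : ℂ)) '' M) ∧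
          DifferentiableOn ℂ f₂
            ((fun m : Total => (m.2.1 : ℂ) - Complex.I * (m.2.2.1 : ℂ)) '' M) ∧
          ∀ m ∈ M, (b m : ℂ) = f₁ ((m.2.1 : ℂ) + Complex.I * (m.2.2.1 : ℂ))
            + f₂ ((m.2.1 : ℂ) - Complex.I * (m.2.2.1 : ℂ)))}

/-- The generator `b ∂_v`. -/
def shift (b : Total → ℝ) : Field := fun m => (0, 0, 0, b m)

/-- The generators that are present for all `p`. -/
def generalGenerators (ε : ℝ) (M : Set Total) : Set Field :=
  {transX, transY, transT, boost ε} ∪ shift '' travelling ε M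

/-- On `M`, the vector field `X` is a (finite) real linear combination of elements of `S`. -/
def GeneratedBy (S : Set Field) (M : Set Total) (X : Field) : Prop :=
  ∃ Y ∈ Submodule.span ℝ S, Set.EqOn X Y M

/-- `W` is a smooth solution of `W_tt - ε W_yy = 0` on the subset `N` of the `(y, t)`-plane. -/
def IsWaveSolution (ε : ℝ) (N : Set (ℝ × ℝ)) (W : ℝ × ℝ → ℝ) : Prop :=
  ContDiffOn ℝ ∞ W N ∧ ∀ n ∈ N,
    iteratedDeriv 2 (fun t => W (n.1, t)) n.2 - ε * iteratedDeriv 2 (fun y => W (y, n.2)) n.1 = 0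

end

end GB

namespace GB

/-! The proof is Lie's algorithm with every jet realized by an explicit polynomial function.
Freezing the coefficients `ξˣ, ξʸ, τ` at the base point turns the prolongation coefficient `η^J`
into `D_J` of one function, `relChar`. The symmetry condition then says that the linearized operator
kills `relChar` at the base point (`isPointSymmetry_iff`). Since the equation has no mixed
derivatives, only the restrictions of `relChar` to the three axis-parallel lines matter. This
settles the sufficiency claims by direct computation.

For necessity, the condition is evaluated on `testFn`, whose jet coordinates are free parameters
except `v_tt`, which is solved from the equation (`determining`). The result is polynomial in the
free coordinates other than `u = v_x`, so differences of specializations isolate coefficients. Write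
`D_x, D_t` for total derivatives. The coefficients of `v_txxx` and `v_xxxy` give `D_x τ = D_x ξʸ =
0`; those of `v_tx` and `v_xy` show that `ξˣ` depends on `x` only; `v_ty` gives `ξʸ_t = ε τ_y`; the
square of `v_t` gives `η_vv = 0`; `v_yy` gives `τ_t = ξʸ_y`; `v_xxxx` gives `τ_t = 2 ξˣ_x`, so
`ξˣ_x` is constant; `v_xxx` gives `η_xv = 0`. The coefficient of `v_xx` is the classifying equation
`2 ξˣ_x (1 + (p+1)u^p) + p(p+1)u^(p-1) (η_x + u (η_v - ξˣ_x)) = 0`.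

For `p ≠ 0, 1` the functions `1, u^p, u^(p-1)` are linearly independent, which forces `ξˣ_x = 0`.
For `p = 1`, subtracting a multiple of `scalingShift` achieves the same. Once `ξˣ_x = 0` and `p ≠
-1`, the classifying equation gives `η_x = η_v = 0`, the remaining terms say that `η` solves the
wave equation, and the other coefficients integrate to translations and a boost
(`generatedBy_of_pd`). Only values `u > 0` are needed, and these are admissible for every `p`.

The general solution of `W_tt = ε W_yy` is d'Alembert's formula for `ε = 1`; for `ε = -1` a harmonic
function on a convex set is the real part of a holomorphic one. -/

theorem natCast_le_infty (n : ℕ) : (n : WithTop ℕ∞) ≤ ∞ := by exact_mod_cast le_top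

/-! ### Directional derivatives on open convex sets -/

section Calculus

variable {E : Type*} [NormedAddCommGroup E] [NormedSpace ℝ E]

/-- The directional derivative of `h` in the direction `d`. -/
noncomputable def pd (d : E) (h : E → ℝ) : E → ℝ := fun m => fderiv ℝ h m d

theorem contDiffOn_pd {M : Set E} (hM : IsOpen M) {h : E → ℝ} (hh : ContDiffOn ℝ ∞ h M) (d : E) :
    ContDiffOn ℝ ∞ (pd d h) M := by
  have := (hh.fderiv_of_isOpen hM (m := ∞) (by simp))
  exact this.clm_apply contDiffOn_const

theorem contDiffAt_of_mem {F : Type*} [NormedAddCommGroup F] [NormedSpace ℝ F] {M : Set E}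
    (hM : IsOpen M) {h : E → F} (hh : ContDiffOn ℝ ∞ h M)
    {m : E} (hm : m ∈ M) : ContDiffAt ℝ ∞ h m := hh.contDiffAt (hM.mem_nhds hm)

theorem hasFDerivAt_of_mem {F : Type*} [NormedAddCommGroup F] [NormedSpace ℝ F] {M : Set E}
    (hM : IsOpen M) {h : E → F} (hh : ContDiffOn ℝ ∞ h M)
    {m : E} (hm : m ∈ M) : HasFDerivAt h (fderiv ℝ h m) m :=
  ((contDiffAt_of_mem hM hh hm).differentiableAt (by simp)).hasFDerivAt

theorem pd_pd {M : Set E} (hM : IsOpen M) {h : E → ℝ} (hh : ContDiffOn ℝ ∞ h M) (d e : E)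
    {m : E} (hm : m ∈ M) : pd d (pd e h) m = fderiv ℝ (fderiv ℝ h) m d e := by
  have hd := hasFDerivAt_of_mem hM (hh.fderiv_of_isOpen hM (m := ∞) (by simp)) hm
  have := (hd.clm_apply (hasFDerivAt_const e m)).fderiv
  change fderiv ℝ (fun y => fderiv ℝ h y e) m d = _
  rw [this]; simp

theorem pd_comm {M : Set E} (hM : IsOpen M) {h : E → ℝ} (hh : ContDiffOn ℝ ∞ h M) (d e : E)
    {m : E} (hm : m ∈ M) : pd d (pd e h) m = pd e (pd d h) m := by
  have hs := (contDiffAt_of_mem hM hh hm).isSymmSndFDerivAt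
    (by simpa using natCast_le_infty 2)
  rw [pd_pd hM hh d e hm, pd_pd hM hh e d hm, hs.eq]

theorem pd_congr {M : Set E} (hM : IsOpen M) {g h : E → ℝ} (hgh : Set.EqOn g h M) (d : E)
    {m : E} (hm : m ∈ M) : pd d g m = pd d h m := by
  simp only [pd]
  rw [Filter.EventuallyEq.fderiv_eq (hgh.eventuallyEq_of_mem (hM.mem_nhds hm))]

theorem pd_eq_zero_of_const {M : Set E} (hM : IsOpen M) {h : E → ℝ} {c : ℝ}
    (hh : ∀ m ∈ M, h m = c) (d : E) {m : E} (hm : m ∈ M) : pd d h m = 0 := by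
  rw [pd_congr hM (h := fun _ => c) hh d hm]
  simp [pd]

theorem pd_add (d e : E) (h : E → ℝ) (m : E) : pd (d + e) h m = pd d h m + pd e h m := by
  simp [pd]

theorem pd_smul (c : ℝ) (d : E) (h : E → ℝ) (m : E) : pd (c • d) h m = c * pd d h m := by
  simp [pd]

theorem hasDerivAt_comp_curve {M : Set E} (hM : IsOpen M) {h : E → ℝ} (hh : ContDiffOn ℝ ∞ h M)
    {γ : ℝ → E} {γ' : E} {r : ℝ} (hγ : HasDerivAt γ γ' r) (hm : γ r ∈ M) :
    HasDerivAt (fun r => h (γ r)) (pd γ' h (γ r)) r :=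
  (hasFDerivAt_of_mem hM hh hm).comp_hasDerivAt r hγ

/-- The segment from `a` to `b` stays in `M`, and `h` has zero derivative along it. This is where
convexity of `M` enters: local independence of a coordinate becomes global. -/
theorem eq_of_pd_eq_zero {M : Set E} (hM : IsOpen M) (hc : Convex ℝ M) {h : E → ℝ}
    (hh : ContDiffOn ℝ ∞ h M) {a b : E} (ha : a ∈ M) (hb : b ∈ M)
    (h0 : ∀ m ∈ M, pd (b - a) h m = 0) : h a = h b := by
  have hmem : ∀ r ∈ Set.Icc (0 : ℝ) 1, a + r • (b - a) ∈ M := fun r hr =>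
    hc.add_smul_sub_mem ha hb hr
  have hd : ∀ r ∈ Set.Icc (0 : ℝ) 1, HasDerivAt (fun r : ℝ => h (a + r • (b - a))) 0 r := by
    intro r hr
    have h1 : HasDerivAt (fun r : ℝ => a + r • (b - a)) (b - a) r := by
      simpa using ((hasDerivAt_id r).smul_const (b - a)).const_add a
    have := hasDerivAt_comp_curve hM hh h1 (hmem r hr)
    rwa [h0 _ (hmem r hr)] at this
  have := constant_of_derivWithin_zero (f := fun r : ℝ => h (a + r • (b - a))) (a := 0) (b := 1)
    (fun r hr => (hd r hr).differentiableAt.differentiableWithinAt) (fun r hr => by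
      have hr' : r ∈ Set.Icc (0 : ℝ) 1 := ⟨hr.1, hr.2.le⟩
      exact (hd r hr').hasDerivWithinAt.derivWithin (uniqueDiffOn_Icc zero_lt_one r hr')) 1 (by simp)
  simpa using this.symm

theorem eq_add_pd_of_pd_pd_eq_zero {M : Set E} (hM : IsOpen M) (hc : Convex ℝ M) {h : E → ℝ}
    (hh : ContDiffOn ℝ ∞ h M) {a b : E} (ha : a ∈ M) (hb : b ∈ M)
    (h0 : ∀ m ∈ M, pd (b - a) (pd (b - a) h) m = 0) : h b = h a + pd (b - a) h a := by
  have hmem : ∀ r ∈ Set.Icc (0 : ℝ) 1, a + r • (b - a) ∈ M := fun r hr =>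
    hc.add_smul_sub_mem ha hb hr
  have hconst : ∀ r ∈ Set.Icc (0 : ℝ) 1, pd (b - a) h (a + r • (b - a)) = pd (b - a) h a :=
    fun r hr => (eq_of_pd_eq_zero hM hc (contDiffOn_pd hM hh _) ha (hmem r hr) fun m hm => by
      rw [add_sub_cancel_left, pd_smul, h0 m hm, mul_zero]).symm
  have hd : ∀ r ∈ Set.Icc (0 : ℝ) 1,
      HasDerivAt (fun r : ℝ => h (a + r • (b - a)) - r * pd (b - a) h a) 0 r := by
    intro r hr
    have h1 : HasDerivAt (fun r : ℝ => a + r • (b - a)) (b - a) r := by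
      simpa using ((hasDerivAt_id r).smul_const (b - a)).const_add a
    have := (hasDerivAt_comp_curve hM hh h1 (hmem r hr)).sub
      ((hasDerivAt_id r).mul_const (pd (b - a) h a))
    rwa [hconst r hr, one_mul, sub_self] at this
  have := constant_of_derivWithin_zero (a := 0) (b := 1)
    (fun r hr => (hd r hr).differentiableAt.differentiableWithinAt) (fun r hr => by
      have hr' : r ∈ Set.Icc (0 : ℝ) 1 := ⟨hr.1, hr.2.le⟩
      exact (hd r hr').hasDerivWithinAt.derivWithin (uniqueDiffOn_Icc zero_lt_one r hr')) 1 (by simp)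
  simp at this
  linarith

theorem pd_const_mul {h : E → ℝ} {m : E} (hh : DifferentiableAt ℝ h m) (c : ℝ) (d : E) :
    pd d (fun m => c * h m) m = c * pd d h m := by
  simp [pd, fderiv_const_mul hh]

/-- Used to straighten curves: a graph curve may be replaced by a simpler one whenever they differ
only in directions on which `h` does not depend. -/
theorem eventuallyEq_comp_curve {M : Set E} (hM : IsOpen M) (hc : Convex ℝ M) {h : E → ℝ}
    (hh : ContDiffOn ℝ ∞ h M) {γ δ : ℝ → E} {r₀ : ℝ} (hγ : ContinuousAt γ r₀)
    (hδ : ContinuousAt δ r₀) (hγ₀ : γ r₀ ∈ M) (hδ₀ : δ r₀ ∈ M)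
    (h0 : ∀ r, ∀ m ∈ M, pd (δ r - γ r) h m = 0) :
    (fun r => h (γ r)) =ᶠ[nhds r₀] fun r => h (δ r) := by
  filter_upwards [hγ.preimage_mem_nhds (hM.mem_nhds hγ₀),
    hδ.preimage_mem_nhds (hM.mem_nhds hδ₀)] with r hr hr'
  exact eq_of_pd_eq_zero hM hc hh hr hr' (h0 r)

end Calculus

/-! ### Quartic polynomials and the Leibniz rule at their centre -/

section Quartic

/-- The polynomial `a₀ + a₁ h + a₂ h² + a₃ h³ + a₄ h⁴` in `h = r - r₀`. -/
def quartic (r₀ a₀ a₁ a₂ a₃ a₄ : ℝ) : ℝ → ℝ := fun r =>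
  a₀ + a₁ * (r - r₀) + a₂ * (r - r₀) ^ 2 + a₃ * (r - r₀) ^ 3 + a₄ * (r - r₀) ^ 4

variable (r₀ a₀ a₁ a₂ a₃ a₄ : ℝ)

theorem quartic_self : quartic r₀ a₀ a₁ a₂ a₃ a₄ r₀ = a₀ := by simp [quartic]

theorem contDiff_quartic {n : WithTop ℕ∞} : ContDiff ℝ n (quartic r₀ a₀ a₁ a₂ a₃ a₄) := by
  unfold quartic; fun_prop

theorem deriv_quartic : deriv (quartic r₀ a₀ a₁ a₂ a₃ a₄) =
    quartic r₀ a₁ (2 * a₂) (3 * a₃) (4 * a₄) 0 := by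
  ext r
  have h := (hasDerivAt_id r).sub_const r₀
  have := (((h.const_mul a₁).const_add a₀).add ((h.pow 2).const_mul a₂)).add
    ((h.pow 3).const_mul a₃) |>.add ((h.pow 4).const_mul a₄)
  refine (this.congr_deriv ?_).deriv
  simp [quartic]; ring

theorem iteratedDeriv_one_mul_quartic {g : ℝ → ℝ} (hg : ContDiffAt ℝ ∞ g r₀) :
    iteratedDeriv 1 (fun r => g r * quartic r₀ a₀ a₁ a₂ a₃ a₄ r) r₀ =
      a₀ * iteratedDeriv 1 g r₀ + a₁ * g r₀ := by
  have := iteratedDeriv_mul (n := 1) (hg.of_le (natCast_le_infty _))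
    (contDiff_quartic r₀ a₀ a₁ a₂ a₃ a₄).contDiffAt
  simp only [Pi.mul_def] at this
  rw [this]
  simp [Finset.sum_range_succ, deriv_quartic, quartic_self]
  ring

theorem iteratedDeriv_two_mul_quartic {g : ℝ → ℝ} (hg : ContDiffAt ℝ ∞ g r₀) :
    iteratedDeriv 2 (fun r => g r * quartic r₀ a₀ a₁ a₂ a₃ a₄ r) r₀ =
      a₀ * iteratedDeriv 2 g r₀ + 2 * a₁ * iteratedDeriv 1 g r₀ + 2 * a₂ * g r₀ := by
  have := iteratedDeriv_mul (n := 2) (hg.of_le (natCast_le_infty _))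
    (contDiff_quartic r₀ a₀ a₁ a₂ a₃ a₄).contDiffAt
  simp only [Pi.mul_def] at this
  rw [this]
  simp [Finset.sum_range_succ, iteratedDeriv_succ', deriv_quartic, quartic_self]
  ring

theorem iteratedDeriv_four_mul_quartic {g : ℝ → ℝ} (hg : ContDiffAt ℝ ∞ g r₀) :
    iteratedDeriv 4 (fun r => g r * quartic r₀ a₀ a₁ a₂ a₃ a₄ r) r₀ =
      a₀ * iteratedDeriv 4 g r₀ + 4 * a₁ * iteratedDeriv 3 g r₀ + 12 * a₂ * iteratedDeriv 2 g r₀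
        + 24 * a₃ * iteratedDeriv 1 g r₀ + 24 * a₄ * g r₀ := by
  have := iteratedDeriv_mul (n := 4) (hg.of_le (natCast_le_infty _))
    (contDiff_quartic r₀ a₀ a₁ a₂ a₃ a₄).contDiffAt
  simp only [Pi.mul_def] at this
  rw [this]
  simp [Finset.sum_range_succ, iteratedDeriv_succ', deriv_quartic, quartic_self, Nat.choose]
  ring

end Quartic


/-! ### Jet coordinates as one-variable derivatives along axis-parallel lines -/

section Lines

theorem Dx_iterate (w : Base → ℝ) (n : ℕ) (q : Base) :
    Dx^[n] w q = iteratedDeriv n (fun r => w (r, q.2.1, q.2.2)) q.1 := by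
  induction n generalizing q with
  | zero => simp
  | succ n ih =>
    rw [Function.iterate_succ_apply', iteratedDeriv_succ, Dx]
    congr 1; ext r; exact ih (r, q.2.1, q.2.2)

theorem Dy_iterate (w : Base → ℝ) (n : ℕ) (q : Base) :
    Dy^[n] w q = iteratedDeriv n (fun r => w (q.1, r, q.2.2)) q.2.1 := by
  induction n generalizing q with
  | zero => simp
  | succ n ih =>
    rw [Function.iterate_succ_apply', iteratedDeriv_succ, Dy]
    congr 1; ext r; exact ih (q.1, r, q.2.2)

theorem Dt_iterate (w : Base → ℝ) (n : ℕ) (q : Base) :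
    Dt^[n] w q = iteratedDeriv n (fun r => w (q.1, q.2.1, r)) q.2.2 := by
  induction n generalizing q with
  | zero => simp
  | succ n ih =>
    rw [Function.iterate_succ_apply', iteratedDeriv_succ, Dt]
    congr 1; ext r; exact ih (q.1, q.2.1, r)

theorem hasDerivAt_lineX (q : Base) (r : ℝ) :
    HasDerivAt (fun r : ℝ => ((r, q.2.1, q.2.2) : Base)) (1, 0, 0) r :=
  (hasDerivAt_id r).prodMk ((hasDerivAt_const r _).prodMk (hasDerivAt_const r _))

theorem hasDerivAt_lineY (q : Base) (r : ℝ) :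
    HasDerivAt (fun r : ℝ => ((q.1, r, q.2.2) : Base)) (0, 1, 0) r :=
  (hasDerivAt_const r _).prodMk ((hasDerivAt_id r).prodMk (hasDerivAt_const r _))

theorem hasDerivAt_lineT (q : Base) (r : ℝ) :
    HasDerivAt (fun r : ℝ => ((q.1, q.2.1, r) : Base)) (0, 0, 1) r :=
  (hasDerivAt_const r _).prodMk ((hasDerivAt_const r _).prodMk (hasDerivAt_id r))

variable {v : Base → ℝ}

theorem Dx_eq_pd (hv : ContDiff ℝ ∞ v) : Dx v = pd (1, 0, 0) v := by
  ext q
  exact (hasDerivAt_comp_curve isOpen_univ hv.contDiffOn (hasDerivAt_lineX q q.1)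
    (Set.mem_univ _)).deriv

theorem Dy_eq_pd (hv : ContDiff ℝ ∞ v) : Dy v = pd (0, 1, 0) v := by
  ext q
  exact (hasDerivAt_comp_curve isOpen_univ hv.contDiffOn (hasDerivAt_lineY q q.2.1)
    (Set.mem_univ _)).deriv

theorem Dt_eq_pd (hv : ContDiff ℝ ∞ v) : Dt v = pd (0, 0, 1) v := by
  ext q
  exact (hasDerivAt_comp_curve isOpen_univ hv.contDiffOn (hasDerivAt_lineT q q.2.2)
    (Set.mem_univ _)).deriv

theorem contDiff_pd {E : Type*} [NormedAddCommGroup E] [NormedSpace ℝ E] {h : E → ℝ}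
    (hh : ContDiff ℝ ∞ h) (d : E) : ContDiff ℝ ∞ (pd d h) :=
  contDiffOn_univ.1 (contDiffOn_pd isOpen_univ hh.contDiffOn d)

theorem contDiff_Dx (hv : ContDiff ℝ ∞ v) : ContDiff ℝ ∞ (Dx v) := by
  rw [Dx_eq_pd hv]; exact contDiff_pd hv _

theorem contDiff_Dy (hv : ContDiff ℝ ∞ v) : ContDiff ℝ ∞ (Dy v) := by
  rw [Dy_eq_pd hv]; exact contDiff_pd hv _

theorem contDiff_Dt (hv : ContDiff ℝ ∞ v) : ContDiff ℝ ∞ (Dt v) := by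
  rw [Dt_eq_pd hv]; exact contDiff_pd hv _

theorem pd_comm_of_contDiff {E : Type*} [NormedAddCommGroup E] [NormedSpace ℝ E] {h : E → ℝ}
    (hh : ContDiff ℝ ∞ h) (d e : E) : pd d (pd e h) = pd e (pd d h) :=
  funext fun m => pd_comm isOpen_univ hh.contDiffOn d e (Set.mem_univ m)

theorem Dx_Dy_comm (hv : ContDiff ℝ ∞ v) : Dx (Dy v) = Dy (Dx v) := by
  rw [Dx_eq_pd (contDiff_Dy hv), Dy_eq_pd (contDiff_Dx hv), Dx_eq_pd hv, Dy_eq_pd hv,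
    pd_comm_of_contDiff hv]

theorem Dx_Dt_comm (hv : ContDiff ℝ ∞ v) : Dx (Dt v) = Dt (Dx v) := by
  rw [Dx_eq_pd (contDiff_Dt hv), Dt_eq_pd (contDiff_Dx hv), Dx_eq_pd hv, Dt_eq_pd hv,
    pd_comm_of_contDiff hv]

theorem Dy_Dt_comm (hv : ContDiff ℝ ∞ v) : Dy (Dt v) = Dt (Dy v) := by
  rw [Dy_eq_pd (contDiff_Dt hv), Dt_eq_pd (contDiff_Dy hv), Dy_eq_pd hv, Dt_eq_pd hv,
    pd_comm_of_contDiff hv]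

theorem jet_x (n : ℕ) (v : Base → ℝ) (q : Base) :
    jet v q (n, 0, 0) = iteratedDeriv n (fun r => v (r, q.2.1, q.2.2)) q.1 := Dx_iterate v n q

theorem jet_y (n : ℕ) (v : Base → ℝ) (q : Base) :
    jet v q (0, n, 0) = iteratedDeriv n (fun r => v (q.1, r, q.2.2)) q.2.1 := Dy_iterate v n q

theorem jet_t (n : ℕ) (v : Base → ℝ) (q : Base) :
    jet v q (0, 0, n) = iteratedDeriv n (fun r => v (q.1, q.2.1, r)) q.2.2 := Dt_iterate v n q

end Lines

/-! ### The prolongation as derivatives of a single function -/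

section Prolongation

/-- The characteristic of `X` minus the vector field with constant coefficients
`(ξˣ, ξʸ, τ)` taken at the point of the graph of `v` over `q`, evaluated along `v`. -/
noncomputable def relChar (X : Field) (v : Base → ℝ) (q : Base) : Base → ℝ := fun r =>
  characteristic X v r + (X (graph v q)).1 * Dx v r + (X (graph v q)).2.1 * Dy v r
    + (X (graph v q)).2.2.1 * Dt v r

variable {M : Set Total} {X Y : Field} {v : Base → ℝ} {q : Base}

theorem contDiffAt_characteristic (hM : IsOpen M) (hX : ContDiffOn ℝ ∞ X M)
    (hv : ContDiff ℝ ∞ v) (hq : graph v q ∈ M) : ContDiffAt ℝ ∞ (characteristic X v) q := by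
  have hg : ContDiff ℝ ∞ (graph v) := by unfold graph; fun_prop
  have h : ContDiffAt ℝ ∞ (fun r => X (graph v r)) q :=
    (contDiffAt_of_mem hM hX hq).comp q hg.contDiffAt
  have h1 := (contDiff_Dx hv).contDiffAt (x := q)
  have h2 := (contDiff_Dy hv).contDiffAt (x := q)
  have h3 := (contDiff_Dt hv).contDiffAt (x := q)
  unfold characteristic
  exact ((h.snd.snd.snd.sub (h.fst.mul h1)).sub (h.snd.fst.mul h2)).sub (h.snd.snd.fst.mul h3)

theorem contDiffAt_relChar (hM : IsOpen M) (hX : ContDiffOn ℝ ∞ X M)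
    (hv : ContDiff ℝ ∞ v) (hq : graph v q ∈ M) : ContDiffAt ℝ ∞ (relChar X v q) q := by
  have h0 := contDiffAt_characteristic hM hX hv hq
  have h1 := (contDiff_Dx hv).contDiffAt (x := q)
  have h2 := (contDiff_Dy hv).contDiffAt (x := q)
  have h3 := (contDiff_Dt hv).contDiffAt (x := q)
  unfold relChar
  exact ((h0.add (contDiffAt_const.mul h1)).add (contDiffAt_const.mul h2)).add
    (contDiffAt_const.mul h3)

theorem iteratedDeriv_linear_comb {f a b c : ℝ → ℝ} {r : ℝ} (hf : ContDiffAt ℝ ∞ f r)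
    (ha : ContDiffAt ℝ ∞ a r) (hb : ContDiffAt ℝ ∞ b r) (hc : ContDiffAt ℝ ∞ c r)
    (α β γ : ℝ) (n : ℕ) :
    iteratedDeriv n (fun r => f r + α * a r + β * b r + γ * c r) r =
      iteratedDeriv n f r + α * iteratedDeriv n a r + β * iteratedDeriv n b r
        + γ * iteratedDeriv n c r := by
  have hf' := hf.of_le (natCast_le_infty n)
  have ha' := ha.of_le (natCast_le_infty n)
  have hb' := hb.of_le (natCast_le_infty n)
  have hc' := hc.of_le (natCast_le_infty n)
  have ha2 : ContDiffAt ℝ n (fun r => α * a r) r := contDiffAt_const.mul ha'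
  have hb2 : ContDiffAt ℝ n (fun r => β * b r) r := contDiffAt_const.mul hb'
  have hc2 : ContDiffAt ℝ n (fun r => γ * c r) r := contDiffAt_const.mul hc'
  have e1 := iteratedDeriv_add ((hf'.add ha2).add hb2) hc2
  have e2 := iteratedDeriv_add (hf'.add ha2) hb2
  have e3 := iteratedDeriv_add hf' ha2
  simp only [Pi.add_def] at e1 e2 e3
  rw [e1, e2, e3, iteratedDeriv_const_mul_field, iteratedDeriv_const_mul_field,
    iteratedDeriv_const_mul_field]

/-- The terms `ξˣ v_{J,x} + ξʸ v_{J,y} + τ v_{J,t}` of `η^J` have coefficients fixed at the base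
point, so they equal `D_J` of the frozen part of `relChar`. -/
theorem prolongation_x (hM : IsOpen M) (hX : ContDiffOn ℝ ∞ X M)
    (hv : ContDiff ℝ ∞ v) (hq : graph v q ∈ M) (n : ℕ) :
    prolongation X v q (n, 0, 0) =
      iteratedDeriv n (fun r => relChar X v q (r, q.2.1, q.2.2)) q.1 := by
  have hl : ∀ {w : Base → ℝ}, ContDiffAt ℝ ∞ w q →
      ContDiffAt ℝ ∞ (fun r => w (r, q.2.1, q.2.2)) q.1 := fun hw =>
    ContDiffAt.comp q.1 (f := fun r => (r, q.2.1, q.2.2)) hw (by fun_prop)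
  have := iteratedDeriv_linear_comb (hl (contDiffAt_characteristic hM hX hv hq))
    (hl (contDiff_Dx hv).contDiffAt) (hl (contDiff_Dy hv).contDiffAt)
    (hl (contDiff_Dt hv).contDiffAt) (X (graph v q)).1 (X (graph v q)).2.1
    (X (graph v q)).2.2.1 n
  refine Eq.trans ?_ this.symm
  rw [← Dx_iterate, ← Dx_iterate, ← Dx_iterate, ← Dx_iterate]
  rfl

theorem prolongation_yy (hM : IsOpen M) (hX : ContDiffOn ℝ ∞ X M)
    (hv : ContDiff ℝ ∞ v) (hq : graph v q ∈ M) :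
    prolongation X v q (0, 2, 0) =
      iteratedDeriv 2 (fun r => relChar X v q (q.1, r, q.2.2)) q.2.1 := by
  have hl : ∀ {w : Base → ℝ}, ContDiffAt ℝ ∞ w q →
      ContDiffAt ℝ ∞ (fun r => w (q.1, r, q.2.2)) q.2.1 := fun hw =>
    ContDiffAt.comp q.2.1 (f := fun r => (q.1, r, q.2.2)) hw (by fun_prop)
  have := iteratedDeriv_linear_comb (hl (contDiffAt_characteristic hM hX hv hq))
    (hl (contDiff_Dx hv).contDiffAt) (hl (contDiff_Dy hv).contDiffAt)
    (hl (contDiff_Dt hv).contDiffAt) (X (graph v q)).1 (X (graph v q)).2.1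
    (X (graph v q)).2.2.1 2
  -- `D` applies `Dx` outermost, while differentiating along the `y`-line puts `Dy` outermost; the
  -- mixed derivatives have to be exchanged.
  have e : Dx (Dy (Dy v)) = Dy (Dy (Dx v)) := by
    rw [Dx_Dy_comm (contDiff_Dy hv), Dx_Dy_comm hv]
  refine Eq.trans ?_ this.symm
  rw [← Dy_iterate, ← Dy_iterate, ← Dy_iterate, ← Dy_iterate]
  change _ + _ * Dx (Dy (Dy v)) q + _ + _ = _ + _ * Dy (Dy (Dx v)) q + _ + _
  rw [e]; rfl

theorem prolongation_tt (hM : IsOpen M) (hX : ContDiffOn ℝ ∞ X M)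
    (hv : ContDiff ℝ ∞ v) (hq : graph v q ∈ M) :
    prolongation X v q (0, 0, 2) =
      iteratedDeriv 2 (fun r => relChar X v q (q.1, q.2.1, r)) q.2.2 := by
  have hl : ∀ {w : Base → ℝ}, ContDiffAt ℝ ∞ w q →
      ContDiffAt ℝ ∞ (fun r => w (q.1, q.2.1, r)) q.2.2 := fun hw =>
    ContDiffAt.comp q.2.2 (f := fun r => (q.1, q.2.1, r)) hw (by fun_prop)
  have := iteratedDeriv_linear_comb (hl (contDiffAt_characteristic hM hX hv hq))
    (hl (contDiff_Dx hv).contDiffAt) (hl (contDiff_Dy hv).contDiffAt)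
    (hl (contDiff_Dt hv).contDiffAt) (X (graph v q)).1 (X (graph v q)).2.1
    (X (graph v q)).2.2.1 2
  have e : Dx (Dt (Dt v)) = Dt (Dt (Dx v)) := by
    rw [Dx_Dt_comm (contDiff_Dt hv), Dx_Dt_comm hv]
  have e' : Dy (Dt (Dt v)) = Dt (Dt (Dy v)) := by
    rw [Dy_Dt_comm (contDiff_Dt hv), Dy_Dt_comm hv]
  refine Eq.trans ?_ this.symm
  rw [← Dt_iterate, ← Dt_iterate, ← Dt_iterate, ← Dt_iterate]
  change _ + _ * Dx (Dt (Dt v)) q + _ * Dy (Dt (Dt v)) q + _ =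
    _ + _ * Dt (Dt (Dx v)) q + _ * Dt (Dt (Dy v)) q + _
  rw [e, e']; rfl

theorem hasDerivAt_rpow_of_mem_powDomain {p u : ℝ} (hp : p ≠ 0) (hu : u ∈ powDomain p) :
    HasDerivAt (fun u : ℝ => u ^ p) (p * u ^ (p - 1)) u := by
  refine Real.hasDerivAt_rpow_const ?_
  rcases hu with h | ⟨n, h⟩ | ⟨h, -⟩
  · exact Or.inl h.ne'
  -- A natural exponent may meet `u = 0`; since `p ≠ 0` it is at least `1`, so the power is still
  -- differentiable there.
  · right
    rw [h] at hp ⊢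
    have : n ≠ 0 := by rintro rfl; simp at hp
    exact_mod_cast Nat.one_le_iff_ne_zero.2 this
  · exact Or.inl h

theorem prolongedAction_boussinesq {p : ℝ} (s ε : ℝ) (hp : p ≠ 0) (hu : Dx v q ∈ powDomain p) :
    prolongedAction X (boussinesq p s ε) v q =
      prolongation X v q (0, 0, 2) - (1 + (p + 1) * Dx v q ^ p) * prolongation X v q (2, 0, 0)
        - p * (p + 1) * Dx v q ^ (p - 1) * jet v q (2, 0, 0) * prolongation X v q (1, 0, 0)
        - s * prolongation X v q (4, 0, 0) - ε * prolongation X v q (0, 2, 0) := by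
  have hlin : ∀ J, HasDerivAt (fun e : ℝ => (jet v q + e • prolongation X v q) J)
      (prolongation X v q J) 0 := fun J => by
    simpa using ((hasDerivAt_id (0 : ℝ)).mul_const (prolongation X v q J)).const_add (jet v q J)
  have h0 : ∀ J, (jet v q + (0 : ℝ) • prolongation X v q) J = jet v q J := by simp
  have hj : jet v q (1, 0, 0) = Dx v q := rfl
  have hpow : HasDerivAt (fun e : ℝ => (jet v q + e • prolongation X v q) (1, 0, 0) ^ p)
      (p * Dx v q ^ (p - 1) * prolongation X v q (1, 0, 0)) 0 := by
    have h1 : HasDerivAt (fun u : ℝ => u ^ p) (p * Dx v q ^ (p - 1))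
        ((jet v q + (0 : ℝ) • prolongation X v q) (1, 0, 0)) := by
      rw [h0, hj]; exact hasDerivAt_rpow_of_mem_powDomain hp hu
    exact h1.comp 0 (hlin (1, 0, 0))
  have := ((((hlin (0, 0, 2)).sub (hlin (2, 0, 0))).sub
    ((hpow.const_mul (p + 1)).mul (hlin (2, 0, 0)))).sub ((hlin (4, 0, 0)).const_mul s)).sub
    ((hlin (0, 2, 0)).const_mul ε)
  refine (this.congr_deriv ?_).deriv
  rw [h0, h0, hj]
  ring

theorem prolongedAction_eq_relChar {p : ℝ} (s ε : ℝ) (hp : p ≠ 0) (hM : IsOpen M)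
    (hX : ContDiffOn ℝ ∞ X M) (hv : ContDiff ℝ ∞ v) (hq : graph v q ∈ M)
    (hu : Dx v q ∈ powDomain p) :
    prolongedAction X (boussinesq p s ε) v q =
      iteratedDeriv 2 (fun r => relChar X v q (q.1, q.2.1, r)) q.2.2
        - (1 + (p + 1) * Dx v q ^ p)
          * iteratedDeriv 2 (fun r => relChar X v q (r, q.2.1, q.2.2)) q.1
        - p * (p + 1) * Dx v q ^ (p - 1) * jet v q (2, 0, 0)
          * iteratedDeriv 1 (fun r => relChar X v q (r, q.2.1, q.2.2)) q.1
        - s * iteratedDeriv 4 (fun r => relChar X v q (r, q.2.1, q.2.2)) q.1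
        - ε * iteratedDeriv 2 (fun r => relChar X v q (q.1, r, q.2.2)) q.2.1 := by
  rw [prolongedAction_boussinesq s ε hp hu, prolongation_x hM hX hv hq, prolongation_x hM hX hv hq,
    prolongation_x hM hX hv hq, prolongation_yy hM hX hv hq, prolongation_tt hM hX hv hq]

end Prolongation


/-! ### The linearized equation -/

section Linearized

/-- The linearization of the equation at `v`, applied to `w`, at the point `q`; it only involves `w`
on the axis-parallel lines through `q`. -/
noncomputable def linearized (p s ε : ℝ) (v : Base → ℝ) (q : Base) (w : Base → ℝ) : ℝ :=
  iteratedDeriv 2 (fun r => w (q.1, q.2.1, r)) q.2.2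
    - (1 + (p + 1) * Dx v q ^ p) * iteratedDeriv 2 (fun r => w (r, q.2.1, q.2.2)) q.1
    - p * (p + 1) * Dx v q ^ (p - 1) * jet v q (2, 0, 0)
      * iteratedDeriv 1 (fun r => w (r, q.2.1, q.2.2)) q.1
    - s * iteratedDeriv 4 (fun r => w (r, q.2.1, q.2.2)) q.1
    - ε * iteratedDeriv 2 (fun r => w (q.1, r, q.2.2)) q.2.1

variable {p s ε : ℝ} {v w w' : Base → ℝ} {q : Base}

theorem continuous_lineX : Continuous (fun r : ℝ => ((r, q.2.1, q.2.2) : Base)) := by fun_prop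

theorem continuous_lineY : Continuous (fun r : ℝ => ((q.1, r, q.2.2) : Base)) := by fun_prop

theorem continuous_lineT : Continuous (fun r : ℝ => ((q.1, q.2.1, r) : Base)) := by fun_prop

theorem linearized_congr (h : w =ᶠ[nhds q] w') :
    linearized p s ε v q w = linearized p s ε v q w' := by
  have hx : (fun r => w (r, q.2.1, q.2.2)) =ᶠ[nhds q.1] fun r => w' (r, q.2.1, q.2.2) :=
    (continuous_lineX (q := q)).continuousAt.eventually h
  have hy : (fun r => w (q.1, r, q.2.2)) =ᶠ[nhds q.2.1] fun r => w' (q.1, r, q.2.2) :=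
    (continuous_lineY (q := q)).continuousAt.eventually h
  have ht : (fun r => w (q.1, q.2.1, r)) =ᶠ[nhds q.2.2] fun r => w' (q.1, q.2.1, r) :=
    (continuous_lineT (q := q)).continuousAt.eventually h
  unfold linearized
  rw [hx.iteratedDeriv_eq, hx.iteratedDeriv_eq, hx.iteratedDeriv_eq, hy.iteratedDeriv_eq,
    ht.iteratedDeriv_eq]

theorem linearized_add (hw : ContDiffAt ℝ ∞ w q) (hw' : ContDiffAt ℝ ∞ w' q) :
    linearized p s ε v q (fun r => w r + w' r) =
      linearized p s ε v q w + linearized p s ε v q w' := by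
  have key : ∀ {f g : ℝ → ℝ} {x : ℝ} (n : ℕ), ContDiffAt ℝ ∞ f x → ContDiffAt ℝ ∞ g x →
      iteratedDeriv n (fun r => f r + g r) x = iteratedDeriv n f x + iteratedDeriv n g x :=
    fun n hf hg => iteratedDeriv_add (hf.of_le (natCast_le_infty n))
      (hg.of_le (natCast_le_infty n))
  have hx : ∀ {w : Base → ℝ}, ContDiffAt ℝ ∞ w q →
      ContDiffAt ℝ ∞ (fun r => w (r, q.2.1, q.2.2)) q.1 := fun hw =>
    ContDiffAt.comp q.1 (f := fun r => (r, q.2.1, q.2.2)) hw (by fun_prop)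
  have hy : ∀ {w : Base → ℝ}, ContDiffAt ℝ ∞ w q →
      ContDiffAt ℝ ∞ (fun r => w (q.1, r, q.2.2)) q.2.1 := fun hw =>
    ContDiffAt.comp q.2.1 (f := fun r => (q.1, r, q.2.2)) hw (by fun_prop)
  have ht : ∀ {w : Base → ℝ}, ContDiffAt ℝ ∞ w q →
      ContDiffAt ℝ ∞ (fun r => w (q.1, q.2.1, r)) q.2.2 := fun hw =>
    ContDiffAt.comp q.2.2 (f := fun r => (q.1, q.2.1, r)) hw (by fun_prop)
  unfold linearized
  rw [key _ (hx hw) (hx hw'), key _ (hx hw) (hx hw'), key _ (hx hw) (hx hw'),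
    key _ (hy hw) (hy hw'), key _ (ht hw) (ht hw')]
  ring

theorem linearized_smul (c : ℝ) :
    linearized p s ε v q (fun r => c * w r) = c * linearized p s ε v q w := by
  unfold linearized
  simp only [iteratedDeriv_const_mul_field]
  ring

theorem linearized_zero : linearized p s ε v q (fun _ => 0) = 0 := by
  simp [linearized]

end Linearized

/-! ### The listed vector fields are symmetries -/

section Symmetries

variable {p s ε : ℝ} {M : Set Total} {X Y : Field}

theorem isPointSymmetry_iff (hp : p ≠ 0) (hM : IsOpen M) :
    IsPointSymmetry p s ε M X ↔ ContDiffOn ℝ ∞ X M ∧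
      ∀ v : Base → ℝ, ContDiff ℝ ∞ v → ∀ q : Base, graph v q ∈ M → Dx v q ∈ powDomain p →
        boussinesq p s ε (jet v q) = 0 → linearized p s ε v q (relChar X v q) = 0 := by
  refine and_congr_right fun hX => ?_
  refine forall_congr' fun v => forall_congr' fun hv => forall_congr' fun q =>
    forall_congr' fun hq => forall_congr' fun hu => forall_congr' fun _ => ?_
  rw [prolongedAction_eq_relChar s ε hp hM hX hv hq hu, linearized]

theorem isPointSymmetry_congr (hp : p ≠ 0) (hM : IsOpen M) (h : Set.EqOn X Y M)
    (hX : IsPointSymmetry p s ε M X) : IsPointSymmetry p s ε M Y := by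
  rw [isPointSymmetry_iff hp hM] at hX ⊢
  refine ⟨hX.1.congr fun m hm => (h hm).symm, fun v hv q hq hu hb => ?_⟩
  rw [← hX.2 v hv q hq hu hb]
  refine linearized_congr ?_
  have hg : ContinuousAt (graph v) q := by
    have := hv.continuous
    unfold graph; fun_prop
  filter_upwards [hg.preimage_mem_nhds (hM.mem_nhds hq)] with r hr
  simp only [relChar, characteristic, h hr, h hq]

theorem isPointSymmetry_add (hp : p ≠ 0) (hM : IsOpen M) (hX : IsPointSymmetry p s ε M X)
    (hY : IsPointSymmetry p s ε M Y) : IsPointSymmetry p s ε M (X + Y) := by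
  rw [isPointSymmetry_iff hp hM] at hX hY ⊢
  refine ⟨hX.1.add hY.1, fun v hv q hq hu hb => ?_⟩
  have := linearized_add (p := p) (s := s) (ε := ε) (v := v) (contDiffAt_relChar hM hX.1 hv hq)
    (contDiffAt_relChar hM hY.1 hv hq)
  rw [hX.2 v hv q hq hu hb, hY.2 v hv q hq hu hb, add_zero] at this
  rw [← this]
  congr 1; ext r
  simp only [relChar, characteristic, Pi.add_apply, Prod.fst_add, Prod.snd_add]
  ring

theorem isPointSymmetry_smul (hp : p ≠ 0) (hM : IsOpen M) (c : ℝ)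
    (hX : IsPointSymmetry p s ε M X) : IsPointSymmetry p s ε M (c • X) := by
  rw [isPointSymmetry_iff hp hM] at hX ⊢
  refine ⟨hX.1.const_smul c, fun v hv q hq hu hb => ?_⟩
  have := linearized_smul (p := p) (s := s) (ε := ε) (v := v) (q := q) (w := relChar X v q) c
  rw [hX.2 v hv q hq hu hb, mul_zero] at this
  rw [← this]
  congr 1; ext r
  simp only [relChar, characteristic, Pi.smul_apply, Prod.smul_fst, Prod.smul_snd, smul_eq_mul]
  ring

theorem isPointSymmetry_of_relChar_eq_zero (hp : p ≠ 0) (hM : IsOpen M) (hX : ContDiffOn ℝ ∞ X M)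
    (h : ∀ v q, relChar X v q = fun _ => 0) : IsPointSymmetry p s ε M X := by
  rw [isPointSymmetry_iff hp hM]
  exact ⟨hX, fun v hv q hq hu hb => by rw [h, linearized_zero]⟩

theorem isPointSymmetry_transX (hp : p ≠ 0) (hM : IsOpen M) : IsPointSymmetry p s ε M transX :=
  isPointSymmetry_of_relChar_eq_zero hp hM contDiffOn_const fun v q => by
    ext r; simp [relChar, characteristic, transX]

theorem isPointSymmetry_transY (hp : p ≠ 0) (hM : IsOpen M) : IsPointSymmetry p s ε M transY :=
  isPointSymmetry_of_relChar_eq_zero hp hM contDiffOn_const fun v q => by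
    ext r; simp [relChar, characteristic, transY]

theorem isPointSymmetry_transT (hp : p ≠ 0) (hM : IsOpen M) : IsPointSymmetry p s ε M transT :=
  isPointSymmetry_of_relChar_eq_zero hp hM contDiffOn_const fun v q => by
    ext r; simp [relChar, characteristic, transT]

theorem isPointSymmetry_of_span (hp : p ≠ 0) (hM : IsOpen M) {S : Set Field}
    (hS : ∀ Y ∈ S, IsPointSymmetry p s ε M Y) (hX : GeneratedBy S M X) :
    IsPointSymmetry p s ε M X := by
  obtain ⟨Y, hY, hXY⟩ := hX
  refine isPointSymmetry_congr hp hM hXY.symm ?_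
  clear hXY
  induction hY using Submodule.span_induction with
  | mem Y hY => exact hS Y hY
  | zero => simpa using isPointSymmetry_smul hp hM 0 (isPointSymmetry_transX (s := s) (ε := ε) hp hM)
  | add Y Z _ _ hY hZ => exact isPointSymmetry_add hp hM hY hZ
  | smul c Y _ hY => exact isPointSymmetry_smul hp hM c hY

theorem contDiff_lineX {v : Base → ℝ} (hv : ContDiff ℝ ∞ v) (q : Base) :
    ContDiff ℝ ∞ (fun r => v (r, q.2.1, q.2.2)) := hv.comp (by fun_prop)

theorem contDiff_lineY {v : Base → ℝ} (hv : ContDiff ℝ ∞ v) (q : Base) :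
    ContDiff ℝ ∞ (fun r => v (q.1, r, q.2.2)) := hv.comp (by fun_prop)

theorem contDiff_lineT {v : Base → ℝ} (hv : ContDiff ℝ ∞ v) (q : Base) :
    ContDiff ℝ ∞ (fun r => v (q.1, q.2.1, r)) := hv.comp (by fun_prop)

/-- `relChar` is `-ε (t - t₀) v_y - (y - y₀) v_t`. It vanishes on the `x`-line, and its second `t`-
and `y`-derivatives are `-2ε v_ty` and `-2 v_ty`, which cancel in `∂_t² - ε ∂_y²`. -/
theorem isPointSymmetry_boost (hp : p ≠ 0) (hM : IsOpen M) :
    IsPointSymmetry p s ε M (boost ε) := by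
  rw [isPointSymmetry_iff hp hM]
  refine ⟨by unfold boost; fun_prop, fun v hv q hq hu hb => ?_⟩
  have hrel : relChar (boost ε) v q =
      fun r => -ε * (r.2.2 - q.2.2) * Dy v r - (r.2.1 - q.2.1) * Dt v r := by
    ext r; simp only [relChar, characteristic, boost, graph]; ring
  have hx : (fun r : ℝ => relChar (boost ε) v q (r, q.2.1, q.2.2)) = fun _ => 0 := by
    rw [hrel]; ext r; simp
  have hy : (fun r : ℝ => relChar (boost ε) v q (q.1, r, q.2.2)) =
      fun r => Dt v (q.1, r, q.2.2) * quartic q.2.1 0 (-1) 0 0 0 r := by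
    rw [hrel]; ext r; simp only [quartic]; ring
  have ht : (fun r : ℝ => relChar (boost ε) v q (q.1, q.2.1, r)) =
      fun r => Dy v (q.1, q.2.1, r) * quartic q.2.2 0 (-ε) 0 0 0 r := by
    rw [hrel]; ext r; simp only [quartic]; ring
  unfold linearized
  rw [hx, hy, ht,
    iteratedDeriv_two_mul_quartic _ _ _ _ _ _ (contDiff_lineY (contDiff_Dt hv) q).contDiffAt,
    iteratedDeriv_two_mul_quartic _ _ _ _ _ _ (contDiff_lineT (contDiff_Dy hv) q).contDiffAt,
    ← Dy_iterate, ← Dy_iterate, ← Dt_iterate, ← Dt_iterate, Function.iterate_one,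
    Function.iterate_one, Dy_Dt_comm hv]
  simp
  ring

/-- Here `relChar` is `W` itself; without `x`-dependence only the wave operator survives in the
linearization. -/
theorem isPointSymmetry_shift (hp : p ≠ 0) (hM : IsOpen M) {b : Total → ℝ} {W : ℝ × ℝ → ℝ}
    (hW : IsWaveSolution ε ((fun m : Total => (m.2.1, m.2.2.1)) '' M) W)
    (hb : ∀ m ∈ M, b m = W (m.2.1, m.2.2.1)) :
    IsPointSymmetry p s ε M (shift b) := by
  have hsm : ContDiffOn ℝ ∞ (fun m : Total => W (m.2.1, m.2.2.1)) M :=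
    hW.1.comp (by fun_prop) (Set.mapsTo_image _ _)
  refine isPointSymmetry_congr (X := shift fun m => W (m.2.1, m.2.2.1)) hp hM
    (fun m hm => by simp [shift, hb m hm]) ?_
  rw [isPointSymmetry_iff hp hM]
  refine ⟨contDiffOn_const.prodMk (contDiffOn_const.prodMk (contDiffOn_const.prodMk hsm)),
    fun v hv q hq hu _ => ?_⟩
  have hrel : relChar (shift fun m => W (m.2.1, m.2.2.1)) v q = fun r => W (r.2.1, r.2.2) := by
    ext r; simp [relChar, characteristic, shift, graph]
  have := hW.2 _ (Set.mem_image_of_mem _ hq)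
  simp only [graph] at this
  rw [hrel, linearized]
  simp only [iteratedDeriv_const]
  simpa using this

/-- In terms of `w = v + x/2` the factor `1 + 2 v_x` becomes `2 w_x` and the field is a pure scaling
with weights `1, 2, 2, -1` for `x, y, t, w`. Every term of the equation then has weight `-5`. -/
theorem isPointSymmetry_scalingShift (hM : IsOpen M) :
    IsPointSymmetry 1 s ε M scalingShift := by
  rw [isPointSymmetry_iff one_ne_zero hM]
  refine ⟨by unfold scalingShift; fun_prop, fun v hv q hq hu hb => ?_⟩
  have hrel : relChar scalingShift v q = fun r => -(v r + r.1) - (r.1 - q.1) * Dx v r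
      - 2 * (r.2.1 - q.2.1) * Dy v r - 2 * (r.2.2 - q.2.2) * Dt v r := by
    ext r; simp only [relChar, characteristic, scalingShift, graph]; ring
  -- The summand `0 * 0` fills the fourth slot of `iteratedDeriv_linear_comb`.
  have hx : (fun r : ℝ => relChar scalingShift v q (r, q.2.1, q.2.2)) = fun r =>
      quartic q.1 (-q.1) (-1) 0 0 0 r + (-1) * v (r, q.2.1, q.2.2)
        + 1 * (Dx v (r, q.2.1, q.2.2) * quartic q.1 0 (-1) 0 0 0 r) + 0 * 0 := by
    rw [hrel]; ext r; simp only [quartic]; ring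
  have hy : (fun r : ℝ => relChar scalingShift v q (q.1, r, q.2.2)) = fun r =>
      quartic q.2.1 (-q.1) 0 0 0 0 r + (-1) * v (q.1, r, q.2.2)
        + 1 * (Dy v (q.1, r, q.2.2) * quartic q.2.1 0 (-2) 0 0 0 r) + 0 * 0 := by
    rw [hrel]; ext r; simp only [quartic]; ring
  have ht : (fun r : ℝ => relChar scalingShift v q (q.1, q.2.1, r)) = fun r =>
      quartic q.2.2 (-q.1) 0 0 0 0 r + (-1) * v (q.1, q.2.1, r)
        + 1 * (Dt v (q.1, q.2.1, r) * quartic q.2.2 0 (-2) 0 0 0 r) + 0 * 0 := by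
    rw [hrel]; ext r; simp only [quartic]; ring
  have cx := (contDiff_lineX hv q).contDiffAt (x := q.1)
  have cy := (contDiff_lineY hv q).contDiffAt (x := q.2.1)
  have ct := (contDiff_lineT hv q).contDiffAt (x := q.2.2)
  have cx' := (contDiff_lineX (contDiff_Dx hv) q).contDiffAt (x := q.1)
  have cy' := (contDiff_lineY (contDiff_Dy hv) q).contDiffAt (x := q.2.1)
  have ct' := (contDiff_lineT (contDiff_Dt hv) q).contDiffAt (x := q.2.2)
  have eX := iteratedDeriv_linear_comb (contDiff_quartic q.1 (-q.1) (-1) 0 0 0).contDiffAt cx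
    (cx'.mul (contDiff_quartic q.1 0 (-1) 0 0 0).contDiffAt) (contDiffAt_const (c := (0 : ℝ)))
    (-1) 1 0
  have eY := iteratedDeriv_linear_comb (contDiff_quartic q.2.1 (-q.1) 0 0 0 0).contDiffAt cy
    (cy'.mul (contDiff_quartic q.2.1 0 (-2) 0 0 0).contDiffAt) (contDiffAt_const (c := (0 : ℝ)))
    (-1) 1 0 2
  have eT := iteratedDeriv_linear_comb (contDiff_quartic q.2.2 (-q.1) 0 0 0 0).contDiffAt ct
    (ct'.mul (contDiff_quartic q.2.2 0 (-2) 0 0 0).contDiffAt) (contDiffAt_const (c := (0 : ℝ)))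
    (-1) 1 0 2
  have q1 : iteratedDeriv 1 (quartic q.1 (-q.1) (-1) 0 0 0) q.1 = -1 := by
    simp [deriv_quartic, quartic_self]
  have q2 : ∀ x a b, iteratedDeriv 2 (quartic x a b 0 0 0) x = 0 := fun x a b => by
    simp [iteratedDeriv_succ', deriv_quartic, quartic_self]
  have q4 : iteratedDeriv 4 (quartic q.1 (-q.1) (-1) 0 0 0) q.1 = 0 := by
    simp [iteratedDeriv_succ', deriv_quartic, quartic_self]
  have j1 : iteratedDeriv 1 (fun r => v (r, q.2.1, q.2.2)) q.1 = Dx v q := (jet_x 1 v q).symm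
  have dx : ∀ n, iteratedDeriv n (fun r => Dx v (r, q.2.1, q.2.2)) q.1 =
      jet v q (n + 1, 0, 0) := fun n => (Dx_iterate (Dx v) n q).symm
  have dy : ∀ n, iteratedDeriv n (fun r => Dy v (q.1, r, q.2.2)) q.2.1 =
      jet v q (0, n + 1, 0) := fun n => (Dy_iterate (Dy v) n q).symm
  have dt : ∀ n, iteratedDeriv n (fun r => Dt v (q.1, q.2.1, r)) q.2.2 =
      jet v q (0, 0, n + 1) := fun n => (Dt_iterate (Dt v) n q).symm
  have hb' : jet v q (0, 0, 2) - jet v q (2, 0, 0) - 2 * Dx v q * jet v q (2, 0, 0)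
    - s * jet v q (4, 0, 0) - ε * jet v q (0, 2, 0) = 0 := by
    rw [← hb]; simp only [boussinesq, Real.rpow_one]
    change _ = _ - _ - (1 + 1) * Dx v q * _ - _ - _
    norm_num
  unfold linearized
  rw [hx, hy, ht, eX, eX, eX, eY, eT, iteratedDeriv_one_mul_quartic _ _ _ _ _ _ cx',
    iteratedDeriv_two_mul_quartic _ _ _ _ _ _ cx', iteratedDeriv_four_mul_quartic _ _ _ _ _ _ cx',
    iteratedDeriv_two_mul_quartic _ _ _ _ _ _ cy', iteratedDeriv_two_mul_quartic _ _ _ _ _ _ ct',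
    q1, q2, q2, q2, q4, j1, ← jet_x 2, ← jet_x 4, ← jet_y, ← jet_t]
  have d0 : Dx v (q.1, q.2.1, q.2.2) = Dx v q := rfl
  simp only [Real.rpow_one, sub_self, Real.rpow_zero, d0, dx, dy, dt, zero_mul, Nat.reduceAdd]
  -- The prolonged field multiplies the left-hand side of the equation by its weight `-5`.
  linear_combination (-5) * hb'

end Symmetries


/-! ### Test functions with prescribed jets -/

section TestFunctions

/-- A function with prescribed restrictions to the axis-parallel lines through `(x₀, y₀, t₀)` of
itself and of its first derivatives. -/
noncomputable def testFn (q₀ : Base) (φ b c : ℝ → ℝ) (l n μ : ℝ) : Base → ℝ := fun q =>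
  φ q.1 + (q.2.1 - q₀.2.1) * b q.1 + (q.2.2 - q₀.2.2) * c q.1 + l / 2 * (q.2.2 - q₀.2.2) ^ 2
    + n / 2 * (q.2.1 - q₀.2.1) ^ 2 + μ * ((q.2.1 - q₀.2.1) * (q.2.2 - q₀.2.2))

variable {q₀ : Base} {φ b c : ℝ → ℝ} {l n μ : ℝ}

theorem contDiff_testFn (hφ : ContDiff ℝ ∞ φ) (hb : ContDiff ℝ ∞ b) (hc : ContDiff ℝ ∞ c) :
    ContDiff ℝ ∞ (testFn q₀ φ b c l n μ) := by
  unfold testFn; fun_prop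

theorem Dx_testFn (hφ : ContDiff ℝ ∞ φ) (hb : ContDiff ℝ ∞ b) (hc : ContDiff ℝ ∞ c) (q : Base) :
    Dx (testFn q₀ φ b c l n μ) q =
      deriv φ q.1 + (q.2.1 - q₀.2.1) * deriv b q.1 + (q.2.2 - q₀.2.2) * deriv c q.1 := by
  have h1 := (hφ.differentiable (by simp) q.1).hasDerivAt
  have h2 := (hb.differentiable (by simp) q.1).hasDerivAt
  have h3 := (hc.differentiable (by simp) q.1).hasDerivAt
  have := ((((h1.add (h2.const_mul (q.2.1 - q₀.2.1))).add (h3.const_mul (q.2.2 - q₀.2.2))).add_const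
    (l / 2 * (q.2.2 - q₀.2.2) ^ 2)).add_const (n / 2 * (q.2.1 - q₀.2.1) ^ 2)).add_const
    (μ * ((q.2.1 - q₀.2.1) * (q.2.2 - q₀.2.2)))
  exact this.deriv

theorem Dy_testFn (q : Base) :
    Dy (testFn q₀ φ b c l n μ) q =
      b q.1 + n * (q.2.1 - q₀.2.1) + μ * (q.2.2 - q₀.2.2) := by
  have h := (hasDerivAt_id q.2.1).sub_const q₀.2.1
  have := (((((h.mul_const (b q.1)).const_add (φ q.1)).add_const ((q.2.2 - q₀.2.2) * c q.1)).add_const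
    (l / 2 * (q.2.2 - q₀.2.2) ^ 2)).add ((h.pow 2).const_mul (n / 2))).add
    ((h.mul_const (q.2.2 - q₀.2.2)).const_mul μ)
  refine (this.congr_deriv ?_).deriv
  simp; ring

theorem Dt_testFn (q : Base) :
    Dt (testFn q₀ φ b c l n μ) q =
      c q.1 + l * (q.2.2 - q₀.2.2) + μ * (q.2.1 - q₀.2.1) := by
  have h := (hasDerivAt_id q.2.2).sub_const q₀.2.2
  have := ((((h.mul_const (c q.1)).const_add (φ q.1 + (q.2.1 - q₀.2.1) * b q.1)).add
    ((h.pow 2).const_mul (l / 2))).add_const (n / 2 * (q.2.1 - q₀.2.1) ^ 2)).add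
    ((h.const_mul (q.2.1 - q₀.2.1)).const_mul μ)
  refine (this.congr_deriv ?_).deriv
  simp; ring

end TestFunctions

/-! ### Derivatives of the characteristic along a line -/

section LineDerivatives

variable {r₀ : ℝ} {f g h k : ℝ → ℝ}

theorem iteratedDeriv_sub_const {f : ℝ → ℝ} {n : ℕ} (hn : 0 < n) (c r : ℝ) :
    iteratedDeriv n (fun r => f r - c) r = iteratedDeriv n f r := by
  have := iteratedDeriv_const_add (f := f) (x := r) hn (-c)
  rw [← this]
  congr 1; ext r; ring

theorem iteratedDeriv_sub_three {n : ℕ} (hf : ContDiffAt ℝ ∞ f r₀) (hg : ContDiffAt ℝ ∞ g r₀)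
    (hh : ContDiffAt ℝ ∞ h r₀) (hk : ContDiffAt ℝ ∞ k r₀) :
    iteratedDeriv n (fun r => f r - g r - h r - k r) r₀ = iteratedDeriv n f r₀
      - iteratedDeriv n g r₀ - iteratedDeriv n h r₀ - iteratedDeriv n k r₀ := by
  have := iteratedDeriv_linear_comb hf hg hh hk (-1) (-1) (-1) n
  simp only [neg_one_mul, ← sub_eq_add_neg] at this
  exact this

variable (a₀ a₁ a₂ a₃ a₄ b₀ b₁ b₂ b₃ b₄ c₀ c₁ c₂ c₃ c₄ : ℝ)

theorem contDiffAt_sub_const_mul_quartic (hf : ContDiffAt ℝ ∞ f r₀) (d : ℝ) :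
    ContDiffAt ℝ ∞ (fun r => (f r - d) * quartic r₀ a₀ a₁ a₂ a₃ a₄ r) r₀ :=
  (hf.sub contDiffAt_const).mul (contDiff_quartic r₀ a₀ a₁ a₂ a₃ a₄).contDiffAt

/-- In the application `f, g, h, k` are `η, ξˣ, ξʸ, τ` along a line and the quartics are `v_x, v_y,
v_t`. Because `g - g r₀` and its analogues vanish at `r₀`, the highest derivative of each quartic
drops out, so `η^J` has no jet coordinates of order above that of `J`. -/
theorem iteratedDeriv_one_lineChar (hf : ContDiffAt ℝ ∞ f r₀) (hg : ContDiffAt ℝ ∞ g r₀)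
    (hh : ContDiffAt ℝ ∞ h r₀) (hk : ContDiffAt ℝ ∞ k r₀) :
    iteratedDeriv 1 (fun r => f r - (g r - g r₀) * quartic r₀ a₀ a₁ a₂ a₃ a₄ r
      - (h r - h r₀) * quartic r₀ b₀ b₁ b₂ b₃ b₄ r
      - (k r - k r₀) * quartic r₀ c₀ c₁ c₂ c₃ c₄ r) r₀ =
    iteratedDeriv 1 f r₀ - a₀ * iteratedDeriv 1 g r₀ - b₀ * iteratedDeriv 1 h r₀
      - c₀ * iteratedDeriv 1 k r₀ := by
  rw [iteratedDeriv_sub_three hf (contDiffAt_sub_const_mul_quartic _ _ _ _ _ hg _)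
    (contDiffAt_sub_const_mul_quartic _ _ _ _ _ hh _)
    (contDiffAt_sub_const_mul_quartic _ _ _ _ _ hk _),
    iteratedDeriv_one_mul_quartic _ _ _ _ _ _ (hg.sub contDiffAt_const),
    iteratedDeriv_one_mul_quartic _ _ _ _ _ _ (hh.sub contDiffAt_const),
    iteratedDeriv_one_mul_quartic _ _ _ _ _ _ (hk.sub contDiffAt_const),
    iteratedDeriv_sub_const one_pos, iteratedDeriv_sub_const one_pos,
    iteratedDeriv_sub_const one_pos]
  ring

theorem iteratedDeriv_two_lineChar (hf : ContDiffAt ℝ ∞ f r₀) (hg : ContDiffAt ℝ ∞ g r₀)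
    (hh : ContDiffAt ℝ ∞ h r₀) (hk : ContDiffAt ℝ ∞ k r₀) :
    iteratedDeriv 2 (fun r => f r - (g r - g r₀) * quartic r₀ a₀ a₁ a₂ a₃ a₄ r
      - (h r - h r₀) * quartic r₀ b₀ b₁ b₂ b₃ b₄ r
      - (k r - k r₀) * quartic r₀ c₀ c₁ c₂ c₃ c₄ r) r₀ =
    iteratedDeriv 2 f r₀ - (a₀ * iteratedDeriv 2 g r₀ + 2 * a₁ * iteratedDeriv 1 g r₀)
      - (b₀ * iteratedDeriv 2 h r₀ + 2 * b₁ * iteratedDeriv 1 h r₀)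
      - (c₀ * iteratedDeriv 2 k r₀ + 2 * c₁ * iteratedDeriv 1 k r₀) := by
  rw [iteratedDeriv_sub_three hf (contDiffAt_sub_const_mul_quartic _ _ _ _ _ hg _)
    (contDiffAt_sub_const_mul_quartic _ _ _ _ _ hh _)
    (contDiffAt_sub_const_mul_quartic _ _ _ _ _ hk _),
    iteratedDeriv_two_mul_quartic _ _ _ _ _ _ (hg.sub contDiffAt_const),
    iteratedDeriv_two_mul_quartic _ _ _ _ _ _ (hh.sub contDiffAt_const),
    iteratedDeriv_two_mul_quartic _ _ _ _ _ _ (hk.sub contDiffAt_const)]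
  simp only [iteratedDeriv_sub_const one_pos, iteratedDeriv_sub_const two_pos]
  ring

theorem iteratedDeriv_four_lineChar (hf : ContDiffAt ℝ ∞ f r₀) (hg : ContDiffAt ℝ ∞ g r₀)
    (hh : ContDiffAt ℝ ∞ h r₀) (hk : ContDiffAt ℝ ∞ k r₀) :
    iteratedDeriv 4 (fun r => f r - (g r - g r₀) * quartic r₀ a₀ a₁ a₂ a₃ a₄ r
      - (h r - h r₀) * quartic r₀ b₀ b₁ b₂ b₃ b₄ r
      - (k r - k r₀) * quartic r₀ c₀ c₁ c₂ c₃ c₄ r) r₀ =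
    iteratedDeriv 4 f r₀
      - (a₀ * iteratedDeriv 4 g r₀ + 4 * a₁ * iteratedDeriv 3 g r₀ + 12 * a₂ * iteratedDeriv 2 g r₀
        + 24 * a₃ * iteratedDeriv 1 g r₀)
      - (b₀ * iteratedDeriv 4 h r₀ + 4 * b₁ * iteratedDeriv 3 h r₀ + 12 * b₂ * iteratedDeriv 2 h r₀
        + 24 * b₃ * iteratedDeriv 1 h r₀)
      - (c₀ * iteratedDeriv 4 k r₀ + 4 * c₁ * iteratedDeriv 3 k r₀ + 12 * c₂ * iteratedDeriv 2 k r₀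
        + 24 * c₃ * iteratedDeriv 1 k r₀) := by
  rw [iteratedDeriv_sub_three hf (contDiffAt_sub_const_mul_quartic _ _ _ _ _ hg _)
    (contDiffAt_sub_const_mul_quartic _ _ _ _ _ hh _)
    (contDiffAt_sub_const_mul_quartic _ _ _ _ _ hk _),
    iteratedDeriv_four_mul_quartic _ _ _ _ _ _ (hg.sub contDiffAt_const),
    iteratedDeriv_four_mul_quartic _ _ _ _ _ _ (hh.sub contDiffAt_const),
    iteratedDeriv_four_mul_quartic _ _ _ _ _ _ (hk.sub contDiffAt_const)]
  simp only [iteratedDeriv_sub_const one_pos, iteratedDeriv_sub_const two_pos,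
    iteratedDeriv_sub_const three_pos, iteratedDeriv_sub_const four_pos]
  ring

end LineDerivatives

/-! ### The symmetry condition with free jet parameters -/

section Determining

/-- The coefficient of `∂ₓ`. -/
def coeffX (X : Field) : Total → ℝ := fun m => (X m).1

/-- The coefficient of `∂_y`. -/
def coeffY (X : Field) : Total → ℝ := fun m => (X m).2.1

/-- The coefficient of `∂_t`. -/
def coeffT (X : Field) : Total → ℝ := fun m => (X m).2.2.1

/-- The coefficient of `∂_v`. -/
def coeffV (X : Field) : Total → ℝ := fun m => (X m).2.2.2

/-- A curve over the line through `m` in the direction of `x`. -/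
def curveX (m : Total) (φ : ℝ → ℝ) : ℝ → Total := fun r => (r, m.2.1, m.2.2.1, φ r)

/-- A curve over the line through `m` in the direction of `y`. -/
def curveY (m : Total) (φ : ℝ → ℝ) : ℝ → Total := fun r => (m.1, r, m.2.2.1, φ r)

/-- A curve over the line through `m` in the direction of `t`. -/
def curveT (m : Total) (φ : ℝ → ℝ) : ℝ → Total := fun r => (m.1, m.2.1, r, φ r)

variable {p s ε : ℝ} {M : Set Total} {X : Field}

theorem contDiffOn_coeffX (hX : ContDiffOn ℝ ∞ X M) : ContDiffOn ℝ ∞ (coeffX X) M := hX.fst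

theorem contDiffOn_coeffY (hX : ContDiffOn ℝ ∞ X M) : ContDiffOn ℝ ∞ (coeffY X) M := hX.snd.fst

theorem contDiffOn_coeffT (hX : ContDiffOn ℝ ∞ X M) : ContDiffOn ℝ ∞ (coeffT X) M := hX.snd.snd.fst

theorem contDiffOn_coeffV (hX : ContDiffOn ℝ ∞ X M) : ContDiffOn ℝ ∞ (coeffV X) M := hX.snd.snd.snd

variable {m : Total} {φ : ℝ → ℝ} {h : Total → ℝ}

theorem curveX_self (hφ : φ m.1 = m.2.2.2) : curveX m φ m.1 = m := by simp [curveX, hφ]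

theorem curveY_self (hφ : φ m.2.1 = m.2.2.2) : curveY m φ m.2.1 = m := by simp [curveY, hφ]

theorem curveT_self (hφ : φ m.2.2.1 = m.2.2.2) : curveT m φ m.2.2.1 = m := by simp [curveT, hφ]

theorem contDiffAt_comp_curveX (hM : IsOpen M) (hh : ContDiffOn ℝ ∞ h M) (hm : m ∈ M)
    (hc : ContDiff ℝ ∞ φ) (hφ : φ m.1 = m.2.2.2) :
    ContDiffAt ℝ ∞ (fun r => h (curveX m φ r)) m.1 :=
  ContDiffAt.comp m.1 (f := curveX m φ)
    (contDiffAt_of_mem hM hh (by rwa [curveX_self hφ])) (by unfold curveX; fun_prop)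

theorem contDiffAt_comp_curveY (hM : IsOpen M) (hh : ContDiffOn ℝ ∞ h M) (hm : m ∈ M)
    (hc : ContDiff ℝ ∞ φ) (hφ : φ m.2.1 = m.2.2.2) :
    ContDiffAt ℝ ∞ (fun r => h (curveY m φ r)) m.2.1 :=
  ContDiffAt.comp m.2.1 (f := curveY m φ)
    (contDiffAt_of_mem hM hh (by rwa [curveY_self hφ])) (by unfold curveY; fun_prop)

theorem contDiffAt_comp_curveT (hM : IsOpen M) (hh : ContDiffOn ℝ ∞ h M) (hm : m ∈ M)
    (hc : ContDiff ℝ ∞ φ) (hφ : φ m.2.2.1 = m.2.2.2) :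
    ContDiffAt ℝ ∞ (fun r => h (curveT m φ r)) m.2.2.1 :=
  ContDiffAt.comp m.2.2.1 (f := curveT m φ)
    (contDiffAt_of_mem hM hh (by rwa [curveT_self hφ])) (by unfold curveT; fun_prop)

/-- The infinitesimal invariance condition for the jets of the functions `testFn` with quartic
coefficients. -/
theorem determining (hp : p ≠ 0) (hM : IsOpen M) (hX : IsPointSymmetry p s ε M X) (hm : m ∈ M)
    {u : ℝ} (hu : u ∈ powDomain p) (k₂ k₃ k₄ b₀ b₁ b₃ c₀ c₁ c₃ n μ l : ℝ)
    (hl : l = (1 + (p + 1) * u ^ p) * (2 * k₂) + s * (24 * k₄) + ε * n) {γx γy γt : ℝ → Total}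
    (hγx : γx = curveX m (quartic m.1 m.2.2.2 u k₂ k₃ k₄))
    (hγy : γy = curveY m (quartic m.2.1 m.2.2.2 b₀ (n / 2) 0 0))
    (hγt : γt = curveT m (quartic m.2.2.1 m.2.2.2 c₀ (l / 2) 0 0)) :
    (iteratedDeriv 2 (fun r => coeffV X (γt r)) m.2.2.1
      - (u * iteratedDeriv 2 (fun r => coeffX X (γt r)) m.2.2.1
        + 2 * c₁ * iteratedDeriv 1 (fun r => coeffX X (γt r)) m.2.2.1)
      - (b₀ * iteratedDeriv 2 (fun r => coeffY X (γt r)) m.2.2.1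
        + 2 * μ * iteratedDeriv 1 (fun r => coeffY X (γt r)) m.2.2.1)
      - (c₀ * iteratedDeriv 2 (fun r => coeffT X (γt r)) m.2.2.1
        + 2 * l * iteratedDeriv 1 (fun r => coeffT X (γt r)) m.2.2.1))
    - (1 + (p + 1) * u ^ p) * (iteratedDeriv 2 (fun r => coeffV X (γx r)) m.1
      - (u * iteratedDeriv 2 (fun r => coeffX X (γx r)) m.1
        + 2 * (2 * k₂) * iteratedDeriv 1 (fun r => coeffX X (γx r)) m.1)
      - (b₀ * iteratedDeriv 2 (fun r => coeffY X (γx r)) m.1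
        + 2 * b₁ * iteratedDeriv 1 (fun r => coeffY X (γx r)) m.1)
      - (c₀ * iteratedDeriv 2 (fun r => coeffT X (γx r)) m.1
        + 2 * c₁ * iteratedDeriv 1 (fun r => coeffT X (γx r)) m.1))
    - p * (p + 1) * u ^ (p - 1) * (2 * k₂) * (iteratedDeriv 1 (fun r => coeffV X (γx r)) m.1
      - u * iteratedDeriv 1 (fun r => coeffX X (γx r)) m.1
      - b₀ * iteratedDeriv 1 (fun r => coeffY X (γx r)) m.1
      - c₀ * iteratedDeriv 1 (fun r => coeffT X (γx r)) m.1)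
    - s * (iteratedDeriv 4 (fun r => coeffV X (γx r)) m.1
      - (u * iteratedDeriv 4 (fun r => coeffX X (γx r)) m.1
        + 4 * (2 * k₂) * iteratedDeriv 3 (fun r => coeffX X (γx r)) m.1
        + 12 * (3 * k₃) * iteratedDeriv 2 (fun r => coeffX X (γx r)) m.1
        + 24 * (4 * k₄) * iteratedDeriv 1 (fun r => coeffX X (γx r)) m.1)
      - (b₀ * iteratedDeriv 4 (fun r => coeffY X (γx r)) m.1
        + 4 * b₁ * iteratedDeriv 3 (fun r => coeffY X (γx r)) m.1
        + 12 * 0 * iteratedDeriv 2 (fun r => coeffY X (γx r)) m.1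
        + 24 * b₃ * iteratedDeriv 1 (fun r => coeffY X (γx r)) m.1)
      - (c₀ * iteratedDeriv 4 (fun r => coeffT X (γx r)) m.1
        + 4 * c₁ * iteratedDeriv 3 (fun r => coeffT X (γx r)) m.1
        + 12 * 0 * iteratedDeriv 2 (fun r => coeffT X (γx r)) m.1
        + 24 * c₃ * iteratedDeriv 1 (fun r => coeffT X (γx r)) m.1))
    - ε * (iteratedDeriv 2 (fun r => coeffV X (γy r)) m.2.1
      - (u * iteratedDeriv 2 (fun r => coeffX X (γy r)) m.2.1
        + 2 * b₁ * iteratedDeriv 1 (fun r => coeffX X (γy r)) m.2.1)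
      - (b₀ * iteratedDeriv 2 (fun r => coeffY X (γy r)) m.2.1
        + 2 * n * iteratedDeriv 1 (fun r => coeffY X (γy r)) m.2.1)
      - (c₀ * iteratedDeriv 2 (fun r => coeffT X (γy r)) m.2.1
        + 2 * μ * iteratedDeriv 1 (fun r => coeffT X (γy r)) m.2.1)) = 0 := by
  have hX' := ((isPointSymmetry_iff hp hM).1 hX).2
  have hsm := hX.1
  set φ := quartic m.1 m.2.2.2 u k₂ k₃ k₄ with hφ
  -- `b` and `c` are `v_y` and `v_t` on the `x`-line, so `v_xy = b₁`, `v_xxxy = 6 b₃`, `v_tx = c₁`,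
  -- `v_txxx = 6 c₃`. The coordinates `v_xxy` and `v_txx` are not needed and are set to zero.
  set b := quartic m.1 b₀ b₁ 0 b₃ 0 with hb
  set c := quartic m.1 c₀ c₁ 0 c₃ 0 with hc
  have cφ : ContDiff ℝ ∞ φ := contDiff_quartic ..
  have cb : ContDiff ℝ ∞ b := contDiff_quartic ..
  have cc : ContDiff ℝ ∞ c := contDiff_quartic ..
  set q : Base := (m.1, m.2.1, m.2.2.1) with hq
  set v := testFn q φ b c l n μ with hv
  have hφ0 : φ m.1 = m.2.2.2 := quartic_self ..
  have hb0 : b m.1 = b₀ := quartic_self ..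
  have hc0 : c m.1 = c₀ := quartic_self ..
  have dφ : deriv φ = quartic m.1 u (2 * k₂) (3 * k₃) (4 * k₄) 0 := deriv_quartic ..
  have db : deriv b m.1 = b₁ := by rw [hb, deriv_quartic, quartic_self]
  have dc : deriv c m.1 = c₁ := by rw [hc, deriv_quartic, quartic_self]
  have dφ0 : deriv φ m.1 = u := by rw [dφ, quartic_self]
  have vx : ∀ r, v (r, m.2.1, m.2.2.1) = φ r := fun r => by simp [hv, testFn, hq]
  have vy : ∀ r, v (m.1, r, m.2.2.1) = quartic m.2.1 m.2.2.2 b₀ (n / 2) 0 0 r := fun r => by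
    simp [hv, testFn, hq, quartic, hφ0, hb0]; ring
  have vt : ∀ r, v (m.1, m.2.1, r) = quartic m.2.2.1 m.2.2.2 c₀ (l / 2) 0 0 r := fun r => by
    simp [hv, testFn, hq, quartic, hφ0, hc0]; ring
  have gx : ∀ r, graph v (r, m.2.1, m.2.2.1) = γx r := fun r => by
    simp [graph, hγx, curveX, vx]
  have gy : ∀ r, graph v (m.1, r, m.2.2.1) = γy r := fun r => by
    simp [graph, hγy, curveY, vy]
  have gt : ∀ r, graph v (m.1, m.2.1, r) = γt r := fun r => by
    simp [graph, hγt, curveT, vt]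
  have gm : graph v q = m := by rw [hq, gx, hγx, curveX_self hφ0]
  have mx : γx m.1 = m := by rw [hγx, curveX_self hφ0]
  have my : γy m.2.1 = m := by rw [hγy, curveY_self (quartic_self ..)]
  have mt : γt m.2.2.1 = m := by rw [hγt, curveT_self (quartic_self ..)]
  have hux : Dx v q = u := by rw [hv, Dx_testFn cφ cb cc]; simp [hq, dφ0]
  have j2 : jet v q (2, 0, 0) = 2 * k₂ := by
    rw [jet_x]; simp only [hq, vx]
    simp [iteratedDeriv_succ', hφ, deriv_quartic, quartic_self]
  have j4 : jet v q (4, 0, 0) = 24 * k₄ := by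
    rw [jet_x]; simp only [hq, vx]
    simp [iteratedDeriv_succ', hφ, deriv_quartic, quartic_self]; ring
  have jy : jet v q (0, 2, 0) = n := by
    rw [jet_y]; simp only [hq, vy]
    simp [iteratedDeriv_succ', deriv_quartic, quartic_self]; ring
  have jt : jet v q (0, 0, 2) = l := by
    rw [jet_t]; simp only [hq, vt]
    simp [iteratedDeriv_succ', deriv_quartic, quartic_self]; ring
  have j1 : jet v q (1, 0, 0) = u := hux
  -- With `v_xx = 2 k₂`, `v_xxxx = 24 k₄` and `v_yy = n`, the choice `v_tt = l` in `hl` puts the jet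
  -- on the equation, whatever the other parameters.
  have key := hX' v (contDiff_testFn cφ cb cc) q (gm ▸ hm) (hux ▸ hu) (by
    simp only [boussinesq, j1, j2, j4, jy, jt, hl]; ring)
  have lx : (fun r => relChar X v q (r, q.2.1, q.2.2)) = fun r => coeffV X (γx r)
      - (coeffX X (γx r) - coeffX X (γx m.1)) * quartic m.1 u (2 * k₂) (3 * k₃) (4 * k₄) 0 r
      - (coeffY X (γx r) - coeffY X (γx m.1)) * quartic m.1 b₀ b₁ 0 b₃ 0 r
      - (coeffT X (γx r) - coeffT X (γx m.1)) * quartic m.1 c₀ c₁ 0 c₃ 0 r := by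
    ext r
    have e1 : Dx v (r, m.2.1, m.2.2.1) = quartic m.1 u (2 * k₂) (3 * k₃) (4 * k₄) 0 r := by
      rw [hv, Dx_testFn cφ cb cc, dφ]; simp [hq]
    have e2 : Dy v (r, m.2.1, m.2.2.1) = b r := by rw [hv, Dy_testFn]; simp [hq]
    have e3 : Dt v (r, m.2.1, m.2.2.1) = c r := by rw [hv, Dt_testFn]; simp [hq]
    simp only [relChar, characteristic, hq, gx, e1, e2, e3, mx, coeffX, coeffY, coeffT, coeffV]
    ring
  have ly : (fun r => relChar X v q (q.1, r, q.2.2)) = fun r => coeffV X (γy r)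
      - (coeffX X (γy r) - coeffX X (γy m.2.1)) * quartic m.2.1 u b₁ 0 0 0 r
      - (coeffY X (γy r) - coeffY X (γy m.2.1)) * quartic m.2.1 b₀ n 0 0 0 r
      - (coeffT X (γy r) - coeffT X (γy m.2.1)) * quartic m.2.1 c₀ μ 0 0 0 r := by
    ext r
    have e1 : Dx v (m.1, r, m.2.2.1) = quartic m.2.1 u b₁ 0 0 0 r := by
      rw [hv, Dx_testFn cφ cb cc]; simp [hq, dφ0, db, quartic]; ring
    have e2 : Dy v (m.1, r, m.2.2.1) = quartic m.2.1 b₀ n 0 0 0 r := by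
      rw [hv, Dy_testFn]; simp [hq, quartic, hb0]
    have e3 : Dt v (m.1, r, m.2.2.1) = quartic m.2.1 c₀ μ 0 0 0 r := by
      rw [hv, Dt_testFn]; simp [hq, quartic, hc0]
    simp only [relChar, characteristic, hq, gy, e1, e2, e3, my, coeffX, coeffY, coeffT, coeffV]
    ring
  have lt : (fun r => relChar X v q (q.1, q.2.1, r)) = fun r => coeffV X (γt r)
      - (coeffX X (γt r) - coeffX X (γt m.2.2.1)) * quartic m.2.2.1 u c₁ 0 0 0 r
      - (coeffY X (γt r) - coeffY X (γt m.2.2.1)) * quartic m.2.2.1 b₀ μ 0 0 0 r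
      - (coeffT X (γt r) - coeffT X (γt m.2.2.1)) * quartic m.2.2.1 c₀ l 0 0 0 r := by
    ext r
    have e1 : Dx v (m.1, m.2.1, r) = quartic m.2.2.1 u c₁ 0 0 0 r := by
      rw [hv, Dx_testFn cφ cb cc]; simp [hq, dφ0, dc, quartic]; ring
    have e2 : Dy v (m.1, m.2.1, r) = quartic m.2.2.1 b₀ μ 0 0 0 r := by
      rw [hv, Dy_testFn]; simp [hq, quartic, hb0]
    have e3 : Dt v (m.1, m.2.1, r) = quartic m.2.2.1 c₀ l 0 0 0 r := by
      rw [hv, Dt_testFn]; simp [hq, quartic, hc0]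
    simp only [relChar, characteristic, hq, gt, e1, e2, e3, mt, coeffX, coeffY, coeffT, coeffV]
    ring
  have sx : ∀ {h : Total → ℝ}, ContDiffOn ℝ ∞ h M → ContDiffAt ℝ ∞ (fun r => h (γx r)) m.1 :=
    fun hh => hγx ▸ contDiffAt_comp_curveX hM hh hm (contDiff_quartic ..) (quartic_self ..)
  have sy : ∀ {h : Total → ℝ}, ContDiffOn ℝ ∞ h M → ContDiffAt ℝ ∞ (fun r => h (γy r)) m.2.1 :=
    fun hh => hγy ▸ contDiffAt_comp_curveY hM hh hm (contDiff_quartic ..) (quartic_self ..)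
  have st : ∀ {h : Total → ℝ}, ContDiffOn ℝ ∞ h M → ContDiffAt ℝ ∞ (fun r => h (γt r)) m.2.2.1 :=
    fun hh => hγt ▸ contDiffAt_comp_curveT hM hh hm (contDiff_quartic ..) (quartic_self ..)
  have hξ := contDiffOn_coeffX hsm
  have hζ := contDiffOn_coeffY hsm
  have hτ := contDiffOn_coeffT hsm
  have hη := contDiffOn_coeffV hsm
  rw [linearized, lx, ly, lt, j2, hux] at key
  have h1 := iteratedDeriv_one_lineChar u (2 * k₂) (3 * k₃) (4 * k₄) 0 b₀ b₁ 0 b₃ 0 c₀ c₁ 0 c₃ 0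
    (sx hη) (sx hξ) (sx hζ) (sx hτ)
  have h2 := iteratedDeriv_two_lineChar u (2 * k₂) (3 * k₃) (4 * k₄) 0 b₀ b₁ 0 b₃ 0 c₀ c₁ 0 c₃ 0
    (sx hη) (sx hξ) (sx hζ) (sx hτ)
  have h4 := iteratedDeriv_four_lineChar u (2 * k₂) (3 * k₃) (4 * k₄) 0 b₀ b₁ 0 b₃ 0 c₀ c₁ 0 c₃ 0
    (sx hη) (sx hξ) (sx hζ) (sx hτ)
  have hy := iteratedDeriv_two_lineChar u b₁ 0 0 0 b₀ n 0 0 0 c₀ μ 0 0 0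
    (sy hη) (sy hξ) (sy hζ) (sy hτ)
  have ht := iteratedDeriv_two_lineChar u c₁ 0 0 0 b₀ μ 0 0 0 c₀ l 0 0 0
    (st hη) (st hξ) (st hζ) (st hτ)
  rw [← h1, ← h2, ← h4, ← hy, ← ht]
  exact key

end Determining


/-! ### Derivatives of functions along curves -/

section Curves

variable {E : Type*} [NormedAddCommGroup E] [NormedSpace ℝ E] {M : Set E} {h : E → ℝ}
  {γ : ℝ → E} {r₀ : ℝ}

theorem iteratedDeriv_comp_curve_eq_zero (hM : IsOpen M) (hc : Convex ℝ M)
    (hh : ContDiffOn ℝ ∞ h M) (hγ : ContinuousAt γ r₀) (hγ₀ : γ r₀ ∈ M)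
    (h0 : ∀ r, ∀ m ∈ M, pd (γ r₀ - γ r) h m = 0) {n : ℕ} (hn : 0 < n) :
    iteratedDeriv n (fun r => h (γ r)) r₀ = 0 := by
  rw [(eventuallyEq_comp_curve hM hc hh hγ (continuousAt_const (y := γ r₀)) hγ₀ hγ₀
    h0).iteratedDeriv_eq, iteratedDeriv_const, if_neg hn.ne']

theorem iteratedDeriv_one_comp_curve (hM : IsOpen M) (hh : ContDiffOn ℝ ∞ h M) {d : E}
    (hγ : HasDerivAt γ d r₀) (hγ₀ : γ r₀ ∈ M) :
    iteratedDeriv 1 (fun r => h (γ r)) r₀ = pd d h (γ r₀) := by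
  rw [iteratedDeriv_one]
  exact (hasDerivAt_comp_curve hM hh hγ hγ₀).deriv

theorem iteratedDeriv_two_comp_line (hM : IsOpen M) (hh : ContDiffOn ℝ ∞ h M) {d : E}
    (hγ : ∀ r, HasDerivAt γ d r) (hγ₀ : γ r₀ ∈ M) :
    iteratedDeriv 2 (fun r => h (γ r)) r₀ = pd d (pd d h) (γ r₀) := by
  rw [iteratedDeriv_succ', ← iteratedDeriv_one_comp_curve hM (contDiffOn_pd hM hh d) (hγ r₀) hγ₀]
  refine Filter.EventuallyEq.iteratedDeriv_eq 1 ?_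
  filter_upwards [(hγ r₀).continuousAt.preimage_mem_nhds (hM.mem_nhds hγ₀)] with r hr
  exact (hasDerivAt_comp_curve hM hh (hγ r) hr).deriv

end Curves

/-! ### Curves over axis-parallel lines in `(x, y, t, v)`-space -/

section CurvesInTotal

variable {M : Set Total} {m : Total} {φ : ℝ → ℝ} {φ' : ℝ}

theorem hasDerivAt_curveX {r : ℝ} (hφ : HasDerivAt φ φ' r) :
    HasDerivAt (curveX m φ) (1, 0, 0, φ') r :=
  (hasDerivAt_id r).prodMk ((hasDerivAt_const r _).prodMk ((hasDerivAt_const r _).prodMk hφ))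

theorem hasDerivAt_curveY {r : ℝ} (hφ : HasDerivAt φ φ' r) :
    HasDerivAt (curveY m φ) (0, 1, 0, φ') r :=
  (hasDerivAt_const r _).prodMk ((hasDerivAt_id r).prodMk ((hasDerivAt_const r _).prodMk hφ))

theorem hasDerivAt_curveT {r : ℝ} (hφ : HasDerivAt φ φ' r) :
    HasDerivAt (curveT m φ) (0, 0, 1, φ') r :=
  (hasDerivAt_const r _).prodMk ((hasDerivAt_const r _).prodMk ((hasDerivAt_id r).prodMk hφ))

theorem hasDerivAt_quartic_self (r₀ a₀ a₁ a₂ a₃ a₄ : ℝ) :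
    HasDerivAt (quartic r₀ a₀ a₁ a₂ a₃ a₄) a₁ r₀ := by
  have := ((contDiff_quartic (n := 1) r₀ a₀ a₁ a₂ a₃ a₄).differentiable (by simp) r₀).hasDerivAt
  rwa [deriv_quartic, quartic_self] at this

theorem hasDerivAt_quartic_affine (r₀ a₀ a₁ r : ℝ) :
    HasDerivAt (quartic r₀ a₀ a₁ 0 0 0) a₁ r := by
  have := ((contDiff_quartic (n := 1) r₀ a₀ a₁ 0 0 0).differentiable (by simp) r).hasDerivAt
  rw [deriv_quartic] at this
  simpa [quartic] using this

theorem pd_coords (h : Total → ℝ) (a b c d : ℝ) (m : Total) :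
    pd (a, b, c, d) h m = a * pd (1, 0, 0, 0) h m + b * pd (0, 1, 0, 0) h m
      + c * pd (0, 0, 1, 0) h m + d * pd (0, 0, 0, 1) h m := by
  rw [← pd_smul, ← pd_smul, ← pd_smul, ← pd_smul, ← pd_add, ← pd_add, ← pd_add]
  simp

/-- A function which is affine in `v`. -/
theorem eq_add_mul_pd_of_affine (hM : IsOpen M) (hc : Convex ℝ M) {h : Total → ℝ}
    (hh : ContDiffOn ℝ ∞ h M)
    (h0 : ∀ m ∈ M, pd (0, 0, 0, 1) (pd (0, 0, 0, 1) h) m = 0) {a b : Total} (ha : a ∈ M)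
    (hb : b ∈ M) {δ : ℝ} (hab : b - a = (0, 0, 0, δ)) :
    h b = h a + pd (0, 0, 0, 1) h a * δ := by
  have hδ : b - a = δ • ((0, 0, 0, 1) : Total) := by simp [hab]
  rw [eq_add_pd_of_pd_pd_eq_zero hM hc hh ha hb fun m hm => ?_, hδ, pd_smul, mul_comm]
  have := h0 m hm
  rw [pd_pd hM hh _ _ hm] at this ⊢
  simp [hδ, -Prod.smul_mk, this]

end CurvesInTotal

/-! ### Determining equations for `ξˣ, ξʸ, τ`, and linearity of `η` in `v` -/

section DeterminingEquations

variable {p s ε : ℝ} {M : Set Total} {X : Field} {m : Total}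

theorem pos_mem_powDomain {u : ℝ} (hu : 0 < u) : u ∈ powDomain p := Or.inl hu

/-- The directions `(1, 1)` and `(1, 2)` span the `(x, v)`-plane. They are the total `x`-derivatives
at `v_x = 1` and `v_x = 2`. -/
theorem pd_eq_zero_of_two {h : Total → ℝ} {m : Total} (h1 : pd (1, 0, 0, 1) h m = 0)
    (h2 : pd (1, 0, 0, 2) h m = 0) (a d : ℝ) : pd (a, 0, 0, d) h m = 0 := by
  rw [pd_coords] at h1 h2 ⊢
  linear_combination (2 * a - d) * h1 + (d - a) * h2

/-- The coordinate `v_txxx` enters only through `24 s c₃ D_x τ`, where `D_x τ = τ_x + u τ_v`.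
Changing `c₃` leaves all three curves unchanged, so a difference isolates this term; two values of
`u` separate `τ_x` from `τ_v`. -/
theorem pd_coeffT_xv (hp : p ≠ 0) (hs : s ≠ 0) (hM : IsOpen M)
    (hX : IsPointSymmetry p s ε M X) (a d : ℝ) {m : Total} (hm : m ∈ M) :
    pd (a, 0, 0, d) (coeffT X) m = 0 := by
  have key : ∀ u : ℝ, 0 < u → pd (1, 0, 0, u) (coeffT X) m = 0 := fun u hu => by
    have h1 := determining hp hM hX hm (pos_mem_powDomain hu) 0 0 0 0 0 0 0 0 1 0 0 0 (by ring)
      rfl rfl rfl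
    have h0 := determining hp hM hX hm (pos_mem_powDomain hu) 0 0 0 0 0 0 0 0 0 0 0 0 (by ring)
      rfl rfl rfl
    have hmem : curveX m (quartic m.1 m.2.2.2 u 0 0 0) m.1 = m := curveX_self (quartic_self ..)
    have hd := iteratedDeriv_one_comp_curve hM (contDiffOn_coeffT hX.1)
      (hasDerivAt_curveX (m := m) (hasDerivAt_quartic_self m.1 m.2.2.2 u 0 0 0)) (by rwa [hmem])
    rw [hmem] at hd
    rw [← hd]
    have : 24 * s ≠ 0 := by simpa using hs
    refine (mul_eq_zero.1 ?_).resolve_left this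
    linear_combination h1 - h0
  exact pd_eq_zero_of_two (key 1 one_pos) (key 2 two_pos) a d

/-- The same argument with `v_xxxy`, that is, with the parameter `b₃`. -/
theorem pd_coeffY_xv (hp : p ≠ 0) (hs : s ≠ 0) (hM : IsOpen M)
    (hX : IsPointSymmetry p s ε M X) (a d : ℝ) {m : Total} (hm : m ∈ M) :
    pd (a, 0, 0, d) (coeffY X) m = 0 := by
  have key : ∀ u : ℝ, 0 < u → pd (1, 0, 0, u) (coeffY X) m = 0 := fun u hu => by
    have h1 := determining hp hM hX hm (pos_mem_powDomain hu) 0 0 0 0 0 1 0 0 0 0 0 0 (by ring)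
      rfl rfl rfl
    have h0 := determining hp hM hX hm (pos_mem_powDomain hu) 0 0 0 0 0 0 0 0 0 0 0 0 (by ring)
      rfl rfl rfl
    have hmem : curveX m (quartic m.1 m.2.2.2 u 0 0 0) m.1 = m := curveX_self (quartic_self ..)
    have hd := iteratedDeriv_one_comp_curve hM (contDiffOn_coeffY hX.1)
      (hasDerivAt_curveX (m := m) (hasDerivAt_quartic_self m.1 m.2.2.2 u 0 0 0)) (by rwa [hmem])
    rw [hmem] at hd
    rw [← hd]
    have : 24 * s ≠ 0 := by simpa using hs
    refine (mul_eq_zero.1 ?_).resolve_left this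
    linear_combination h1 - h0
  exact pd_eq_zero_of_two (key 1 one_pos) (key 2 two_pos) a d

theorem continuous_curveX {φ : ℝ → ℝ} (hφ : Continuous φ) : Continuous (curveX m φ) := by
  unfold curveX; fun_prop

theorem continuous_curveY {φ : ℝ → ℝ} (hφ : Continuous φ) : Continuous (curveY m φ) := by
  unfold curveY; fun_prop

theorem continuous_curveT {φ : ℝ → ℝ} (hφ : Continuous φ) : Continuous (curveT m φ) := by
  unfold curveT; fun_prop

theorem continuous_quartic (r₀ a₀ a₁ a₂ a₃ a₄ : ℝ) : Continuous (quartic r₀ a₀ a₁ a₂ a₃ a₄) :=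
  (contDiff_quartic (n := 0) r₀ a₀ a₁ a₂ a₃ a₄).continuous

/-- Total `x`-derivatives kill a function that is independent of `x` and `v`, whatever the graph
curve. -/
theorem iteratedDeriv_curveX_eq_zero (hM : IsOpen M) (hc : Convex ℝ M) {h : Total → ℝ}
    (hh : ContDiffOn ℝ ∞ h M) (h0 : ∀ a d : ℝ, ∀ m ∈ M, pd (a, 0, 0, d) h m = 0) (hm : m ∈ M)
    (a₁ a₂ a₃ a₄ : ℝ) {n : ℕ} (hn : 0 < n) :
    iteratedDeriv n (fun r => h (curveX m (quartic m.1 m.2.2.2 a₁ a₂ a₃ a₄) r)) m.1 = 0 := by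
  have hmem := curveX_self (m := m) (quartic_self m.1 m.2.2.2 a₁ a₂ a₃ a₄)
  refine iteratedDeriv_comp_curve_eq_zero hM hc hh
    (continuous_curveX (continuous_quartic ..)).continuousAt (by rwa [hmem]) (fun r m' hm' => ?_) hn
  simpa only [curveX, quartic_self, Prod.mk_sub_mk, sub_self] using
    h0 (m.1 - r) (m.2.2.2 - quartic m.1 m.2.2.2 a₁ a₂ a₃ a₄ r) m' hm'

theorem iteratedDeriv_curveY_eq_zero (hM : IsOpen M) (hc : Convex ℝ M) {h : Total → ℝ}
    (hh : ContDiffOn ℝ ∞ h M) (h0 : ∀ a d : ℝ, ∀ m ∈ M, pd (0, a, 0, d) h m = 0) (hm : m ∈ M)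
    (a₁ a₂ a₃ a₄ : ℝ) {n : ℕ} (hn : 0 < n) :
    iteratedDeriv n (fun r => h (curveY m (quartic m.2.1 m.2.2.2 a₁ a₂ a₃ a₄) r)) m.2.1 = 0 := by
  have hmem := curveY_self (m := m) (quartic_self m.2.1 m.2.2.2 a₁ a₂ a₃ a₄)
  refine iteratedDeriv_comp_curve_eq_zero hM hc hh
    (continuous_curveY (continuous_quartic ..)).continuousAt (by rwa [hmem]) (fun r m' hm' => ?_) hn
  simpa only [curveY, quartic_self, Prod.mk_sub_mk, sub_self] using
    h0 (m.2.1 - r) (m.2.2.2 - quartic m.2.1 m.2.2.2 a₁ a₂ a₃ a₄ r) m' hm'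

theorem iteratedDeriv_curveT_eq_zero (hM : IsOpen M) (hc : Convex ℝ M) {h : Total → ℝ}
    (hh : ContDiffOn ℝ ∞ h M) (h0 : ∀ a d : ℝ, ∀ m ∈ M, pd (0, 0, a, d) h m = 0) (hm : m ∈ M)
    (a₁ a₂ a₃ a₄ : ℝ) {n : ℕ} (hn : 0 < n) :
    iteratedDeriv n (fun r => h (curveT m (quartic m.2.2.1 m.2.2.2 a₁ a₂ a₃ a₄) r)) m.2.2.1
      = 0 := by
  have hmem := curveT_self (m := m) (quartic_self m.2.2.1 m.2.2.2 a₁ a₂ a₃ a₄)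
  refine iteratedDeriv_comp_curve_eq_zero hM hc hh
    (continuous_curveT (continuous_quartic ..)).continuousAt (by rwa [hmem]) (fun r m' hm' => ?_) hn
  simpa only [curveT, quartic_self, Prod.mk_sub_mk, sub_self] using
    h0 (m.2.2.1 - r) (m.2.2.2 - quartic m.2.2.1 m.2.2.2 a₁ a₂ a₃ a₄ r) m' hm'

/-- Since `τ` and `ξʸ` no longer vary along the `x`-line, `v_tx` and `v_xy` multiply only the total
`t`- and `y`-derivatives of `ξˣ`. -/
theorem pd_coeffX_ytv (hp : p ≠ 0) (hs : s ≠ 0) (hε : ε ≠ 0) (hM : IsOpen M) (hc : Convex ℝ M)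
    (hX : IsPointSymmetry p s ε M X) (a b d : ℝ) {m : Total} (hm : m ∈ M) :
    pd (0, a, b, d) (coeffX X) m = 0 := by
  have zT : ∀ {n : ℕ}, 0 < n →
      iteratedDeriv n (fun r => coeffT X (curveX m (quartic m.1 m.2.2.2 1 0 0 0) r)) m.1 = 0 :=
    fun hn => iteratedDeriv_curveX_eq_zero hM hc (contDiffOn_coeffT hX.1)
      (fun a d m hm => pd_coeffT_xv hp hs hM hX a d hm) hm _ _ _ _ hn
  have zY : ∀ {n : ℕ}, 0 < n →
      iteratedDeriv n (fun r => coeffY X (curveX m (quartic m.1 m.2.2.2 1 0 0 0) r)) m.1 = 0 :=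
    fun hn => iteratedDeriv_curveX_eq_zero hM hc (contDiffOn_coeffY hX.1)
      (fun a d m hm => pd_coeffY_xv hp hs hM hX a d hm) hm _ _ _ _ hn
  have one_mem := pos_mem_powDomain (p := p) one_pos
  have ht : ∀ c₀ : ℝ, pd (0, 0, 1, c₀) (coeffX X) m = 0 := fun c₀ => by
    have h1 := determining hp hM hX hm one_mem 0 0 0 0 0 0 c₀ 1 0 0 0 0 (by ring) rfl rfl rfl
    have h0 := determining hp hM hX hm one_mem 0 0 0 0 0 0 c₀ 0 0 0 0 0 (by ring) rfl rfl rfl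
    rw [zT one_pos, zT three_pos] at h1
    have hmem : curveT m (quartic m.2.2.1 m.2.2.2 c₀ (0 / 2) 0 0) m.2.2.1 = m :=
      curveT_self (quartic_self ..)
    have hd := iteratedDeriv_one_comp_curve hM (contDiffOn_coeffX hX.1)
      (hasDerivAt_curveT (m := m) (hasDerivAt_quartic_self m.2.2.1 m.2.2.2 c₀ (0 / 2) 0 0))
      (by rwa [hmem])
    rw [hmem] at hd
    rw [← hd]
    rw [zT one_pos, zT three_pos] at h0
    linear_combination (h0 - h1) / 2
  -- Taking `v_y = 0` suffices: the `v`-derivative is already controlled by `ht` for two values of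
  -- `v_t`.
  have hy : pd (0, 1, 0, 0) (coeffX X) m = 0 := by
    have h1 := determining hp hM hX hm one_mem 0 0 0 0 1 0 0 0 0 0 0 0 (by ring) rfl rfl rfl
    have h0 := determining hp hM hX hm one_mem 0 0 0 0 0 0 0 0 0 0 0 0 (by ring) rfl rfl rfl
    rw [zY one_pos, zY three_pos] at h1 h0
    have hmem : curveY m (quartic m.2.1 m.2.2.2 0 (0 / 2) 0 0) m.2.1 = m :=
      curveY_self (quartic_self ..)
    have hd := iteratedDeriv_one_comp_curve hM (contDiffOn_coeffX hX.1)
      (hasDerivAt_curveY (m := m) (hasDerivAt_quartic_self m.2.1 m.2.2.2 0 (0 / 2) 0 0))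
      (by rwa [hmem])
    rw [hmem] at hd
    rw [← hd]
    refine (mul_eq_zero.1 ?_).resolve_left hε
    linear_combination (h1 - h0) / 2
  have h0 := ht 0
  have h1 := ht 1
  rw [pd_coords] at h0 h1 ⊢
  linear_combination a * hy + (b - d) * h0 + d * h1

/-- The infinitesimal invariance condition once it is known that the coefficient of `∂ₓ` depends on
`x` only and those of `∂_y` and `∂_t` on `(y, t)` only. -/
theorem determining_reduced (hp : p ≠ 0) (hs : s ≠ 0) (hε : ε ≠ 0) (hM : IsOpen M)
    (hc : Convex ℝ M) (hX : IsPointSymmetry p s ε M X) (hm : m ∈ M)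
    {u : ℝ} (hu : u ∈ powDomain p) (k₂ k₃ k₄ c₀ n μ l : ℝ)
    (hl : l = (1 + (p + 1) * u ^ p) * (2 * k₂) + s * (24 * k₄) + ε * n) {γx γy γt : ℝ → Total}
    (hγx : γx = curveX m (quartic m.1 m.2.2.2 u k₂ k₃ k₄))
    (hγy : γy = curveY m (quartic m.2.1 m.2.2.2 0 (n / 2) 0 0))
    (hγt : γt = curveT m (quartic m.2.2.1 m.2.2.2 c₀ (l / 2) 0 0)) :
    (iteratedDeriv 2 (fun r => coeffV X (γt r)) m.2.2.1
      - 2 * μ * iteratedDeriv 1 (fun r => coeffY X (γt r)) m.2.2.1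
      - (c₀ * iteratedDeriv 2 (fun r => coeffT X (γt r)) m.2.2.1
        + 2 * l * iteratedDeriv 1 (fun r => coeffT X (γt r)) m.2.2.1))
    - (1 + (p + 1) * u ^ p) * (iteratedDeriv 2 (fun r => coeffV X (γx r)) m.1
      - (u * iteratedDeriv 2 (fun r => coeffX X (γx r)) m.1
        + 2 * (2 * k₂) * iteratedDeriv 1 (fun r => coeffX X (γx r)) m.1))
    - p * (p + 1) * u ^ (p - 1) * (2 * k₂) * (iteratedDeriv 1 (fun r => coeffV X (γx r)) m.1
      - u * iteratedDeriv 1 (fun r => coeffX X (γx r)) m.1)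
    - s * (iteratedDeriv 4 (fun r => coeffV X (γx r)) m.1
      - (u * iteratedDeriv 4 (fun r => coeffX X (γx r)) m.1
        + 4 * (2 * k₂) * iteratedDeriv 3 (fun r => coeffX X (γx r)) m.1
        + 12 * (3 * k₃) * iteratedDeriv 2 (fun r => coeffX X (γx r)) m.1
        + 24 * (4 * k₄) * iteratedDeriv 1 (fun r => coeffX X (γx r)) m.1))
    - ε * (iteratedDeriv 2 (fun r => coeffV X (γy r)) m.2.1
      - 2 * n * iteratedDeriv 1 (fun r => coeffY X (γy r)) m.2.1
      - (c₀ * iteratedDeriv 2 (fun r => coeffT X (γy r)) m.2.1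
        + 2 * μ * iteratedDeriv 1 (fun r => coeffT X (γy r)) m.2.1)) = 0 := by
  have key := determining hp hM hX hm hu k₂ k₃ k₄ 0 0 0 c₀ 0 0 n μ l hl hγx hγy hγt
  have zT : ∀ {n : ℕ}, 0 < n → iteratedDeriv n (fun r => coeffT X (γx r)) m.1 = 0 :=
    fun hn => hγx ▸ iteratedDeriv_curveX_eq_zero hM hc (contDiffOn_coeffT hX.1)
      (fun a d m hm => pd_coeffT_xv hp hs hM hX a d hm) hm _ _ _ _ hn
  have zY : iteratedDeriv 2 (fun r => coeffX X (γy r)) m.2.1 = 0 :=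
    hγy ▸ iteratedDeriv_curveY_eq_zero hM hc (contDiffOn_coeffX hX.1)
      (fun a d m hm => pd_coeffX_ytv hp hs hε hM hc hX a 0 d hm) hm _ _ _ _ two_pos
  have zX : iteratedDeriv 2 (fun r => coeffX X (γt r)) m.2.2.1 = 0 :=
    hγt ▸ iteratedDeriv_curveT_eq_zero hM hc (contDiffOn_coeffX hX.1)
      (fun a d m hm => pd_coeffX_ytv hp hs hε hM hc hX 0 a d hm) hm _ _ _ _ two_pos
  rw [zT one_pos, zT two_pos, zT four_pos, zY, zX] at key
  linear_combination key

/-- This is the coefficient of `v_ty`, that is, of `μ`. -/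
theorem pd_t_coeffY (hp : p ≠ 0) (hs : s ≠ 0) (hε : ε ≠ 0) (hM : IsOpen M)
    (hc : Convex ℝ M) (hX : IsPointSymmetry p s ε M X) {m : Total} (hm : m ∈ M) :
    pd (0, 0, 1, 0) (coeffY X) m = ε * pd (0, 1, 0, 0) (coeffT X) m := by
  have one_mem := pos_mem_powDomain (p := p) one_pos
  have h1 := determining_reduced hp hs hε hM hc hX hm one_mem 0 0 0 0 0 1 0 (by ring) rfl rfl rfl
  have h0 := determining_reduced hp hs hε hM hc hX hm one_mem 0 0 0 0 0 0 0 (by ring) rfl rfl rfl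
  have ht : curveT m (quartic m.2.2.1 m.2.2.2 0 (0 / 2) 0 0) m.2.2.1 = m :=
    curveT_self (quartic_self ..)
  have hdt := iteratedDeriv_one_comp_curve hM (contDiffOn_coeffY hX.1)
    (hasDerivAt_curveT (m := m) (hasDerivAt_quartic_self m.2.2.1 m.2.2.2 0 (0 / 2) 0 0))
    (by rwa [ht])
  have hy : curveY m (quartic m.2.1 m.2.2.2 0 (0 / 2) 0 0) m.2.1 = m :=
    curveY_self (quartic_self ..)
  have hdy := iteratedDeriv_one_comp_curve hM (contDiffOn_coeffT hX.1)
    (hasDerivAt_curveY (m := m) (hasDerivAt_quartic_self m.2.1 m.2.2.2 0 (0 / 2) 0 0))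
    (by rwa [hy])
  rw [ht] at hdt
  rw [hy] at hdy
  rw [← hdt, ← hdy]
  linear_combination (h0 - h1) / 2

/-- The second total `t`-derivative of `η` contains `v_t² η_vv`, and nothing else in the condition
is quadratic in `v_t` once `τ_v = 0`. -/
theorem pd_v_pd_v_coeffV (hp : p ≠ 0) (hs : s ≠ 0) (hε : ε ≠ 0) (hM : IsOpen M)
    (hc : Convex ℝ M) (hX : IsPointSymmetry p s ε M X) {m : Total} (hm : m ∈ M) :
    pd (0, 0, 0, 1) (pd (0, 0, 0, 1) (coeffV X)) m = 0 := by
  have one_mem := pos_mem_powDomain (p := p) one_pos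
  have eq := fun c₀ => determining_reduced hp hs hε hM hc hX hm one_mem 0 0 0 c₀ 0 0 0 (by ring)
    rfl rfl rfl
  have ht : ∀ c₀, curveT m (quartic m.2.2.1 m.2.2.2 c₀ (0 / 2) 0 0) m.2.2.1 = m := fun c₀ =>
    curveT_self (quartic_self ..)
  have hd : ∀ c₀ r, HasDerivAt (curveT m (quartic m.2.2.1 m.2.2.2 c₀ (0 / 2) 0 0))
      (0, 0, 1, c₀) r := fun c₀ r => by
    rw [zero_div]; exact hasDerivAt_curveT (hasDerivAt_quartic_affine ..)
  have hη : ∀ c₀, iteratedDeriv 2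
      (fun r => coeffV X (curveT m (quartic m.2.2.1 m.2.2.2 c₀ (0 / 2) 0 0) r)) m.2.2.1 =
      fderiv ℝ (fderiv ℝ (coeffV X)) m (0, 0, 1, c₀) (0, 0, 1, c₀) := fun c₀ => by
    rw [iteratedDeriv_two_comp_line hM (contDiffOn_coeffV hX.1) (hd c₀) ((ht c₀).symm ▸ hm), ht,
      pd_pd hM (contDiffOn_coeffV hX.1) _ _ hm]
  -- As `τ` does not depend on `v`, its derivative along the `t`-curve does not see the slope `c₀`.
  have hτ : ∀ c₀, iteratedDeriv 2
      (fun r => coeffT X (curveT m (quartic m.2.2.1 m.2.2.2 c₀ (0 / 2) 0 0) r)) m.2.2.1 =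
      iteratedDeriv 2
        (fun r => coeffT X (curveT m (quartic m.2.2.1 m.2.2.2 0 (0 / 2) 0 0) r)) m.2.2.1 :=
    fun c₀ => Filter.EventuallyEq.iteratedDeriv_eq 2 <| eventuallyEq_comp_curve hM hc
      (contDiffOn_coeffT hX.1) (hd c₀ _).continuousAt (hd 0 _).continuousAt ((ht c₀).symm ▸ hm)
      ((ht 0).symm ▸ hm) fun r m' hm' => by
        simpa [curveT] using pd_coeffT_xv hp hs hM hX 0 _ hm'
  have hsplit : ∀ c₀ : ℝ, ((0, 0, 1, c₀) : Total) = (0, 0, 1, 0) + c₀ • (0, 0, 0, 1) := by simp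
  rw [pd_pd hM (contDiffOn_coeffV hX.1) _ _ hm]
  have e1 := eq 1
  have e2 := eq (-1)
  have e0 := eq 0
  rw [hη, hτ, hsplit] at e1 e2 e0
  simp only [map_add, map_smul, add_apply, smul_apply, smul_eq_mul] at e1 e2 e0
  -- The second difference in `c₀ = -1, 0, 1` removes the constant and linear terms.
  linear_combination (e1 + e2 - 2 * e0) / 2

end DeterminingEquations


/-! ### Consequences of linearity in `v`, up to the classifying equation -/

section Affine

variable {p s ε : ℝ} {M : Set Total} {X : Field} {m : Total}

theorem eventuallyEq_of_affine (hM : IsOpen M) (hc : Convex ℝ M) {h : Total → ℝ}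
    (hh : ContDiffOn ℝ ∞ h M)
    (h0 : ∀ m ∈ M, pd (0, 0, 0, 1) (pd (0, 0, 0, 1) h) m = 0) {γ δ : ℝ → Total} {ψ : ℝ → ℝ}
    {r₀ : ℝ} (hγ : ContinuousAt γ r₀) (hδ : ContinuousAt δ r₀) (hγ₀ : γ r₀ ∈ M) (hδ₀ : δ r₀ ∈ M)
    (hψ : ∀ r, γ r - δ r = (0, 0, 0, ψ r)) :
    (fun r => h (γ r)) =ᶠ[nhds r₀] fun r => h (δ r) + pd (0, 0, 0, 1) h (δ r) * ψ r := by
  filter_upwards [hγ.preimage_mem_nhds (hM.mem_nhds hγ₀),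
    hδ.preimage_mem_nhds (hM.mem_nhds hδ₀)] with r hr hr'
  exact eq_add_mul_pd_of_affine hM hc hh h0 hr' hr (hψ r)

theorem quartic_sub_const (r₀ a₀ a₁ a₂ a₃ a₄ r : ℝ) :
    quartic r₀ a₀ a₁ a₂ a₃ a₄ r - a₀ = quartic r₀ 0 a₁ a₂ a₃ a₄ r := by
  simp only [quartic]; ring

variable {h : Total → ℝ} (a₁ a₂ a₃ a₄ : ℝ)

/-- For `h` affine in `v`, moving from the curve to the straight line `v = const` costs only `h_v`
times the displacement. The higher chain rule thereby reduces to a product with a quartic, to which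
the Leibniz formulas apply. -/
theorem iteratedDeriv_curveX_of_affine (hM : IsOpen M) (hc : Convex ℝ M)
    (hh : ContDiffOn ℝ ∞ h M) (h0 : ∀ m ∈ M, pd (0, 0, 0, 1) (pd (0, 0, 0, 1) h) m = 0)
    (hm : m ∈ M) (n : ℕ) :
    iteratedDeriv n (fun r => h (curveX m (quartic m.1 m.2.2.2 a₁ a₂ a₃ a₄) r)) m.1 =
      iteratedDeriv n (fun r => h (curveX m (fun _ => m.2.2.2) r)) m.1
      + iteratedDeriv n (fun r => pd (0, 0, 0, 1) h (curveX m (fun _ => m.2.2.2) r)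
        * quartic m.1 0 a₁ a₂ a₃ a₄ r) m.1 := by
  have e := eventuallyEq_of_affine (γ := curveX m (quartic m.1 m.2.2.2 a₁ a₂ a₃ a₄))
    (δ := curveX m fun _ => m.2.2.2) (r₀ := m.1) hM hc hh h0
    (continuous_curveX (continuous_quartic ..)).continuousAt
    (continuous_curveX continuous_const).continuousAt (by rwa [curveX_self (quartic_self ..)])
    (by rwa [curveX_self rfl]) (fun r => by
      simp only [curveX, Prod.mk_sub_mk, sub_self, quartic_sub_const]; rfl)
  rw [e.iteratedDeriv_eq]
  have c1 := contDiffAt_comp_curveX hM hh hm contDiff_const rfl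
  have c2 := contDiffAt_comp_curveX hM (contDiffOn_pd hM hh (0, 0, 0, 1)) hm contDiff_const rfl
  exact iteratedDeriv_add (c1.of_le (natCast_le_infty n))
    ((c2.mul (contDiff_quartic ..).contDiffAt).of_le (natCast_le_infty n))

theorem iteratedDeriv_curveY_of_affine (hM : IsOpen M) (hc : Convex ℝ M)
    (hh : ContDiffOn ℝ ∞ h M) (h0 : ∀ m ∈ M, pd (0, 0, 0, 1) (pd (0, 0, 0, 1) h) m = 0)
    (hm : m ∈ M) (n : ℕ) :
    iteratedDeriv n (fun r => h (curveY m (quartic m.2.1 m.2.2.2 a₁ a₂ a₃ a₄) r)) m.2.1 =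
      iteratedDeriv n (fun r => h (curveY m (fun _ => m.2.2.2) r)) m.2.1
      + iteratedDeriv n (fun r => pd (0, 0, 0, 1) h (curveY m (fun _ => m.2.2.2) r)
        * quartic m.2.1 0 a₁ a₂ a₃ a₄ r) m.2.1 := by
  have e := eventuallyEq_of_affine (γ := curveY m (quartic m.2.1 m.2.2.2 a₁ a₂ a₃ a₄))
    (δ := curveY m fun _ => m.2.2.2) (r₀ := m.2.1) hM hc hh h0
    (continuous_curveY (continuous_quartic ..)).continuousAt
    (continuous_curveY continuous_const).continuousAt (by rwa [curveY_self (quartic_self ..)])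
    (by rwa [curveY_self rfl]) (fun r => by
      simp only [curveY, Prod.mk_sub_mk, sub_self, quartic_sub_const]; rfl)
  rw [e.iteratedDeriv_eq]
  have c1 := contDiffAt_comp_curveY hM hh hm contDiff_const rfl
  have c2 := contDiffAt_comp_curveY hM (contDiffOn_pd hM hh (0, 0, 0, 1)) hm contDiff_const rfl
  exact iteratedDeriv_add (c1.of_le (natCast_le_infty n))
    ((c2.mul (contDiff_quartic ..).contDiffAt).of_le (natCast_le_infty n))

theorem iteratedDeriv_curveT_of_affine (hM : IsOpen M) (hc : Convex ℝ M)
    (hh : ContDiffOn ℝ ∞ h M) (h0 : ∀ m ∈ M, pd (0, 0, 0, 1) (pd (0, 0, 0, 1) h) m = 0)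
    (hm : m ∈ M) (n : ℕ) :
    iteratedDeriv n (fun r => h (curveT m (quartic m.2.2.1 m.2.2.2 a₁ a₂ a₃ a₄) r)) m.2.2.1 =
      iteratedDeriv n (fun r => h (curveT m (fun _ => m.2.2.2) r)) m.2.2.1
      + iteratedDeriv n (fun r => pd (0, 0, 0, 1) h (curveT m (fun _ => m.2.2.2) r)
        * quartic m.2.2.1 0 a₁ a₂ a₃ a₄ r) m.2.2.1 := by
  have e := eventuallyEq_of_affine (γ := curveT m (quartic m.2.2.1 m.2.2.2 a₁ a₂ a₃ a₄))
    (δ := curveT m fun _ => m.2.2.2) (r₀ := m.2.2.1) hM hc hh h0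
    (continuous_curveT (continuous_quartic ..)).continuousAt
    (continuous_curveT continuous_const).continuousAt (by rwa [curveT_self (quartic_self ..)])
    (by rwa [curveT_self rfl]) (fun r => by
      simp only [curveT, Prod.mk_sub_mk, sub_self, quartic_sub_const]; rfl)
  rw [e.iteratedDeriv_eq]
  have c1 := contDiffAt_comp_curveT hM hh hm contDiff_const rfl
  have c2 := contDiffAt_comp_curveT hM (contDiffOn_pd hM hh (0, 0, 0, 1)) hm contDiff_const rfl
  exact iteratedDeriv_add (c1.of_le (natCast_le_infty n))
    ((c2.mul (contDiff_quartic ..).contDiffAt).of_le (natCast_le_infty n))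

theorem iteratedDeriv_two_coeffV_curveT (hp : p ≠ 0) (hs : s ≠ 0) (hε : ε ≠ 0) (hM : IsOpen M)
    (hc : Convex ℝ M) (hX : IsPointSymmetry p s ε M X) (hm : m ∈ M) :
    iteratedDeriv 2
      (fun r => coeffV X (curveT m (quartic m.2.2.1 m.2.2.2 0 a₂ 0 0) r)) m.2.2.1 =
    pd (0, 0, 1, 0) (pd (0, 0, 1, 0) (coeffV X)) m
      + 2 * a₂ * pd (0, 0, 0, 1) (coeffV X) m := by
  have hη := contDiffOn_coeffV hX.1
  have hself := curveT_self (m := m) (φ := fun _ => m.2.2.2) rfl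
  rw [iteratedDeriv_curveT_of_affine 0 a₂ 0 0 hM hc hη
    (fun m hm => pd_v_pd_v_coeffV hp hs hε hM hc hX hm) hm,
    iteratedDeriv_two_mul_quartic _ _ _ _ _ _
      (contDiffAt_comp_curveT hM (contDiffOn_pd hM hη _) hm contDiff_const rfl),
    iteratedDeriv_two_comp_line hM hη (fun r => hasDerivAt_curveT (hasDerivAt_const r _))
      (by rwa [hself]), hself]
  ring

theorem iteratedDeriv_two_coeffV_curveY (hp : p ≠ 0) (hs : s ≠ 0) (hε : ε ≠ 0) (hM : IsOpen M)
    (hc : Convex ℝ M) (hX : IsPointSymmetry p s ε M X) (hm : m ∈ M) :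
    iteratedDeriv 2
      (fun r => coeffV X (curveY m (quartic m.2.1 m.2.2.2 0 a₂ 0 0) r)) m.2.1 =
    pd (0, 1, 0, 0) (pd (0, 1, 0, 0) (coeffV X)) m
      + 2 * a₂ * pd (0, 0, 0, 1) (coeffV X) m := by
  have hη := contDiffOn_coeffV hX.1
  have hself := curveY_self (m := m) (φ := fun _ => m.2.2.2) rfl
  rw [iteratedDeriv_curveY_of_affine 0 a₂ 0 0 hM hc hη
    (fun m hm => pd_v_pd_v_coeffV hp hs hε hM hc hX hm) hm,
    iteratedDeriv_two_mul_quartic _ _ _ _ _ _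
      (contDiffAt_comp_curveY hM (contDiffOn_pd hM hη _) hm contDiff_const rfl),
    iteratedDeriv_two_comp_line hM hη (fun r => hasDerivAt_curveY (hasDerivAt_const r _))
      (by rwa [hself]), hself]
  ring

theorem iteratedDeriv_one_curveT (hM : IsOpen M) (hh : ContDiffOn ℝ ∞ h M) (hm : m ∈ M) :
    iteratedDeriv 1 (fun r => h (curveT m (quartic m.2.2.1 m.2.2.2 a₁ a₂ a₃ a₄) r)) m.2.2.1 =
      pd (0, 0, 1, a₁) h m := by
  have hself := curveT_self (m := m) (quartic_self m.2.2.1 m.2.2.2 a₁ a₂ a₃ a₄)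
  rw [iteratedDeriv_one_comp_curve hM hh (hasDerivAt_curveT (hasDerivAt_quartic_self ..))
    (by rwa [hself]), hself]

theorem iteratedDeriv_one_curveY (hM : IsOpen M) (hh : ContDiffOn ℝ ∞ h M) (hm : m ∈ M) :
    iteratedDeriv 1 (fun r => h (curveY m (quartic m.2.1 m.2.2.2 a₁ a₂ a₃ a₄) r)) m.2.1 =
      pd (0, 1, 0, a₁) h m := by
  have hself := curveY_self (m := m) (quartic_self m.2.1 m.2.2.2 a₁ a₂ a₃ a₄)
  rw [iteratedDeriv_one_comp_curve hM hh (hasDerivAt_curveY (hasDerivAt_quartic_self ..))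
    (by rwa [hself]), hself]

theorem iteratedDeriv_one_curveX (hM : IsOpen M) (hh : ContDiffOn ℝ ∞ h M) (hm : m ∈ M) :
    iteratedDeriv 1 (fun r => h (curveX m (fun _ => m.2.2.2) r)) m.1 = pd (1, 0, 0, 0) h m := by
  have hself := curveX_self (m := m) (φ := fun _ => m.2.2.2) rfl
  rw [iteratedDeriv_one_comp_curve hM hh (hasDerivAt_curveX (hasDerivAt_const _ _))
    (by rwa [hself]), hself]

/-- Raising `v_yy` by `1` on the equation raises `v_tt` by `ε`. The two contributions of `η_v`
cancel, leaving `-2ε τ_t + 2ε ξʸ_y`. -/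
theorem pd_t_coeffT_eq_pd_y_coeffY (hp : p ≠ 0) (hs : s ≠ 0) (hε : ε ≠ 0) (hM : IsOpen M)
    (hc : Convex ℝ M) (hX : IsPointSymmetry p s ε M X) {m : Total} (hm : m ∈ M) :
    pd (0, 0, 1, 0) (coeffT X) m = pd (0, 1, 0, 0) (coeffY X) m := by
  have one_mem := pos_mem_powDomain (p := p) one_pos
  have h1 := determining_reduced hp hs hε hM hc hX hm one_mem 0 0 0 0 1 0 ε (by ring) rfl rfl rfl
  have h0 := determining_reduced hp hs hε hM hc hX hm one_mem 0 0 0 0 0 0 0 (by ring) rfl rfl rfl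
  rw [iteratedDeriv_two_coeffV_curveT _ hp hs hε hM hc hX hm,
    iteratedDeriv_two_coeffV_curveY _ hp hs hε hM hc hX hm,
    iteratedDeriv_one_curveT _ _ _ _ hM (contDiffOn_coeffT hX.1) hm,
    iteratedDeriv_one_curveY _ _ _ _ hM (contDiffOn_coeffY hX.1) hm] at h1 h0
  have : 2 * ε ≠ 0 := by simpa using hε
  refine sub_eq_zero.1 ((mul_eq_zero.1 ?_).resolve_left this)
  linear_combination h0 - h1

/-- The infinitesimal invariance condition in terms of functions of `x`, for jets whose coordinates
are pure `x`-derivatives and `v_tt`. -/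
theorem determining_x (hp : p ≠ 0) (hs : s ≠ 0) (hε : ε ≠ 0) (hM : IsOpen M)
    (hc : Convex ℝ M) (hX : IsPointSymmetry p s ε M X) (hm : m ∈ M)
    {u : ℝ} (hu : u ∈ powDomain p) (k₂ k₃ k₄ : ℝ) {f f' : ℝ} (hf : f = 1 + (p + 1) * u ^ p)
    (hf' : f' = p * (p + 1) * u ^ (p - 1)) {A E Ξ : ℝ → ℝ}
    (hA : A = fun r => pd (0, 0, 0, 1) (coeffV X) (curveX m (fun _ => m.2.2.2) r))
    (hE : E = fun r => coeffV X (curveX m (fun _ => m.2.2.2) r))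
    (hΞ : Ξ = fun r => coeffX X (curveX m (fun _ => m.2.2.2) r)) :
    pd (0, 0, 1, 0) (pd (0, 0, 1, 0) (coeffV X)) m
      + (f * (2 * k₂) + s * (24 * k₄)) * (A m.1 - 2 * pd (0, 0, 1, 0) (coeffT X) m)
      - f * (iteratedDeriv 2 E m.1 + 2 * u * iteratedDeriv 1 A m.1 + 2 * k₂ * A m.1
        - u * iteratedDeriv 2 Ξ m.1 - 4 * k₂ * iteratedDeriv 1 Ξ m.1)
      - f' * (2 * k₂) * (iteratedDeriv 1 E m.1 + u * (A m.1 - iteratedDeriv 1 Ξ m.1))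
      - s * (iteratedDeriv 4 E m.1 + 4 * u * iteratedDeriv 3 A m.1
        + 12 * k₂ * iteratedDeriv 2 A m.1 + 24 * k₃ * iteratedDeriv 1 A m.1 + 24 * k₄ * A m.1
        - u * iteratedDeriv 4 Ξ m.1 - 8 * k₂ * iteratedDeriv 3 Ξ m.1
        - 36 * k₃ * iteratedDeriv 2 Ξ m.1 - 96 * k₄ * iteratedDeriv 1 Ξ m.1)
      - ε * pd (0, 1, 0, 0) (pd (0, 1, 0, 0) (coeffV X)) m = 0 := by
  have key := determining_reduced hp hs hε hM hc hX hm hu k₂ k₃ k₄ 0 0 0 _ rfl rfl rfl rfl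
  have hη := contDiffOn_coeffV hX.1
  have hA' : ContDiffAt ℝ ∞ A m.1 :=
    hA ▸ contDiffAt_comp_curveX hM (contDiffOn_pd hM hη _) hm contDiff_const rfl
  have eV : ∀ n, iteratedDeriv n
      (fun r => coeffV X (curveX m (quartic m.1 m.2.2.2 u k₂ k₃ k₄) r)) m.1 =
      iteratedDeriv n E m.1 + iteratedDeriv n (fun r => A r * quartic m.1 0 u k₂ k₃ k₄ r) m.1 :=
    fun n => by
      rw [hA, hE]
      exact iteratedDeriv_curveX_of_affine _ _ _ _ hM hc hη
        (fun m hm => pd_v_pd_v_coeffV hp hs hε hM hc hX hm) hm n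
  have eX : ∀ n, iteratedDeriv n
      (fun r => coeffX X (curveX m (quartic m.1 m.2.2.2 u k₂ k₃ k₄) r)) m.1 =
      iteratedDeriv n Ξ m.1 := fun n => by
    rw [hΞ]
    refine Filter.EventuallyEq.iteratedDeriv_eq n (eventuallyEq_comp_curve hM hc
      (contDiffOn_coeffX hX.1) (continuous_curveX (continuous_quartic ..)).continuousAt
      (continuous_curveX continuous_const).continuousAt (by rwa [curveX_self (quartic_self ..)])
      (by rwa [curveX_self rfl]) fun r m' hm' => ?_)
    simpa only [curveX, Prod.mk_sub_mk, sub_self] using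
      pd_coeffX_ytv hp hs hε hM hc hX 0 0 _ hm'
  rw [iteratedDeriv_two_coeffV_curveT _ hp hs hε hM hc hX hm,
    iteratedDeriv_two_coeffV_curveY _ hp hs hε hM hc hX hm,
    iteratedDeriv_one_curveT _ _ _ _ hM (contDiffOn_coeffT hX.1) hm, eV, eV, eV, eX, eX, eX, eX,
    iteratedDeriv_one_mul_quartic _ _ _ _ _ _ hA', iteratedDeriv_two_mul_quartic _ _ _ _ _ _ hA',
    iteratedDeriv_four_mul_quartic _ _ _ _ _ _ hA', ← hf, ← hf'] at key
  have hAm : A m.1 = pd (0, 0, 0, 1) (coeffV X) m := by rw [hA]; simp only [curveX_self]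
  rw [← hAm] at key
  linear_combination key

/-- The same comparison between `v_xxxx` and `v_tt`: `η_v` cancels and `-48 s τ_t + 96 s ξˣ_x`
remains. -/
theorem pd_t_coeffT_eq_two_mul (hp : p ≠ 0) (hs : s ≠ 0) (hε : ε ≠ 0) (hM : IsOpen M)
    (hc : Convex ℝ M) (hX : IsPointSymmetry p s ε M X) {m : Total} (hm : m ∈ M) :
    pd (0, 0, 1, 0) (coeffT X) m = 2 * pd (1, 0, 0, 0) (coeffX X) m := by
  have one_mem := pos_mem_powDomain (p := p) one_pos
  have h1 := determining_x hp hs hε hM hc hX hm one_mem 0 0 1 rfl rfl rfl rfl rfl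
  have h0 := determining_x hp hs hε hM hc hX hm one_mem 0 0 0 rfl rfl rfl rfl rfl
  rw [iteratedDeriv_one_curveX hM (contDiffOn_coeffX hX.1) hm] at h1 h0
  have : 48 * s ≠ 0 := by simpa using hs
  refine sub_eq_zero.1 ((mul_eq_zero.1 ?_).resolve_left this)
  linear_combination h0 - h1

/-- Only the `x`-direction is not immediate, and there `2 ξˣ_xx = τ_tx = τ_xt = 0`. -/
theorem pd_pd_x_coeffX (hp : p ≠ 0) (hs : s ≠ 0) (hε : ε ≠ 0) (hM : IsOpen M)
    (hc : Convex ℝ M) (hX : IsPointSymmetry p s ε M X) (d : Total) {m : Total} (hm : m ∈ M) :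
    pd d (pd (1, 0, 0, 0) (coeffX X)) m = 0 := by
  have hξ := contDiffOn_coeffX hX.1
  have hτ := contDiffOn_coeffT hX.1
  have h0 : ∀ d : Total, d.1 = 0 → pd d (pd (1, 0, 0, 0) (coeffX X)) m = 0 := fun d hd => by
    rw [pd_comm hM hξ _ _ hm]
    refine pd_eq_zero_of_const (c := 0) hM (fun m' hm' => ?_) _ hm
    have e : d = (0, d.2.1, d.2.2.1, d.2.2.2) := by rw [← hd]
    rw [e]
    exact pd_coeffX_ytv hp hs hε hM hc hX d.2.1 d.2.2.1 d.2.2.2 hm'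
  have hx : pd (1, 0, 0, 0) (pd (1, 0, 0, 0) (coeffX X)) m = 0 := by
    have e1 : pd (1, 0, 0, 0) (pd (0, 0, 1, 0) (coeffT X)) m = 0 := by
      rw [pd_comm hM hτ _ _ hm]
      exact pd_eq_zero_of_const (c := 0) hM
        (fun m' hm' => pd_coeffT_xv hp hs hM hX 1 0 hm') _ hm
    rw [pd_congr hM (h := fun m => 2 * pd (1, 0, 0, 0) (coeffX X) m)
      (fun m' hm' => pd_t_coeffT_eq_two_mul hp hs hε hM hc hX hm') _ hm,
      pd_const_mul ((contDiffAt_of_mem hM (contDiffOn_pd hM hξ _) hm).differentiableAt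
        (by simp))] at e1
    linarith
  have := pd_coords (pd (1, 0, 0, 0) (coeffX X)) d.1 d.2.1 d.2.2.1 d.2.2.2 m
  rw [hx, h0 (0, 1, 0, 0) rfl, h0 (0, 0, 1, 0) rfl, h0 (0, 0, 0, 1) rfl] at this
  simpa using this

theorem iteratedDeriv_coeffX_eq_zero (hp : p ≠ 0) (hs : s ≠ 0) (hε : ε ≠ 0) (hM : IsOpen M)
    (hc : Convex ℝ M) (hX : IsPointSymmetry p s ε M X) {m : Total} (hm : m ∈ M) {n : ℕ}
    (hn : 0 < n) :
    iteratedDeriv (n + 1) (fun r => coeffX X (curveX m (fun _ => m.2.2.2) r)) m.1 = 0 := by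
  have hξ := contDiffOn_coeffX hX.1
  have hself := curveX_self (m := m) (φ := fun _ => m.2.2.2) rfl
  have hcont : ContinuousAt (curveX m fun _ => m.2.2.2) m.1 :=
    (continuous_curveX continuous_const).continuousAt
  rw [iteratedDeriv_succ', ← iteratedDeriv_comp_curve_eq_zero hM hc
    (contDiffOn_pd hM hξ (1, 0, 0, 0)) hcont (by rwa [hself])
    (fun r m' hm' => pd_pd_x_coeffX hp hs hε hM hc hX _ hm') hn]
  refine Filter.EventuallyEq.iteratedDeriv_eq n ?_
  filter_upwards [hcont.preimage_mem_nhds (hM.mem_nhds (by rwa [hself]))] with r hr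
  exact (hasDerivAt_comp_curve hM hξ (hasDerivAt_curveX (hasDerivAt_const r _)) hr).deriv

/-- The coefficient of `v_xxx` combines `η_xv` with `ξˣ_xx`, and the latter is already zero. -/
theorem pd_x_pd_v_coeffV (hp : p ≠ 0) (hs : s ≠ 0) (hε : ε ≠ 0) (hM : IsOpen M)
    (hc : Convex ℝ M) (hX : IsPointSymmetry p s ε M X) {m : Total} (hm : m ∈ M) :
    pd (1, 0, 0, 0) (pd (0, 0, 0, 1) (coeffV X)) m = 0 := by
  have one_mem := pos_mem_powDomain (p := p) one_pos
  have h1 := determining_x hp hs hε hM hc hX hm one_mem 0 1 0 rfl rfl rfl rfl rfl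
  have h0 := determining_x hp hs hε hM hc hX hm one_mem 0 0 0 rfl rfl rfl rfl rfl
  rw [iteratedDeriv_one_curveX hM (contDiffOn_pd hM (contDiffOn_coeffV hX.1) _) hm] at h1 h0
  have e2 := iteratedDeriv_coeffX_eq_zero hp hs hε hM hc hX hm one_pos
  rw [one_add_one_eq_two] at e2
  rw [e2] at h1 h0
  have : 24 * s ≠ 0 := by simpa using hs
  refine (mul_eq_zero.1 ?_).resolve_left this
  linear_combination h0 - h1

/-- What is left after the previous determining equations is affine in `k₂`. Its linear part is the
classifying equation; its constant part will yield the wave equation for `η`. -/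
theorem determining_sum (hp : p ≠ 0) (hs : s ≠ 0) (hε : ε ≠ 0) (hM : IsOpen M)
    (hc : Convex ℝ M) (hX : IsPointSymmetry p s ε M X) {m : Total} (hm : m ∈ M)
    {u : ℝ} (hu : u ∈ powDomain p) (k₂ : ℝ) :
    pd (0, 0, 1, 0) (pd (0, 0, 1, 0) (coeffV X)) m
      - ε * pd (0, 1, 0, 0) (pd (0, 1, 0, 0) (coeffV X)) m
      - (1 + (p + 1) * u ^ p)
        * iteratedDeriv 2 (fun r => coeffV X (curveX m (fun _ => m.2.2.2) r)) m.1
      - s * iteratedDeriv 4 (fun r => coeffV X (curveX m (fun _ => m.2.2.2) r)) m.1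
      - 2 * k₂ * (2 * pd (1, 0, 0, 0) (coeffX X) m * (1 + (p + 1) * u ^ p)
        + p * (p + 1) * u ^ (p - 1) * (pd (1, 0, 0, 0) (coeffV X) m
          + u * (pd (0, 0, 0, 1) (coeffV X) m - pd (1, 0, 0, 0) (coeffX X) m))) = 0 := by
  have hη := contDiffOn_coeffV hX.1
  have key := determining_x hp hs hε hM hc hX hm hu k₂ 0 0 rfl rfl rfl rfl rfl
  have zX : ∀ {n : ℕ}, 0 < n → _ := fun hn => iteratedDeriv_coeffX_eq_zero hp hs hε hM hc hX hm hn
  have hself := curveX_self (m := m) (φ := fun _ => m.2.2.2) rfl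
  have zA : ∀ {n : ℕ}, 0 < n → iteratedDeriv n
      (fun r => pd (0, 0, 0, 1) (coeffV X) (curveX m (fun _ => m.2.2.2) r)) m.1 = 0 := fun hn =>
    iteratedDeriv_comp_curve_eq_zero hM hc (contDiffOn_pd hM hη _)
      (continuous_curveX continuous_const).continuousAt (by rwa [hself]) (fun r m' hm' => by
        simp only [curveX, Prod.mk_sub_mk, sub_self]
        rw [pd_coords, pd_x_pd_v_coeffV hp hs hε hM hc hX hm']; simp) hn
  have z2 := zX one_pos
  have z3 := zX two_pos
  have z4 := zX three_pos
  simp only [Nat.reduceAdd] at z2 z3 z4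
  rw [zA one_pos, zA two_pos, zA three_pos, z2, z3, z4, iteratedDeriv_one_curveX hM hη hm,
    iteratedDeriv_one_curveX hM (contDiffOn_coeffX hX.1) hm,
    pd_t_coeffT_eq_two_mul hp hs hε hM hc hX hm, hself] at key
  linear_combination key

theorem classifying_equation (hp : p ≠ 0) (hs : s ≠ 0) (hε : ε ≠ 0) (hM : IsOpen M)
    (hc : Convex ℝ M) (hX : IsPointSymmetry p s ε M X) {m : Total} (hm : m ∈ M)
    {u : ℝ} (hu : u ∈ powDomain p) :
    2 * pd (1, 0, 0, 0) (coeffX X) m * (1 + (p + 1) * u ^ p)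
      + p * (p + 1) * u ^ (p - 1) * (pd (1, 0, 0, 0) (coeffV X) m
        + u * (pd (0, 0, 0, 1) (coeffV X) m - pd (1, 0, 0, 0) (coeffX X) m)) = 0 := by
  have h1 := determining_sum hp hs hε hM hc hX hm hu 1
  have h0 := determining_sum hp hs hε hM hc hX hm hu 0
  linear_combination (h0 - h1) / 2

end Affine

/-! ### Solving the classifying equation -/

section Classification

variable {p s ε : ℝ} {M : Set Total} {X : Field} {m : Total}

/-- At `u = 1, 2, 4` the three powers form a Vandermonde system with nodes `1, 2^p, 2^(p-1)`.
Neither of the last two nodes is `1`, because `p ≠ 0` and `p ≠ 1`. -/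
theorem eq_zero_of_classifying {p α β γ : ℝ} (hp : p ≠ 0) (hp1 : p ≠ 1)
    (h : ∀ u : ℝ, 0 < u → α + β * u ^ p + γ * u ^ (p - 1) = 0) : α = 0 := by
  have h0 := h 1 one_pos
  have h1 := h 2 two_pos
  have h2 := h (2 * 2) (by norm_num)
  rw [Real.mul_rpow two_pos.le two_pos.le, Real.mul_rpow two_pos.le two_pos.le] at h2
  rw [Real.one_rpow, Real.one_rpow] at h0
  have ne : ∀ {q : ℝ}, q ≠ 0 → (2 : ℝ) ^ q ≠ 1 := fun {q} hq h => by
    have hlog := Real.log_rpow two_pos q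
    rw [h, Real.log_one] at hlog
    exact (mul_ne_zero hq (Real.log_pos one_lt_two).ne') hlog.symm
  have ha : (2 : ℝ) ^ p - 1 ≠ 0 := sub_ne_zero.2 (ne hp)
  have hb : (2 : ℝ) ^ (p - 1) - 1 ≠ 0 := sub_ne_zero.2 (ne (sub_ne_zero.2 hp1))
  refine (mul_eq_zero.1 ?_).resolve_right (mul_ne_zero ha hb)
  -- The weights are the coefficients of the polynomial with roots `2^p` and `2^(p-1)`, which
  -- eliminates `β` and `γ`.
  linear_combination h2 - ((2 : ℝ) ^ p + 2 ^ (p - 1)) * h1 + 2 ^ p * 2 ^ (p - 1) * h0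

theorem pd_x_coeffX_eq_zero (hp : p ≠ 0) (hp1 : p ≠ 1) (hs : s ≠ 0) (hε : ε ≠ 0) (hM : IsOpen M)
    (hc : Convex ℝ M) (hX : IsPointSymmetry p s ε M X) {m : Total} (hm : m ∈ M) :
    pd (1, 0, 0, 0) (coeffX X) m = 0 := by
  set c := pd (1, 0, 0, 0) (coeffX X) m with hc'
  have := eq_zero_of_classifying (α := 2 * c)
    (β := 2 * c * (p + 1) + p * (p + 1) * (pd (0, 0, 0, 1) (coeffV X) m - c))
    (γ := p * (p + 1) * pd (1, 0, 0, 0) (coeffV X) m) hp hp1 fun u hu => by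
      have key := classifying_equation hp hs hε hM hc hX hm (pos_mem_powDomain hu)
      have hu' : u ^ (p - 1) * u = u ^ p := by
        rw [← Real.rpow_add_one hu.ne', sub_add_cancel]
      rw [← hc'] at key
      linear_combination key - p * (p + 1) * (pd (0, 0, 0, 1) (coeffV X) m - c) * hu'
  linarith

/-- With `ξˣ_x = 0` the classifying equation is a non-zero multiple of `η_x + u η_v`; the condition
`p ≠ -1` makes the factor `p(p+1)u^(p-1)` non-zero. -/
theorem pd_coeffV_eq_zero (hp : p ≠ 0) (hp1 : p ≠ -1) (hs : s ≠ 0) (hε : ε ≠ 0) (hM : IsOpen M)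
    (hc : Convex ℝ M) (hX : IsPointSymmetry p s ε M X) {m : Total} (hm : m ∈ M)
    (h0 : pd (1, 0, 0, 0) (coeffX X) m = 0) (a d : ℝ) : pd (a, 0, 0, d) (coeffV X) m = 0 := by
  have hp1' : p + 1 ≠ 0 := fun h => hp1 (eq_neg_of_add_eq_zero_left h)
  have key : ∀ u : ℝ, 0 < u → pd (1, 0, 0, u) (coeffV X) m = 0 := fun u hu => by
    have e := classifying_equation hp hs hε hM hc hX hm (pos_mem_powDomain hu)
    rw [h0] at e
    have hne : p * (p + 1) * u ^ (p - 1) ≠ 0 :=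
      mul_ne_zero (mul_ne_zero hp hp1') (Real.rpow_pos_of_pos hu _).ne'
    refine (mul_eq_zero.1 ?_).resolve_left hne
    rw [pd_coords]
    linear_combination e
  exact pd_eq_zero_of_two (key 1 one_pos) (key 2 two_pos) a d

theorem wave_coeffV (hp : p ≠ 0) (hp1 : p ≠ -1) (hs : s ≠ 0) (hε : ε ≠ 0) (hM : IsOpen M)
    (hc : Convex ℝ M) (hX : IsPointSymmetry p s ε M X)
    (h0 : ∀ m ∈ M, pd (1, 0, 0, 0) (coeffX X) m = 0) {m : Total} (hm : m ∈ M) :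
    pd (0, 0, 1, 0) (pd (0, 0, 1, 0) (coeffV X)) m
      - ε * pd (0, 1, 0, 0) (pd (0, 1, 0, 0) (coeffV X)) m = 0 := by
  have key := determining_sum hp hs hε hM hc hX hm (pos_mem_powDomain one_pos) 0
  have hself := curveX_self (m := m) (φ := fun _ => m.2.2.2) rfl
  have z : ∀ {n : ℕ}, 0 < n → iteratedDeriv n
      (fun r => coeffV X (curveX m (fun _ => m.2.2.2) r)) m.1 = 0 := fun hn =>
    iteratedDeriv_comp_curve_eq_zero hM hc (contDiffOn_coeffV hX.1)
      (continuous_curveX continuous_const).continuousAt (by rwa [hself]) (fun r m' hm' => by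
        simp only [curveX, Prod.mk_sub_mk, sub_self]
        exact pd_coeffV_eq_zero hp hp1 hs hε hM hc hX hm' (h0 m' hm') _ 0) hn
  rw [z two_pos, z four_pos] at key
  linear_combination key

end Classification


/-! ### Factoring functions through linear maps -/

section Factor

/-- Fibres of `L` in the convex set `M` are convex, so `h` is constant on them. The preimages `κ`
come from choice and need not be continuous; smoothness is checked near each `L m` with a translate
of the smooth section `σ` through `m`. -/
theorem exists_contDiffOn_factor {E F : Type*} [NormedAddCommGroup E] [NormedSpace ℝ E]
    [NormedAddCommGroup F] [NormedSpace ℝ F] (L : E →L[ℝ] F) {σ : F → E} (hσ : ContDiff ℝ ∞ σ)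
    (hLσ : ∀ z, L (σ z) = z) {M : Set E} (hM : IsOpen M) (hc : Convex ℝ M) {h : E → ℝ}
    (hh : ContDiffOn ℝ ∞ h M) (h0 : ∀ d, L d = 0 → ∀ m ∈ M, pd d h m = 0) :
    ∃ g : F → ℝ, ContDiffOn ℝ ∞ g (L '' M) ∧ ∀ m ∈ M, h m = g (L m) := by
  classical
  have hex : ∀ z ∈ L '' M, ∃ m ∈ M, L m = z := fun z hz => hz
  choose! κ hκM hκ using hex
  have hfac : ∀ m ∈ M, h m = h (κ (L m)) := fun m hm => by
    have hz := Set.mem_image_of_mem L hm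
    refine eq_of_pd_eq_zero hM hc hh hm (hκM _ hz) (h0 _ ?_)
    rw [map_sub, hκ _ hz, sub_self]
  refine ⟨fun z => h (κ z), ?_, hfac⟩
  rintro _ ⟨m, hm, rfl⟩
  have hpath : ContDiff ℝ ∞ fun z => m + (σ z - σ (L m)) := by fun_prop
  have hm' : m + (σ (L m) - σ (L m)) ∈ M := by simpa using hm
  have hsm : ContDiffAt ℝ ∞ (fun z => h (m + (σ z - σ (L m)))) (L m) :=
    ContDiffAt.comp (L m) (f := fun z => m + (σ z - σ (L m)))
      (contDiffAt_of_mem hM hh hm') hpath.contDiffAt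
  refine (hsm.congr_of_eventuallyEq ?_).contDiffWithinAt
  filter_upwards [hpath.continuous.continuousAt.preimage_mem_nhds (hM.mem_nhds hm')] with z hz
  have hL : L (m + (σ z - σ (L m))) = z := by simp [hLσ]
  have := hfac _ hz
  rw [hL] at this
  exact this.symm

theorem contDiffOn_of_hasDerivAt {g G : ℝ → ℝ} {I : Set ℝ} (hI : IsOpen I)
    (hg : ContDiffOn ℝ ∞ g I) (hG : ∀ a ∈ I, HasDerivAt G (g a) a) : ContDiffOn ℝ ∞ G I := by
  rw [contDiffOn_infty_iff_deriv_of_isOpen hI]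
  exact ⟨fun a ha => (hG a ha).differentiableAt.differentiableWithinAt,
    hg.congr fun a ha => (hG a ha).deriv⟩

end Factor

/-! ### General solution of the wave and Laplace equations -/

section Travelling

/-- The linear functional `y + t`. -/
noncomputable def sumYT : Total →L[ℝ] ℝ :=
  (ContinuousLinearMap.fst ℝ ℝ (ℝ × ℝ)).comp (ContinuousLinearMap.snd ℝ ℝ (ℝ × ℝ × ℝ)) +
    (ContinuousLinearMap.fst ℝ ℝ ℝ).comp ((ContinuousLinearMap.snd ℝ ℝ (ℝ × ℝ)).comp
      (ContinuousLinearMap.snd ℝ ℝ (ℝ × ℝ × ℝ)))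

/-- The linear functional `y - t`. -/
noncomputable def diffYT : Total →L[ℝ] ℝ :=
  (ContinuousLinearMap.fst ℝ ℝ (ℝ × ℝ)).comp (ContinuousLinearMap.snd ℝ ℝ (ℝ × ℝ × ℝ)) -
    (ContinuousLinearMap.fst ℝ ℝ ℝ).comp ((ContinuousLinearMap.snd ℝ ℝ (ℝ × ℝ)).comp
      (ContinuousLinearMap.snd ℝ ℝ (ℝ × ℝ × ℝ)))

/-- The linear map `y + i t`. -/
noncomputable def complexYT : Total →L[ℝ] ℂ :=
  Complex.ofRealCLM.comp
      ((ContinuousLinearMap.fst ℝ ℝ (ℝ × ℝ)).comp (ContinuousLinearMap.snd ℝ ℝ (ℝ × ℝ × ℝ))) +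
    Complex.I • Complex.ofRealCLM.comp
      ((ContinuousLinearMap.fst ℝ ℝ ℝ).comp ((ContinuousLinearMap.snd ℝ ℝ (ℝ × ℝ)).comp
        (ContinuousLinearMap.snd ℝ ℝ (ℝ × ℝ × ℝ))))

theorem sumYT_apply (m : Total) : sumYT m = m.2.1 + m.2.2.1 := rfl

theorem diffYT_apply (m : Total) : diffYT m = m.2.1 - m.2.2.1 := rfl

theorem complexYT_apply (m : Total) : complexYT m = (m.2.1 : ℂ) + Complex.I * (m.2.2.1 : ℂ) := rfl

variable {M : Set Total} {h : Total → ℝ}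

/-- By the factorization `(∂_y - ∂_t)(∂_y + ∂_t) h = 0`, the function `h_y + h_t` depends only on `y
+ t`. If `G` is a primitive of it, then `h - G(y + t)/2` is killed by `∂_y + ∂_t` and depends only
on `y - t`. -/
theorem travelling_of_wave_one (hM : IsOpen M) (hc : Convex ℝ M) (hh : ContDiffOn ℝ ∞ h M)
    (h0 : ∀ a d : ℝ, ∀ m ∈ M, pd (a, 0, 0, d) h m = 0)
    (hw : ∀ m ∈ M, pd (0, 0, 1, 0) (pd (0, 0, 1, 0) h) m = pd (0, 1, 0, 0) (pd (0, 1, 0, 0) h) m) :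
    h ∈ travelling 1 M := by
  have hk := contDiffOn_pd hM hh (0, 1, 1, 0)
  have hpd : ∀ d : Total, ∀ m ∈ M, pd d h m =
      d.2.1 * pd (0, 1, 0, 0) h m + d.2.2.1 * pd (0, 0, 1, 0) h m := fun d m hm => by
    have e1 := h0 1 0 m hm
    have e2 := h0 0 1 m hm
    have := pd_coords h d.1 d.2.1 d.2.2.1 d.2.2.2 m
    rw [e1, e2] at this
    refine Eq.trans this ?_
    ring
  have hk0 : ∀ d : Total, sumYT d = 0 → ∀ m ∈ M, pd d (pd (0, 1, 1, 0) h) m = 0 := by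
    intro d hd m hm
    rw [sumYT_apply] at hd
    -- The kernel of `y + t` consists of the `x`- and `v`-directions together with `∂_y - ∂_t`.
    have hd' : d = (d.1, 0, 0, d.2.2.2) + d.2.1 • ((0, 1, 0, 0) - (0, 0, 1, 0)) := by
      ext <;> simp
      linarith
    have hs : ((0, 1, 1, 0) : Total) = (0, 1, 0, 0) + (0, 0, 1, 0) := by simp
    have e0 : pd (d.1, 0, 0, d.2.2.2) (pd (0, 1, 1, 0) h) m = 0 := by
      rw [pd_comm hM hh _ _ hm]
      exact pd_eq_zero_of_const (c := 0) hM (fun m' hm' => h0 _ _ m' hm') _ hm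
    have e1 := hw m hm
    have e2 := pd_comm hM hh (0, 1, 0, 0) (0, 0, 1, 0) hm
    rw [hd', pd_add, e0, pd_smul, pd_pd hM hh _ _ hm, hs]
    rw [pd_pd hM hh _ _ hm, pd_pd hM hh _ _ hm] at e1 e2
    rw [map_sub, map_add]
    simp only [sub_apply]
    linear_combination d.2.1 * (e2 - e1)
  have hsec : ContDiff ℝ ∞ (fun a : ℝ => ((0, a, 0, 0) : Total)) := by fun_prop
  obtain ⟨g, hg, hgk⟩ := exists_contDiffOn_factor sumYT hsec (fun a => by simp [sumYT_apply])
    hM hc hk hk0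
  have hIo : IsOpen (sumYT '' M) :=
    sumYT.isOpenMap (fun a => ⟨(0, a, 0, 0), by simp [sumYT_apply]⟩) M hM
  have hIc : Convex ℝ (sumYT '' M) := hc.linear_image sumYT.toLinearMap
  obtain ⟨G, hG'⟩ := hIc.exists_forall_hasDerivWithinAt (𝕜 := ℝ) (hg.differentiableOn (by simp))
  have hG : ∀ a ∈ sumYT '' M, HasDerivAt G (g a) a := fun a ha =>
    (hG' a ha).hasDerivAt (hIo.mem_nhds ha)
  have hGs := contDiffOn_of_hasDerivAt hIo hg hG
  have hR : ContDiffOn ℝ ∞ (fun m => h m - 1 / 2 * G (sumYT m)) M :=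
    hh.sub (contDiffOn_const.mul (hGs.comp sumYT.contDiff.contDiffOn (Set.mapsTo_image _ _)))
  have hR0 : ∀ d : Total, diffYT d = 0 → ∀ m ∈ M,
      pd d (fun m => h m - 1 / 2 * G (sumYT m)) m = 0 := by
    intro d hd m hm
    rw [diffYT_apply] at hd
    have h1 := (hasFDerivAt_of_mem hM hh hm).sub
      (((hG _ (Set.mem_image_of_mem _ hm)).comp_hasFDerivAt m sumYT.hasFDerivAt).const_mul (1 / 2))
    have h2 : pd d (fun m => h m - 1 / 2 * G (sumYT m)) m =
        pd d h m - 1 / 2 * (g (sumYT m) * sumYT d) :=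
      congrArg (fun A : Total →L[ℝ] ℝ => A d) h1.fderiv
    have h3 := hpd (0, 1, 1, 0) m hm
    simp only [one_mul] at h3
    rw [h2, ← hgk m hm, h3, hpd d m hm, sumYT_apply]
    linear_combination (1 / 2) * (pd (0, 1, 0, 0) h m - pd (0, 0, 1, 0) h m) * hd
  obtain ⟨f₂, hf₂, hf₂R⟩ := exists_contDiffOn_factor diffYT hsec (fun a => by simp [diffYT_apply])
    hM hc hR hR0
  exact Or.inl ⟨rfl, fun a => 1 / 2 * G a, f₂, contDiffOn_const.mul hGs, hf₂, fun m hm => by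
    have := hf₂R m hm
    rw [sumYT_apply, diffYT_apply] at this
    linarith⟩

/-- As a function of `z = y + it`, `h` is a harmonic function `w`, so `w_y - i w_t` is holomorphic.
On the convex image of `M` it has a primitive `Φ`, and `w - Re Φ` is constant because its gradient
vanishes. -/
theorem travelling_of_wave_neg_one (hM : IsOpen M) (hc : Convex ℝ M)
    (hh : ContDiffOn ℝ ∞ h M) (h0 : ∀ a d : ℝ, ∀ m ∈ M, pd (a, 0, 0, d) h m = 0)
    (hw : ∀ m ∈ M, pd (0, 0, 1, 0) (pd (0, 0, 1, 0) h) m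
      = -pd (0, 1, 0, 0) (pd (0, 1, 0, 0) h) m) :
    h ∈ travelling (-1) M := by
  have hsec : ContDiff ℝ ∞ (fun z : ℂ => ((0, Complex.reCLM z, Complex.imCLM z, 0) : Total)) := by
    fun_prop
  have hLs : ∀ z : ℂ, complexYT (0, Complex.reCLM z, Complex.imCLM z, 0) = z := fun z => by
    rw [complexYT_apply, mul_comm]; exact Complex.re_add_im z
  have hker : ∀ d : Total, complexYT d = 0 → d = (d.1, 0, 0, d.2.2.2) := fun d hd => by
    rw [complexYT_apply] at hd
    have h1 := congrArg Complex.re hd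
    have h2 := congrArg Complex.im hd
    simp at h1 h2
    ext <;> simp [h1, h2]
  obtain ⟨w, hws, hwh⟩ := exists_contDiffOn_factor complexYT hsec hLs hM hc hh fun d hd m hm => by
    rw [hker d hd]; exact h0 _ _ m hm
  have hΩo : IsOpen (complexYT '' M) := complexYT.isOpenMap (fun z => ⟨_, hLs z⟩) M hM
  have hΩc : Convex ℝ (complexYT '' M) := hc.linear_image complexYT.toLinearMap
  have h1 : ∀ d : Total, ∀ m ∈ M, pd d h m = pd (complexYT d) w (complexYT m) := fun d m hm => by
    have h2 := (hasFDerivAt_of_mem hΩo hws (Set.mem_image_of_mem _ hm)).comp m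
      complexYT.hasFDerivAt
    rw [pd_congr hM (h := w ∘ complexYT) hwh d hm]
    exact congrArg (fun A : Total →L[ℝ] ℝ => A d) h2.fderiv
  have h2 : ∀ d : Total, ∀ m ∈ M, pd d (pd d h) m =
      pd (complexYT d) (pd (complexYT d) w) (complexYT m) := fun d m hm => by
    have hs := contDiffOn_pd hΩo hws (complexYT d)
    have h3 := (hasFDerivAt_of_mem hΩo hs (Set.mem_image_of_mem _ hm)).comp m
      complexYT.hasFDerivAt
    rw [pd_congr hM (h := pd (complexYT d) w ∘ complexYT) (h1 d) d hm]
    exact congrArg (fun A : Total →L[ℝ] ℝ => A d) h3.fderiv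
  have hY : complexYT (0, 1, 0, 0) = 1 := by simp [complexYT_apply]
  have hT : complexYT (0, 0, 1, 0) = Complex.I := by simp [complexYT_apply]
  have hharm : ∀ z ∈ complexYT '' M, InnerProductSpace.HarmonicAt w z := fun z hz => by
    refine ⟨(contDiffAt_of_mem hΩo hws hz).of_le (by simpa using natCast_le_infty 2), ?_⟩
    filter_upwards [hΩo.mem_nhds hz] with z' hz'
    obtain ⟨m, hm, rfl⟩ := hz'
    have := hw m hm
    rw [h2 _ m hm, h2 _ m hm, hY, hT, pd_pd hΩo hws _ _ (Set.mem_image_of_mem _ hm),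
      pd_pd hΩo hws _ _ (Set.mem_image_of_mem _ hm)] at this
    rw [InnerProductSpace.laplacian_eq_iteratedFDeriv_complexPlane]
    simp [iteratedFDeriv_two_apply, this]
  obtain ⟨Φ, hΦ'⟩ := hΩc.exists_forall_hasDerivWithinAt (𝕜 := ℂ) fun z hz =>
    (HarmonicAt.differentiableAt_complex_partial (hharm z hz)).differentiableWithinAt
  have hΦ : ∀ z ∈ complexYT '' M, HasDerivAt Φ _ z := fun z hz =>
    (hΦ' z hz).hasDerivAt (hΩo.mem_nhds hz)
  obtain ⟨k, hk⟩ := hΩo.exists_is_const_of_fderiv_eq_zero (𝕜 := ℝ)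
    (f := fun z => w z - (Φ z).re) hΩc.isPreconnected
    (fun z hz => by
      have e1 := (hasFDerivAt_of_mem hΩo hws hz).differentiableAt
      have e2 := ((hΦ z hz).differentiableAt.restrictScalars ℝ)
      exact (e1.sub (Complex.reCLM.differentiableAt.comp z e2)).differentiableWithinAt)
    (fun z hz => by
      have e1 := (hasFDerivAt_of_mem hΩo hws hz)
      have e2 := Complex.reCLM.hasFDerivAt.comp z ((hΦ z hz).hasFDerivAt.restrictScalars ℝ)
      refine (e1.sub e2).fderiv.trans ?_
      ext d
      have hd : d = d.re • (1 : ℂ) + d.im • Complex.I := by simp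
      have e3 : fderiv ℝ w z d = d.re * fderiv ℝ w z 1 + d.im * fderiv ℝ w z Complex.I := by
        conv_lhs => rw [hd, map_add, map_smul, map_smul]
        rfl
      simp [e3])
  have hΦd : DifferentiableOn ℂ (fun z => 1 / 2 * (Φ z + k)) (complexYT '' M) := fun z hz =>
    (((hΦ z hz).differentiableAt.add_const _).const_mul _).differentiableWithinAt
  -- With `F = (Φ + k)/2` and `f₂ z = conj (F (conj z))`, the sum `F(y + it) + f₂(y - it)` equals `2
  -- Re F(y + it)`, which is `w`.
  refine Or.inr ⟨rfl, fun z => 1 / 2 * (Φ z + k),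
    (starRingEnd ℂ) ∘ (fun z => 1 / 2 * (Φ z + k)) ∘ (starRingEnd ℂ), hΦd, ?_, fun m hm => ?_⟩
  · rintro _ ⟨m, hm, rfl⟩
    have e : (m.2.1 : ℂ) - Complex.I * (m.2.2.1 : ℂ) = (starRingEnd ℂ) (complexYT m) := by
      simp [complexYT_apply, sub_eq_add_neg]
    have hm' := Set.mem_image_of_mem complexYT hm
    simp only [e]
    exact ((hΦd.differentiableAt (hΩo.mem_nhds hm')).conj_conj).differentiableWithinAt
  · have e : (m.2.1 : ℂ) - Complex.I * (m.2.2.1 : ℂ) = (starRingEnd ℂ) (complexYT m) := by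
      simp [complexYT_apply, sub_eq_add_neg]
    have hm' := Set.mem_image_of_mem complexYT hm
    have e1 := hk _ hm'
    rw [← hwh m hm] at e1
    rw [e, ← complexYT_apply, Function.comp_apply, Function.comp_apply, Complex.conj_conj]
    apply Complex.ext
    · simp; linarith
    · simp

theorem travelling_of_wave {ε : ℝ} (hε : ε = 1 ∨ ε = -1) (hM : IsOpen M) (hc : Convex ℝ M)
    (hh : ContDiffOn ℝ ∞ h M)
    (h0 : ∀ a d : ℝ, ∀ m ∈ M, pd (a, 0, 0, d) h m = 0)
    (hw : ∀ m ∈ M, pd (0, 0, 1, 0) (pd (0, 0, 1, 0) h) m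
      - ε * pd (0, 1, 0, 0) (pd (0, 1, 0, 0) h) m = 0) : h ∈ travelling ε M := by
  rcases hε with rfl | rfl
  · exact travelling_of_wave_one hM hc hh h0 fun m hm => by linarith [hw m hm]
  · exact travelling_of_wave_neg_one hM hc hh h0 fun m hm => by linarith [hw m hm]

end Travelling


/-! ### Travelling functions are exactly the wave solutions -/

section WaveSolutions

variable {M : Set Total} {ε : ℝ}

theorem isOpen_image_diff (hM : IsOpen M) : IsOpen (diffYT '' M) :=
  diffYT.isOpenMap (fun a => ⟨(0, a, 0, 0), by simp [diffYT_apply]⟩) M hM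

theorem isOpen_image_sum (hM : IsOpen M) : IsOpen (sumYT '' M) :=
  sumYT.isOpenMap (fun a => ⟨(0, a, 0, 0), by simp [sumYT_apply]⟩) M hM

theorem isOpen_image_yt (hM : IsOpen M) :
    IsOpen ((fun m : Total => (m.2.1, m.2.2.1)) '' M) :=
  ((IsOpenMap.id.prodMap isOpenMap_fst).comp isOpenMap_snd) M hM

theorem isWaveSolution_of_real (hM : IsOpen M) {f₁ f₂ : ℝ → ℝ}
    (h₁ : ContDiffOn ℝ ∞ f₁ ((fun m : Total => m.2.1 + m.2.2.1) '' M))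
    (h₂ : ContDiffOn ℝ ∞ f₂ ((fun m : Total => m.2.1 - m.2.2.1) '' M)) :
    IsWaveSolution 1 ((fun m : Total => (m.2.1, m.2.2.1)) '' M)
      fun n => f₁ (n.1 + n.2) + f₂ (n.1 - n.2) := by
  constructor
  · refine (h₁.comp (by fun_prop) ?_).add (h₂.comp (by fun_prop) ?_)
    · rintro _ ⟨m, hm, rfl⟩; exact ⟨m, hm, rfl⟩
    · rintro _ ⟨m, hm, rfl⟩; exact ⟨m, hm, rfl⟩
  · rintro _ ⟨m, hm, rfl⟩
    have c₁ : ContDiffAt ℝ ∞ f₁ (m.2.1 + m.2.2.1) :=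
      h₁.contDiffAt ((isOpen_image_sum hM).mem_nhds ⟨m, hm, rfl⟩)
    have c₂ : ContDiffAt ℝ ∞ f₂ (m.2.1 - m.2.2.1) :=
      h₂.contDiffAt ((isOpen_image_diff hM).mem_nhds ⟨m, hm, rfl⟩)
    have le : (2 : WithTop ℕ∞) ≤ ∞ := by simpa using natCast_le_infty 2
    have et := iteratedDeriv_add (n := 2) (x := m.2.2.1) (f := fun t => f₁ (m.2.1 + t))
      (g := fun t => f₂ (m.2.1 - t))
      (ContDiffAt.comp m.2.2.1 (f := fun t => m.2.1 + t) (c₁.of_le le) (by fun_prop))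
      (ContDiffAt.comp m.2.2.1 (f := fun t => m.2.1 - t) (c₂.of_le le) (by fun_prop))
    have ey := iteratedDeriv_add (n := 2) (x := m.2.1) (f := fun y => f₁ (y + m.2.2.1))
      (g := fun y => f₂ (y - m.2.2.1))
      (ContDiffAt.comp m.2.1 (f := fun y => y + m.2.2.1) (c₁.of_le le) (by fun_prop))
      (ContDiffAt.comp m.2.1 (f := fun y => y - m.2.2.1) (c₂.of_le le) (by fun_prop))
    simp only [Pi.add_def] at et ey
    rw [et, ey, iteratedDeriv_comp_const_add, iteratedDeriv_comp_const_sub,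
      iteratedDeriv_comp_add_const, iteratedDeriv_comp_sub_const]
    simp

theorem hasDerivAt_re_comp_affine {g : ℂ → ℂ} {a b : ℂ} {r : ℝ}
    (hg : DifferentiableAt ℂ g (a + b * r)) :
    HasDerivAt (fun r : ℝ => (g (a + b * r)).re) (b * deriv g (a + b * r)).re r := by
  have h1 : HasDerivAt (fun z : ℂ => a + b * z) b (r : ℂ) := by
    simpa using ((hasDerivAt_id (r : ℂ)).const_mul b).const_add a
  have h2 := HasDerivAt.comp (r : ℂ) (h₂ := g) hg.hasDerivAt h1
  rw [mul_comm]
  exact h2.real_of_complex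

/-- With `b = ±i` this computes the `t`-derivatives and with `b = 1` the `y`-derivatives; `b² = ∓1`
then gives the Laplace equation. -/
theorem iteratedDeriv_two_re_comp_affine {g : ℂ → ℂ} {U : Set ℂ} (hU : IsOpen U)
    (hg : DifferentiableOn ℂ g U) {a b : ℂ} {r : ℝ} (hr : a + b * r ∈ U) :
    iteratedDeriv 2 (fun r : ℝ => (g (a + b * r)).re) r =
      (b ^ 2 * deriv (deriv g) (a + b * r)).re := by
  have hd : DifferentiableOn ℂ (fun z => b * deriv g z) U := (hg.deriv hU).const_mul b
  have h := hasDerivAt_re_comp_affine (hd.differentiableAt (hU.mem_nhds hr))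
  rw [deriv_const_mul _ ((hg.deriv hU).differentiableAt (hU.mem_nhds hr))] at h
  rw [iteratedDeriv_succ', iteratedDeriv_one, pow_two, mul_assoc, ← h.deriv]
  have hc : ContinuousAt (fun r : ℝ => a + b * (r : ℂ)) r := by fun_prop
  refine Filter.EventuallyEq.deriv_eq ?_
  filter_upwards [hc.preimage_mem_nhds (hU.mem_nhds hr)] with r' hr'
  exact (hasDerivAt_re_comp_affine (hg.differentiableAt (hU.mem_nhds hr'))).deriv

theorem contDiffOn_re_comp {g : ℂ → ℂ} {U : Set ℂ} (hU : IsOpen U)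
    (hg : DifferentiableOn ℂ g U) {N : Set (ℝ × ℝ)} {l : ℝ × ℝ → ℂ} (hl : ContDiff ℝ ∞ l)
    (hlN : Set.MapsTo l N U) : ContDiffOn ℝ ∞ (fun n => (g (l n)).re) N := by
  have h1 : ContDiffOn ℝ ∞ g U := (hg.contDiffOn hU).restrict_scalars ℝ
  exact Complex.reCLM.contDiff.comp_contDiffOn (h1.comp hl.contDiffOn hlN)

theorem isWaveSolution_of_complex (hM : IsOpen M) {f₁ f₂ : ℂ → ℂ}
    (h₁ : DifferentiableOn ℂ f₁
      ((fun m : Total => (m.2.1 : ℂ) + Complex.I * (m.2.2.1 : ℂ)) '' M))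
    (h₂ : DifferentiableOn ℂ f₂
      ((fun m : Total => (m.2.1 : ℂ) - Complex.I * (m.2.2.1 : ℂ)) '' M)) :
    IsWaveSolution (-1) ((fun m : Total => (m.2.1, m.2.2.1)) '' M) fun n =>
      (f₁ ((n.1 : ℂ) + Complex.I * (n.2 : ℂ))).re + (f₂ ((n.1 : ℂ) - Complex.I * (n.2 : ℂ))).re := by
  have hLs : ∀ z : ℂ, complexYT (0, z.re, z.im, 0) = z := fun z => by
    rw [complexYT_apply, mul_comm]; exact Complex.re_add_im z
  have o₁ : IsOpen ((fun m : Total => (m.2.1 : ℂ) + Complex.I * (m.2.2.1 : ℂ)) '' M) :=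
    complexYT.isOpenMap (fun z => ⟨_, hLs z⟩) M hM
  have o₂ : IsOpen ((fun m : Total => (m.2.1 : ℂ) - Complex.I * (m.2.2.1 : ℂ)) '' M) := by
    have e : (fun m : Total => (m.2.1 : ℂ) - Complex.I * (m.2.2.1 : ℂ)) =
        Complex.conjCLE ∘ complexYT := by
      ext m; simp [complexYT_apply, sub_eq_add_neg]
    rw [e, Set.image_comp]
    exact Complex.conjCLE.toHomeomorph.isOpenMap _ o₁
  have cofReal : ContDiff ℝ ∞ (fun r : ℝ => (r : ℂ)) := Complex.ofRealCLM.contDiff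
  have l₁ : ContDiff ℝ ∞ (fun n : ℝ × ℝ => (n.1 : ℂ) + Complex.I * (n.2 : ℂ)) :=
    (cofReal.comp contDiff_fst).add (contDiff_const.mul (cofReal.comp contDiff_snd))
  have l₂ : ContDiff ℝ ∞ (fun n : ℝ × ℝ => (n.1 : ℂ) - Complex.I * (n.2 : ℂ)) :=
    (cofReal.comp contDiff_fst).sub (contDiff_const.mul (cofReal.comp contDiff_snd))
  have m₁ : Set.MapsTo (fun n : ℝ × ℝ => (n.1 : ℂ) + Complex.I * (n.2 : ℂ))
      ((fun m : Total => (m.2.1, m.2.2.1)) '' M)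
      ((fun m : Total => (m.2.1 : ℂ) + Complex.I * (m.2.2.1 : ℂ)) '' M) := by
    rintro _ ⟨m, hm, rfl⟩; exact ⟨m, hm, rfl⟩
  have m₂ : Set.MapsTo (fun n : ℝ × ℝ => (n.1 : ℂ) - Complex.I * (n.2 : ℂ))
      ((fun m : Total => (m.2.1, m.2.2.1)) '' M)
      ((fun m : Total => (m.2.1 : ℂ) - Complex.I * (m.2.2.1 : ℂ)) '' M) := by
    rintro _ ⟨m, hm, rfl⟩; exact ⟨m, hm, rfl⟩
  have s₁ := contDiffOn_re_comp o₁ h₁ l₁ m₁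
  have s₂ := contDiffOn_re_comp o₂ h₂ l₂ m₂
  refine ⟨s₁.add s₂, fun n hn => ?_⟩
  have hN := (isOpen_image_yt hM).mem_nhds hn
  have le : (2 : WithTop ℕ∞) ≤ ∞ := by simpa using natCast_le_infty 2
  have c₁ := (s₁.contDiffAt hN).of_le le
  have c₂ := (s₂.contDiffAt hN).of_le le
  have et := iteratedDeriv_add (n := 2) (x := n.2)
    (ContDiffAt.comp n.2 (f := fun t => (n.1, t)) c₁ (by fun_prop))
    (ContDiffAt.comp n.2 (f := fun t => (n.1, t)) c₂ (by fun_prop))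
  have ey := iteratedDeriv_add (n := 2) (x := n.1)
    (ContDiffAt.comp n.1 (f := fun y => (y, n.2)) c₁ (by fun_prop))
    (ContDiffAt.comp n.1 (f := fun y => (y, n.2)) c₂ (by fun_prop))
  have t₁ := iteratedDeriv_two_re_comp_affine o₁ h₁ (a := (n.1 : ℂ)) (b := Complex.I) (m₁ hn)
  have t₂ := iteratedDeriv_two_re_comp_affine o₂ h₂ (a := (n.1 : ℂ)) (b := -Complex.I) (r := n.2)
    (by simpa [sub_eq_add_neg] using m₂ hn)
  have y₁ := iteratedDeriv_two_re_comp_affine o₁ h₁ (a := Complex.I * (n.2 : ℂ)) (b := 1)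
    (r := n.1) (by simpa [add_comm] using m₁ hn)
  have y₂ := iteratedDeriv_two_re_comp_affine o₂ h₂ (a := -(Complex.I * (n.2 : ℂ))) (b := 1)
    (r := n.1) (by simpa [sub_eq_add_neg, add_comm] using m₂ hn)
  simp only [Pi.add_def, Function.comp_def] at et ey
  simp only [neg_mul, ← sub_eq_add_neg] at t₂
  simp only [one_mul, neg_add_eq_sub, add_comm (Complex.I * (n.2 : ℂ))] at y₁ y₂
  rw [et, ey, t₁, t₂, y₁, y₂]
  simp
  ring

theorem exists_waveSolution_of_travelling (hM : IsOpen M) {b : Total → ℝ}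
    (hb : b ∈ travelling ε M) :
    ∃ W : ℝ × ℝ → ℝ, IsWaveSolution ε ((fun m : Total => (m.2.1, m.2.2.1)) '' M) W ∧
      ∀ m ∈ M, b m = W (m.2.1, m.2.2.1) := by
  rcases hb with ⟨rfl, f₁, f₂, h₁, h₂, h⟩ | ⟨rfl, f₁, f₂, h₁, h₂, h⟩
  · exact ⟨_, isWaveSolution_of_real hM h₁ h₂, h⟩
  · refine ⟨_, isWaveSolution_of_complex hM h₁ h₂, fun m hm => ?_⟩
    -- The sum is real, so it equals the sum of the real parts even if the two summands are not
    -- real.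
    have := congrArg Complex.re (h m hm)
    simpa using this

theorem travelling_congr {b c : Total → ℝ} (h : Set.EqOn b c M) (hb : b ∈ travelling ε M) :
    c ∈ travelling ε M := by
  rcases hb with ⟨hε, f₁, f₂, h₁, h₂, e⟩ | ⟨hε, f₁, f₂, h₁, h₂, e⟩
  · exact Or.inl ⟨hε, f₁, f₂, h₁, h₂, fun m hm => by rw [← h hm, e m hm]⟩
  · exact Or.inr ⟨hε, f₁, f₂, h₁, h₂, fun m hm => by rw [← h hm, e m hm]⟩

theorem travelling_of_waveSolution (hε : ε = 1 ∨ ε = -1) (hM : IsOpen M) (hc : Convex ℝ M)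
    {b : Total → ℝ} {W : ℝ × ℝ → ℝ}
    (hW : IsWaveSolution ε ((fun m : Total => (m.2.1, m.2.2.1)) '' M) W)
    (hb : ∀ m ∈ M, b m = W (m.2.1, m.2.2.1)) : b ∈ travelling ε M := by
  have hsm : ContDiffOn ℝ ∞ (fun m : Total => W (m.2.1, m.2.2.1)) M :=
    hW.1.comp (by fun_prop) (Set.mapsTo_image _ _)
  refine travelling_congr (fun m hm => (hb m hm).symm)
    (travelling_of_wave hε hM hc hsm (fun a d m hm => ?_) fun m hm => ?_)
  · have h1 : HasDerivAt (fun r : ℝ => ((m.1 + r * a, m.2.1, m.2.2.1, m.2.2.2 + r * d) : Total))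
        (a, 0, 0, d) 0 := by
      refine HasDerivAt.prodMk ?_ ((hasDerivAt_const _ _).prodMk
        ((hasDerivAt_const _ _).prodMk ?_))
      · simpa using ((hasDerivAt_id (0 : ℝ)).mul_const a).const_add m.1
      · simpa using ((hasDerivAt_id (0 : ℝ)).mul_const d).const_add m.2.2.2
    have h2 := hasDerivAt_comp_curve hM hsm h1 (by simpa using hm)
    have h3 := h2.unique (hasDerivAt_const (0 : ℝ) (W (m.2.1, m.2.2.1)))
    simpa using h3
  · have hT := iteratedDeriv_two_comp_line hM hsm (r₀ := m.2.2.1)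
      (fun r => hasDerivAt_curveT (m := m) (hasDerivAt_const r m.2.2.2))
      (by rwa [curveT_self rfl])
    have hY := iteratedDeriv_two_comp_line hM hsm (r₀ := m.2.1)
      (fun r => hasDerivAt_curveY (m := m) (hasDerivAt_const r m.2.2.2))
      (by rwa [curveY_self rfl])
    rw [curveT_self rfl] at hT
    rw [curveY_self rfl] at hY
    have := hW.2 _ (Set.mem_image_of_mem _ hm)
    simp only at this
    simp only [curveT] at hT
    simp only [curveY] at hY
    rw [← hT, ← hY, this]

end WaveSolutions

/-! ### Integrating the determining equations and conclusion -/

section Generation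

variable {p s ε : ℝ} {M : Set Total} {X : Field}

theorem pd_eq_zero_of_coords {h : Total → ℝ} {m : Total} (hx : pd (1, 0, 0, 0) h m = 0)
    (hy : pd (0, 1, 0, 0) h m = 0) (ht : pd (0, 0, 1, 0) h m = 0)
    (hv : pd (0, 0, 0, 1) h m = 0) (d : Total) : pd d h m = 0 := by
  have := pd_coords h d.1 d.2.1 d.2.2.1 d.2.2.2 m
  rw [hx, hy, ht, hv] at this
  simpa using this

/-- The equations make `ξˣ` constant, `τ` affine in `y` and `ξʸ` affine in `t`, with slopes `β` and
`εβ`. The common `β` is the coefficient of the boost. -/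
theorem generatedBy_of_pd (hε : ε = 1 ∨ ε = -1) (hM : IsOpen M) (hc : Convex ℝ M)
    (hn : M.Nonempty) (hX : ContDiffOn ℝ ∞ X M)
    (hξ : ∀ d, ∀ m ∈ M, pd d (coeffX X) m = 0)
    (hζ : ∀ a d : ℝ, ∀ m ∈ M, pd (a, 0, 0, d) (coeffY X) m = 0)
    (hτ : ∀ a d : ℝ, ∀ m ∈ M, pd (a, 0, 0, d) (coeffT X) m = 0)
    (hζy : ∀ m ∈ M, pd (0, 1, 0, 0) (coeffY X) m = 0)
    (hτt : ∀ m ∈ M, pd (0, 0, 1, 0) (coeffT X) m = 0)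
    (hζτ : ∀ m ∈ M, pd (0, 0, 1, 0) (coeffY X) m = ε * pd (0, 1, 0, 0) (coeffT X) m)
    (hη : ∀ a d : ℝ, ∀ m ∈ M, pd (a, 0, 0, d) (coeffV X) m = 0)
    (hw : ∀ m ∈ M, pd (0, 0, 1, 0) (pd (0, 0, 1, 0) (coeffV X)) m
      - ε * pd (0, 1, 0, 0) (pd (0, 1, 0, 0) (coeffV X)) m = 0) :
    GeneratedBy (generalGenerators ε M) M X := by
  have hε0 : ε ≠ 0 := by rcases hε with rfl | rfl <;> norm_num
  obtain ⟨m₀, hm₀⟩ := hn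
  have sX := contDiffOn_coeffX hX
  have sY := contDiffOn_coeffY hX
  have sT := contDiffOn_coeffT hX
  have hpdT : ∀ d : Total, ∀ m ∈ M, pd d (coeffT X) m = d.2.1 * pd (0, 1, 0, 0) (coeffT X) m := by
    intro d m hm
    have := pd_coords (coeffT X) d.1 d.2.1 d.2.2.1 d.2.2.2 m
    rw [hτ 1 0 m hm, hτ 0 1 m hm, hτt m hm] at this
    simpa using this
  have hpdY : ∀ d : Total, ∀ m ∈ M,
      pd d (coeffY X) m = d.2.2.1 * (ε * pd (0, 1, 0, 0) (coeffT X) m) := by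
    intro d m hm
    have := pd_coords (coeffY X) d.1 d.2.1 d.2.2.1 d.2.2.2 m
    rw [hζ 1 0 m hm, hζ 0 1 m hm, hζy m hm, hζτ m hm] at this
    simpa using this
  set β := pd (0, 1, 0, 0) (coeffT X) m₀ with hβ
  have sTy := contDiffOn_pd hM sT (0, 1, 0, 0)
  have hTy0 : ∀ m ∈ M, ∀ d, pd d (pd (0, 1, 0, 0) (coeffT X)) m = 0 := fun m hm => by
    refine pd_eq_zero_of_coords ?_ ?_ ?_ ?_
    · rw [pd_comm hM sT _ _ hm]
      exact pd_eq_zero_of_const (c := 0) hM (fun m' hm' => hτ 1 0 m' hm') _ hm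
    -- Here `ε τ_yy = ξʸ_ty = ξʸ_yt = 0`.
    · have e : pd (0, 1, 0, 0) (pd (0, 0, 1, 0) (coeffY X)) m = 0 := by
        rw [pd_comm hM sY _ _ hm]
        exact pd_eq_zero_of_const (c := 0) hM hζy _ hm
      rw [pd_congr hM (h := fun m => ε * pd (0, 1, 0, 0) (coeffT X) m) hζτ _ hm,
        pd_const_mul ((contDiffAt_of_mem hM sTy hm).differentiableAt (by simp))] at e
      exact (mul_eq_zero.1 e).resolve_left hε0
    · rw [pd_comm hM sT _ _ hm]
      exact pd_eq_zero_of_const (c := 0) hM hτt _ hm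
    · rw [pd_comm hM sT _ _ hm]
      exact pd_eq_zero_of_const (c := 0) hM (fun m' hm' => hτ 0 1 m' hm') _ hm
  have hTy : ∀ m ∈ M, pd (0, 1, 0, 0) (coeffT X) m = β := fun m hm =>
    (eq_of_pd_eq_zero hM hc sTy hm₀ hm fun m' hm' => hTy0 m' hm' _).symm
  have hT : ∀ m ∈ M, coeffT X m = coeffT X m₀ + (m.2.1 - m₀.2.1) * β := fun m hm => by
    rw [eq_add_pd_of_pd_pd_eq_zero hM hc sT hm₀ hm fun m' hm' => ?_, hpdT _ m₀ hm₀]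
    · rfl
    · exact pd_eq_zero_of_const (c := (m - m₀).2.1 * β) hM
        (fun z hz => by rw [hpdT _ z hz, hTy z hz]) _ hm'
  have hY : ∀ m ∈ M, coeffY X m = coeffY X m₀ + (m.2.2.1 - m₀.2.2.1) * (ε * β) := fun m hm => by
    rw [eq_add_pd_of_pd_pd_eq_zero hM hc sY hm₀ hm fun m' hm' => ?_, hpdY _ m₀ hm₀]
    · rfl
    · exact pd_eq_zero_of_const (c := (m - m₀).2.2.1 * (ε * β)) hM
        (fun z hz => by rw [hpdY _ z hz, hTy z hz]) _ hm'
  have hXc : ∀ m ∈ M, coeffX X m = coeffX X m₀ := fun m hm =>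
    (eq_of_pd_eq_zero hM hc sX hm₀ hm fun m' hm' => hξ _ m' hm').symm
  have hb := travelling_of_wave hε hM hc (contDiffOn_coeffV hX) hη hw
  -- The translation coefficients are the values at `m₀` minus what `β • boost ε` contributes there.
  refine ⟨coeffX X m₀ • transX + (coeffY X m₀ - m₀.2.2.1 * (ε * β)) • transY
    + (coeffT X m₀ - m₀.2.1 * β) • transT + β • boost ε + shift (coeffV X), ?_, fun m hm => ?_⟩
  · have gen : ∀ Y ∈ generalGenerators ε M, Y ∈ Submodule.span ℝ (generalGenerators ε M) :=
      fun Y hY => Submodule.subset_span hY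
    refine Submodule.add_mem _ (Submodule.add_mem _ (Submodule.add_mem _ (Submodule.add_mem _
      (Submodule.smul_mem _ _ (gen _ ?_)) (Submodule.smul_mem _ _ (gen _ ?_)))
      (Submodule.smul_mem _ _ (gen _ ?_))) (Submodule.smul_mem _ _ (gen _ ?_))) (gen _ ?_)
    · simp [generalGenerators]
    · simp [generalGenerators]
    · simp [generalGenerators]
    · simp [generalGenerators]
    · exact Or.inr ⟨_, hb, rfl⟩
  · have e1 : (X m).1 = coeffX X m₀ := hXc m hm
    have e2 : (X m).2.1 = _ := hY m hm
    have e3 : (X m).2.2.1 = _ := hT m hm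
    refine Prod.ext ?_ (Prod.ext ?_ (Prod.ext ?_ ?_))
    · simp [transX, transY, transT, boost, shift, e1]
    · simp [transX, transY, transT, boost, shift, e2]; ring
    · simp [transX, transY, transT, boost, shift, e3]; ring
    · simp [transX, transY, transT, boost, shift, coeffV]

theorem generatedBy_of_isPointSymmetry (hp : p ≠ 0) (hp1 : p ≠ -1) (hs : s ≠ 0)
    (hε : ε = 1 ∨ ε = -1) (hM : IsOpen M) (hc : Convex ℝ M) (hn : M.Nonempty)
    (hX : IsPointSymmetry p s ε M X) (h0 : ∀ m ∈ M, pd (1, 0, 0, 0) (coeffX X) m = 0) :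
    GeneratedBy (generalGenerators ε M) M X := by
  have hε0 : ε ≠ 0 := by rcases hε with rfl | rfl <;> norm_num
  have hτt : ∀ m ∈ M, pd (0, 0, 1, 0) (coeffT X) m = 0 := fun m hm => by
    rw [pd_t_coeffT_eq_two_mul hp hs hε0 hM hc hX hm, h0 m hm, mul_zero]
  refine generatedBy_of_pd hε hM hc hn hX.1 (fun d m hm => ?_)
    (fun a d m hm => pd_coeffY_xv hp hs hM hX a d hm)
    (fun a d m hm => pd_coeffT_xv hp hs hM hX a d hm)
    (fun m hm => by rw [← pd_t_coeffT_eq_pd_y_coeffY hp hs hε0 hM hc hX hm, hτt m hm]) hτt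
    (fun m hm => pd_t_coeffY hp hs hε0 hM hc hX hm)
    (fun a d m hm => pd_coeffV_eq_zero hp hp1 hs hε0 hM hc hX hm (h0 m hm) a d)
    (fun m hm => wave_coeffV hp hp1 hs hε0 hM hc hX h0 hm)
  have h := pd_coeffX_ytv hp hs hε0 hM hc hX (m := m)
  exact pd_eq_zero_of_coords (h0 m hm) (h 1 0 0 hm) (h 0 1 0 hm) (h 0 0 1 hm) d

theorem isPointSymmetry_of_mem_generalGenerators (hp : p ≠ 0) (hM : IsOpen M) {Y : Field}
    (hY : Y ∈ generalGenerators ε M) : IsPointSymmetry p s ε M Y := by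
  rcases hY with (rfl | rfl | rfl | rfl) | ⟨b, hb, rfl⟩
  · exact isPointSymmetry_transX hp hM
  · exact isPointSymmetry_transY hp hM
  · exact isPointSymmetry_transT hp hM
  · exact isPointSymmetry_boost hp hM
  · obtain ⟨W, hW, h⟩ := exists_waveSolution_of_travelling hM hb
    exact isPointSymmetry_shift hp hM hW h

theorem pd_x_fst (m : Total) : pd (1, 0, 0, 0) (fun m : Total => m.1) m = 1 := by
  change fderiv ℝ Prod.fst m (1, 0, 0, 0) = 1
  rw [fderiv_fst]; rfl

/-- `ξˣ_x` is a constant `c`, and `scalingShift` has `ξˣ_x = 1`. Subtracting `c • scalingShift`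
reduces to the case `ξˣ_x = 0`. -/
theorem generatedBy_insert_of_isPointSymmetry (hs : s ≠ 0)
    (hε : ε = 1 ∨ ε = -1) (hM : IsOpen M) (hc : Convex ℝ M) (hn : M.Nonempty)
    (hX : IsPointSymmetry 1 s ε M X) :
    GeneratedBy (insert scalingShift (generalGenerators ε M)) M X := by
  have hε0 : ε ≠ 0 := by rcases hε with rfl | rfl <;> norm_num
  obtain ⟨m₀, hm₀⟩ := hn
  set c := pd (1, 0, 0, 0) (coeffX X) m₀ with hc'
  have hconst : ∀ m ∈ M, pd (1, 0, 0, 0) (coeffX X) m = c := fun m hm =>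
    (eq_of_pd_eq_zero hM hc (contDiffOn_pd hM (contDiffOn_coeffX hX.1) _) hm₀ hm fun m' hm' =>
      pd_pd_x_coeffX one_ne_zero hs hε0 hM hc hX _ hm').symm
  have hX' : IsPointSymmetry 1 s ε M (X + (-c) • scalingShift) :=
    isPointSymmetry_add one_ne_zero hM hX
      (isPointSymmetry_smul one_ne_zero hM _ (isPointSymmetry_scalingShift hM))
  have h0 : ∀ m ∈ M, pd (1, 0, 0, 0) (coeffX (X + (-c) • scalingShift)) m = 0 := fun m hm => by
    have h1 := hasFDerivAt_of_mem hM (contDiffOn_coeffX hX.1) hm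
    have h2 : DifferentiableAt ℝ (fun m : Total => m.1) m := by fun_prop
    have h3 := (h1.add (h2.hasFDerivAt.const_mul (-c))).fderiv
    have h4 : pd (1, 0, 0, 0) (coeffX (X + (-c) • scalingShift)) m =
        pd (1, 0, 0, 0) (coeffX X) m + -c * pd (1, 0, 0, 0) (fun m : Total => m.1) m :=
      congrArg (fun A : Total →L[ℝ] ℝ => A (1, 0, 0, 0)) h3
    rw [h4, pd_x_fst, hconst m hm]; ring
  obtain ⟨Y, hY, hXY⟩ := generatedBy_of_isPointSymmetry one_ne_zero (by norm_num) hs hε hM hc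
    ⟨m₀, hm₀⟩ hX' h0
  refine ⟨Y + c • scalingShift, Submodule.add_mem _
    (Submodule.span_mono (Set.subset_insert _ _) hY)
    (Submodule.smul_mem _ _ (Submodule.subset_span (Set.mem_insert _ _))), fun m hm => ?_⟩
  have := hXY hm
  simp only [Pi.add_apply, Pi.smul_apply] at this ⊢
  rw [← this]; simp

/-- Every listed generator has a constant `∂ₓ`-coefficient, and so do linear combinations; for
`scalingShift` this coefficient is `x`, not constant on a non-empty open set. -/
theorem not_generatedBy_scalingShift (hM : IsOpen M) (hn : M.Nonempty) :
    ¬ GeneratedBy (generalGenerators ε M) M scalingShift := by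
  rintro ⟨Y, hY, h⟩
  have hconst : ∃ c, ∀ m, (Y m).1 = c := by
    clear h
    induction hY using Submodule.span_induction with
    | mem Y hY =>
      rcases hY with (rfl | rfl | rfl | rfl) | ⟨b, -, rfl⟩
      · exact ⟨1, fun _ => rfl⟩
      · exact ⟨0, fun _ => rfl⟩
      · exact ⟨0, fun _ => rfl⟩
      · exact ⟨0, fun _ => rfl⟩
      · exact ⟨0, fun _ => rfl⟩
    | zero => exact ⟨0, fun _ => rfl⟩
    | add Y Z _ _ hY hZ =>
      obtain ⟨c, hc⟩ := hY
      obtain ⟨d, hd⟩ := hZ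
      exact ⟨c + d, fun m => by simp [hc, hd]⟩
    | smul a Y _ hY =>
      obtain ⟨c, hc⟩ := hY
      exact ⟨a * c, fun m => by simp [hc]⟩
  obtain ⟨c, hc⟩ := hconst
  obtain ⟨m, hm⟩ := hn
  have h1 : pd (1, 0, 0, 0) (fun m : Total => m.1) m = 0 :=
    pd_eq_zero_of_const (c := c) hM
      (fun m' hm' => (congrArg Prod.fst (h hm')).trans (hc m')) _ hm
  rw [pd_x_fst] at h1
  exact one_ne_zero h1

theorem isPointSymmetry_scalingShift_iff (hp : p ≠ 0) (hs : s ≠ 0) (hε : ε ≠ 0) (hM : IsOpen M)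
    (hc : Convex ℝ M) (hn : M.Nonempty) : IsPointSymmetry p s ε M scalingShift ↔ p = 1 := by
  constructor
  · intro h
    by_contra hp1
    obtain ⟨m, hm⟩ := hn
    have h1 := pd_x_coeffX_eq_zero hp hp1 hs hε hM hc h hm
    exact one_ne_zero ((pd_x_fst m).symm.trans h1)
  · rintro rfl
    exact isPointSymmetry_scalingShift hM

end Generation

end GB

theorem theorem3p2 (p s ε : ℝ) (hp : p ≠ 0) (hs : s = 1 ∨ s = -1) (hε : ε = 1 ∨ ε = -1)
    (M : Set GB.Total) (hMo : IsOpen M) (hMc : Convex ℝ M) (hMn : M.Nonempty) :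
    -- the listed generators, and their linear combinations, are point symmetries
    (∀ X : GB.Field, GB.GeneratedBy (GB.generalGenerators ε M) M X →
      GB.IsPointSymmetry p s ε M X) ∧
    -- there are no others when the equation is nonlinear and `p ≠ 1`
    (p ≠ -1 → p ≠ 1 → ∀ X : GB.Field, GB.IsPointSymmetry p s ε M X →
      GB.GeneratedBy (GB.generalGenerators ε M) M X) ∧
    -- for `p = 1` there is exactly one additional generator
    (p = 1 → ∀ X : GB.Field, GB.IsPointSymmetry p s ε M X ↔
      GB.GeneratedBy (insert GB.scalingShift (GB.generalGenerators ε M)) M X) ∧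
    -- which is a point symmetry only for `p = 1`, and is not among the others
    (GB.IsPointSymmetry p s ε M GB.scalingShift ↔ p = 1) ∧
    ¬ GB.GeneratedBy (GB.generalGenerators ε M) M GB.scalingShift ∧
    -- the shift functions are the general solution of `W_tt - ε W_yy = 0`
    (∀ b : GB.Total → ℝ, b ∈ GB.travelling ε M ↔
      ∃ W : ℝ × ℝ → ℝ,
        GB.IsWaveSolution ε ((fun m : GB.Total => (m.2.1, m.2.2.1)) '' M) W ∧
        ∀ m ∈ M, b m = W (m.2.1, m.2.2.1)) := by
  have hs0 : s ≠ 0 := by rcases hs with rfl | rfl <;> norm_num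
  have hε0 : ε ≠ 0 := by rcases hε with rfl | rfl <;> norm_num
  refine ⟨fun X hX => ?_, fun hp1 hp1' X hX => ?_, ?_, ?_, ?_, fun b => ⟨fun hb => ?_, ?_⟩⟩
  · exact GB.isPointSymmetry_of_span hp hMo
      (fun Y hY => GB.isPointSymmetry_of_mem_generalGenerators hp hMo hY) hX
  · exact GB.generatedBy_of_isPointSymmetry hp hp1 hs0 hε hMo hMc hMn hX fun m hm =>
      GB.pd_x_coeffX_eq_zero hp hp1' hs0 hε0 hMo hMc hX hm
  · rintro rfl X
    refine ⟨GB.generatedBy_insert_of_isPointSymmetry hs0 hε hMo hMc hMn,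
      GB.isPointSymmetry_of_span hp hMo ?_⟩
    rintro Y (rfl | hY)
    · exact GB.isPointSymmetry_scalingShift hMo
    · exact GB.isPointSymmetry_of_mem_generalGenerators hp hMo hY
  · exact GB.isPointSymmetry_scalingShift_iff hp hs0 hε0 hMo hMc hMn
  · exact GB.not_generatedBy_scalingShift hMo hMn
  · exact GB.exists_waveSolution_of_travelling hMo hb
  · rintro ⟨W, hW, h⟩
    exact GB.travelling_of_waveSolution hε hMo hMc hW h
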